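/- Let $S^1$ be the circle of radius $a>0$, let $\mathcal V$ be a complex Hermitian vector bundle of rank $N$ over $S^1$ with metric connection $D=\partial_x$; in a parallel unitary frame, sections are functions $u:\mathbb R\to\mathbb C^N$ with $u(x+2\pi a)=Wu(x)$ for a fixed unitary matrix $W$ ($W=1$ gives periodic functions). Let $Q$ be a smooth Hermitian endomorphism of $\mathcal V$, let $L=-D^2+Q$ act on smooth sections, and let $(\lambda_n)$ be the (real) eigenvalues of $L$ repeated according to multiplicity. Let $\lambda\in\mathbb C$ with $\operatorname{Re}\lambda<\lambda_n$ for all $n$ (for instance, $\lambda$ real and sufficiently large negative). The heat trace $\Theta(t)=\sum_n e^{-t\lambda_n}$ converges for all $t>0$; define $\Omega(t)$ by $\Theta(t)=(4\pi t)^{-1/2}\Omega(t)$. (i) For $\operatorname{Re}q<0$ the integral $$B_q(\lambda)=\frac1{\Gamma(-q)}\int_0^\infty t^{-q-1}e^{t\lambda}\,\Omega(t)\,dt$$ converges absolutely, and $q\mapsto B_q(\lambda)$ extends uniquely to an entire function of $q$, again denoted $B_q(\lambda)$. (ii) The series $\zeta(s,\lambda)=\sum_n(\lambda_n-\lambda)^{-s}$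 (principal branch) converges absolutely for $\operatorname{Re}s>\tfrac12$ and extends uniquely to a meromorphic function of $s\in\mathbb C$. For all $s\in\mathbb C\setminus\{\tfrac12-k: k=0,1,2,\dots\}$, $$\zeta(s,\lambda)=(4\pi)^{-1/2}\,\frac{\Gamma(s-\frac12)}{\Gamma(s)}\,B_{\frac12-s}(\lambda),$$ where $1/\Gamma(s)$ is read as $0$ at $s=0,-1,-2,\dots$. (iii) Consequently $\zeta(\cdot,\lambda)$ is analytic at $s=0$ and $\zeta(0,\lambda)=0$. Moreover, with $\log\operatorname{Det}(L-\lambda):=-\partial_s\zeta(s,\lambda)|_{s=0}$, the function $e^{t\lambda}\Omega(t)$ is differentiable on $(0,\infty)$, the integral below converges absolutely, and $$\log\operatorname{Det}(L-\lambda)=B_{1/2}(\lambda)=-\frac1{\sqrt\pi}\int_0^\infty t^{-1/2}\,\partial_t\!\left[e^{t\lambda}\Omega(t)\right]dt .$$ -/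

import Mathlib

open scoped ContDiff Real Matrix

noncomputable section

namespace CircleLaplace

/-- Smooth sections of the rank-`N` Hermitian vector bundle over the circle of radius `a`, with its
metric connection `D = ∂ₓ`. In a parallel unitary frame, a smooth section is a smooth map
`u : ℝ → ℂᴺ` with `u (x + 2πa) = W (u x)`, where the unitary matrix `W` is the gluing matrix of the
bundle. The product bundle (periodic sections) is `W = 1`. -/
def smoothSections {N : ℕ} (a : ℝ) (W : Matrix.unitaryGroup (Fin N) ℂ) :
    Submodule ℂ (ℝ → Fin N → ℂ) where
  carrier := {u | ContDiff ℝ ∞ u ∧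
    ∀ x, u (x + 2 * π * a) = (W : Matrix (Fin N) (Fin N) ℂ) *ᵥ u x}
  add_mem' := by
    rintro u v ⟨hu, hu'⟩ ⟨hv, hv'⟩
    refine ⟨hu.add hv, fun x => ?_⟩
    simp [hu' x, hv' x, Matrix.mulVec_add]
  zero_mem' := ⟨contDiff_const, fun x => by simp⟩
  smul_mem' := by
    rintro c u ⟨hu, hu'⟩
    refine ⟨contDiff_const.smul hu, fun x => ?_⟩
    simp [hu' x, Matrix.mulVec_smul]

/-- A smooth Hermitian endomorphism of the bundle, written in the same frame. -/
structure Potential {N : ℕ} (a : ℝ) (W : Matrix.unitaryGroup (Fin N) ℂ) where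
  toFun : ℝ → Matrix (Fin N) (Fin N) ℂ
  smooth : ∀ i j, ContDiff ℝ ∞ (fun x => toFun x i j)
  hermitian : ∀ x, (toFun x).IsHermitian
  equivariant : ∀ x, toFun (x + 2 * π * a) * (W : Matrix (Fin N) (Fin N) ℂ) =
    (W : Matrix (Fin N) (Fin N) ℂ) * toFun x

variable {N : ℕ} {a : ℝ} {W : Matrix.unitaryGroup (Fin N) ℂ}

/-- The derivative of a smooth section is a smooth section. -/
theorem deriv_mem {u : ℝ → Fin N → ℂ} (hu : u ∈ smoothSections a W) :
    deriv u ∈ smoothSections a W := by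
  obtain ⟨h1, h2⟩ := hu
  refine ⟨(contDiff_infty_iff_deriv.1 h1).2, fun x => ?_⟩
  have hd : HasDerivAt u (deriv u x) x := (contDiff_infty_iff_deriv.1 h1).1.differentiableAt.hasDerivAt
  have hA : HasDerivAt (fun y => (W : Matrix (Fin N) (Fin N) ℂ) *ᵥ u y)
      ((W : Matrix (Fin N) (Fin N) ℂ) *ᵥ deriv u x) x := by
    rw [hasDerivAt_pi] at hd ⊢
    intro i
    simp only [Matrix.mulVec, dotProduct]
    exact HasDerivAt.fun_sum fun j _ => (hd j).const_mul _
  have hB : deriv (fun y => u (y + 2 * π * a)) x = deriv u (x + 2 * π * a) :=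
    deriv_comp_add_const u (2 * π * a) x
  rw [← hB, ← hA.deriv]
  exact congrArg (fun f => deriv f x) (funext h2)

/-- The action of an endomorphism maps smooth sections to smooth sections. -/
theorem mulVec_mem (Q : Potential a W) {u : ℝ → Fin N → ℂ} (hu : u ∈ smoothSections a W) :
    (fun x => Q.toFun x *ᵥ u x) ∈ smoothSections a W := by
  obtain ⟨h1, h2⟩ := hu
  refine ⟨?_, fun x => ?_⟩
  · rw [contDiff_pi] at h1 ⊢
    intro i
    simp only [Matrix.mulVec, dotProduct]
    exact ContDiff.sum fun j _ => (Q.smooth i j).mul (h1 j)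
  · simp only [h2 x, Matrix.mulVec_mulVec, Q.equivariant x]

/-- The Laplace type operator `L = -D² + Q` on smooth sections. -/
def laplaceOp (Q : Potential a W) : Module.End ℂ (smoothSections a W) where
  toFun u := ⟨fun x => -deriv (deriv u.1) x + Q.toFun x *ᵥ u.1 x,
    (smoothSections a W).add_mem
      ((smoothSections a W).neg_mem (deriv_mem (deriv_mem u.2))) (mulVec_mem Q u.2)⟩
  map_add' u v := by
    have hd : ∀ w ∈ smoothSections a W, Differentiable ℝ w :=
      fun w hw => (contDiff_infty_iff_deriv.1 hw.1).1
    have h1 : deriv (u.1 + v.1) = deriv u.1 + deriv v.1 :=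
      funext fun x => deriv_add (hd _ u.2 x) (hd _ v.2 x)
    have h2 : deriv (deriv u.1 + deriv v.1) = deriv (deriv u.1) + deriv (deriv v.1) :=
      funext fun x => deriv_add (hd _ (deriv_mem u.2) x) (hd _ (deriv_mem v.2) x)
    ext x : 2
    simp only [Submodule.coe_add, h1, h2, Pi.add_apply, Matrix.mulVec_add]
    abel
  map_smul' c u := by
    have hd : ∀ w ∈ smoothSections a W, Differentiable ℝ w :=
      fun w hw => (contDiff_infty_iff_deriv.1 hw.1).1
    have h1 : deriv (c • u.1) = c • deriv u.1 :=
      funext fun x => deriv_const_smul c (hd _ u.2 x)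
    have h2 : deriv (c • deriv u.1) = c • deriv (deriv u.1) :=
      funext fun x => deriv_const_smul c (hd _ (deriv_mem u.2) x)
    ext x : 2
    simp only [Submodule.coe_smul, h1, h2, Pi.smul_apply, Matrix.mulVec_smul, RingHom.id_apply,
      smul_add, smul_neg]

/-- Index set of the eigenvalues of `L` (all of them are real), each one repeated according to its
multiplicity. Eigenspaces are finite-dimensional, so `finrank` is the true dimension. -/
def EigenIndex (Q : Potential a W) : Type :=
  Σ μ : ℝ, Fin (Module.finrank ℂ (Module.End.eigenspace (laplaceOp Q) (μ : ℂ)))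

/-- The eigenvalue `λₙ`. -/
def eigenvalue (Q : Potential a W) (n : EigenIndex Q) : ℝ := n.1

/-- The heat trace `Θ(t) = ∑ₙ exp(-t λₙ)`. -/
def heatTrace (Q : Potential a W) (t : ℝ) : ℝ :=
  ∑' n : EigenIndex Q, Real.exp (-t * eigenvalue Q n)

/-- The function `Ω(t)`, `t > 0`, with `Θ(t) = (4πt)^{-1/2} Ω(t)`. -/
def Omega (Q : Potential a W) (t : ℝ) : ℝ := √(4 * π * t) * heatTrace Q t

/-- `e^{tλ} Ω(t)`. -/
def expOmega (Q : Potential a W) (lam : ℂ) (t : ℝ) : ℂ :=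
  Complex.exp (t * lam) * (Omega Q t : ℂ)

/-- `B` is the function `q ↦ B_q(λ)`: it is entire, and for `Re q < 0` it is given by the
convergent integral `Γ(-q)⁻¹ ∫₀^∞ t^{-q-1} e^{tλ} Ω(t) dt`. -/
def IsModifiedMellin (Q : Potential a W) (lam : ℂ) (B : ℂ → ℂ) : Prop :=
  Differentiable ℂ B ∧ ∀ q : ℂ, q.re < 0 →
    MeasureTheory.IntegrableOn (fun t : ℝ => (t : ℂ) ^ (-q - 1) * expOmega Q lam t) (Set.Ioi 0) ∧
    B q = 1 / Complex.Gamma (-q) *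
      ∫ t in Set.Ioi (0 : ℝ), (t : ℂ) ^ (-q - 1) * expOmega Q lam t

/-- `Z` is the zeta function `s ↦ ζ(s,λ)`: the meromorphic function on `ℂ` given by the convergent
series `∑ₙ (λₙ - λ)^{-s}` when `Re s` is sufficiently large. Normal form means that `Z` takes its
analytic value wherever it has no pole. -/
def IsZeta (Q : Potential a W) (lam : ℂ) (Z : ℂ → ℂ) : Prop :=
  MeromorphicNFOn Z Set.univ ∧ ∃ σ : ℝ, ∀ s : ℂ, σ < s.re →
    HasSum (fun n : EigenIndex Q => ((eigenvalue Q n : ℂ) - lam) ^ (-s)) (Z s)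

/-- `log Det (L - λ) = -∂ₛ ζ(s,λ)` at `s = 0`, for the zeta function `Z = ζ(·,λ)`. -/
def logDet (Z : ℂ → ℂ) : ℂ := -deriv Z 0

end CircleLaplace

end

/-! Put f(t) = e^{tλ} Ω(t). Everything rests on two facts (`polyApprox_Omega`): the heat trace
converges for t > 0, and Ω has at t = 0⁺ an asymptotic expansion to every order in nonnegative
integer powers of t, expressed by `PolyApprox`.

From these facts to the theorem. Subtract P(t) e^{-t} from f with P polynomial. The Mellin transform
of P(t) e^{-t} is Γ times a polynomial, and the remainder is O(t^M) at 0, so Γ(-q)⁻¹ times the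
Mellin transform of f continues to Re q < M for every M (`exists_entire_mellin`). Summing (λₙ -
λ)^{-s} Γ(s) = ∫ t^{s-1} e^{-t(λₙ - λ)} dt over n gives the formula for ζ where Re s > 1/2
(`hasSum_zeta`), and the identity theorem gives it elsewhere. At s = 0 the factor 1/Γ(s) has a
simple zero, and (4π)^{-1/2} Γ(-1/2) = -1 gives -ζ'(0) = B_{1/2}. One integration by parts moves the
integral representation of B to Re q < 1. It requires f' to be bounded near 0; an asymptotic
expansion may not be differentiated, so this comes from Landau's interpolation between the expansion
of f and a crude bound on f'' (`bounded_deriv_of_approx`).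

The expansion of Ω. Diagonalising the gluing matrix W and twisting by phases makes all sections
periodic (`exists_frame`). In Fourier space the operator becomes a diagonal part freq², the
frequencies forming shifted lattices, plus a rapidly decaying matrix depending only on differences
of modes. The heat kernel satisfies Duhamel's equation (`heatKer_eq`), so it is the sum of its Dyson
series. In each Dyson term the exponent is a convex combination of squares (ξ + kᵢ)², that is, (ξ +
mean)² + variance; so the term of index k is t^k times a mixture of Gaussians exp(-t((ξ + b)² + V))
(`GaussMix`). The trace sums ξ over a lattice, and by Poisson summation √(4πt) Σ exp(-t(om·l + b)²)
is a constant up to O(t^∞), uniformly in b (`exists_gaussSum_sub_le`). What remains is an integral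
of e^{-tV} in which V has all moments, hence an expansion in powers of t.

The trace is linked to the eigenvalues by an orthonormal eigenbasis (`exists_isEigenbasis`). It
comes from the spectral theorem for the compact symmetric injective operator (L + c)⁻¹, built by a
Neumann series for large c. Its eigenvectors decay rapidly by bootstrapping, hence are Fourier
coefficients of smooth sections, so multiplicities agree. -/

noncomputable section

namespace CircleLaplace

open MeasureTheory Set Filter Topology Asymptotics

section

/-! ### Sums of complex exponentials and their derivatives -/

section HeatSum

variable {ι : Type*} {z : ι → ℂ} {K δ : ℝ}

/-- The sums `∑ₙ (-zₙ)ʲ exp(-t zₙ)`. -/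
def heatSum (z : ι → ℂ) (j : ℕ) (t : ℝ) : ℂ := ∑' n, (-z n) ^ j * Complex.exp (-(t * z n))

/-- Half of the exponential absorbs the power: x^j ≤ j! e^x with x = t·Re w / 2, and the sector
condition bounds ‖w‖ by K·Re w. -/
theorem norm_heatTerm_le {w : ℂ} (hK : 0 ≤ K) (h0 : 0 ≤ w.re) (hw : ‖w‖ ≤ K * w.re) (j : ℕ)
    {t : ℝ} (ht : 0 < t) :
    ‖(-w) ^ j * Complex.exp (-(t * w))‖ ≤
      (2 * K / t) ^ j * j.factorial * Real.exp (-(t / 2) * w.re) := by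
  rw [norm_mul, norm_pow, norm_neg, Complex.norm_exp]
  have hre : (-(t * w) : ℂ).re = -(t * w.re) := by simp
  have h1 : (t / 2 * w.re) ^ j ≤ j.factorial * Real.exp (t / 2 * w.re) := by
    have := Real.pow_div_factorial_le_exp (t / 2 * w.re) (by positivity) j
    rwa [div_le_iff₀' (by positivity)] at this
  have h2 : ‖w‖ ^ j ≤ (2 * K / t) ^ j * (t / 2 * w.re) ^ j := by
    rw [← mul_pow]
    refine pow_le_pow_left₀ (norm_nonneg _) (hw.trans_eq ?_) j
    field_simp
  rw [hre]
  calc ‖w‖ ^ j * Real.exp (-(t * w.re))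
      ≤ (2 * K / t) ^ j * (j.factorial * Real.exp (t / 2 * w.re)) * Real.exp (-(t * w.re)) := by
        gcongr
        exact h2.trans (by gcongr)
    _ = _ := by
        have : Real.exp (-(t / 2) * w.re) = Real.exp (t / 2 * w.re) * Real.exp (-(t * w.re)) := by
          rw [← Real.exp_add]; ring_nf
        rw [this]; ring

variable (hδ : 0 < δ) (hz : ∀ n, δ ≤ (z n).re) (hK : 0 ≤ K) (hzK : ∀ n, ‖z n‖ ≤ K * (z n).re)
  (hs : ∀ t : ℝ, 0 < t → Summable fun n => Real.exp (-t * (z n).re))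

include hδ hz hK hzK hs

theorem summable_norm_heatTerm (j : ℕ) {t : ℝ} (ht : 0 < t) :
    Summable fun n => ‖(-z n) ^ j * Complex.exp (-(t * z n))‖ :=
  Summable.of_nonneg_of_le (fun _ => norm_nonneg _)
    (fun n => norm_heatTerm_le hK (hδ.le.trans (hz n)) (hzK n) j ht)
    ((hs (t / 2) (by positivity)).mul_left _)

/-- Termwise differentiation on the half-line (t/2, ∞), where every differentiated term is dominated
by its bound at t/2. -/
theorem hasDerivAt_heatSum (j : ℕ) {t : ℝ} (ht : 0 < t) :
    HasDerivAt (heatSum z j) (heatSum z (j + 1) t) t := by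
  have hsum := (summable_norm_heatTerm hδ hz hK hzK hs j ht).of_norm
  refine hasDerivAt_tsum_of_isPreconnected (t := Ioi (t / 2)) (y₀ := t)
    (g := fun n (y : ℝ) => (-z n) ^ j * Complex.exp (-(y * z n)))
    (g' := fun n (y : ℝ) => (-z n) ^ (j + 1) * Complex.exp (-(y * z n)))
    (u := fun n => (2 * K / (t / 2)) ^ (j + 1) * (j + 1).factorial *
      Real.exp (-(t / 2 / 2) * (z n).re))
    ((hs (t / 2 / 2) (by positivity)).mul_left _) isOpen_Ioi isPreconnected_Ioi ?_ ?_
    (by simp [ht]) hsum (by simp [ht])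
  · intro n y _
    have h1 : HasDerivAt (fun y : ℝ => (-((y : ℂ) * z n))) (-(((1 : ℝ) : ℂ) * z n)) y :=
      ((hasDerivAt_id y).ofReal_comp.mul_const (z n)).neg
    have h2 := h1.cexp.const_mul ((-z n) ^ j)
    rw [show (-z n) ^ (j + 1) * Complex.exp (-(y * z n)) =
      (-z n) ^ j * (Complex.exp (-(y * z n)) * -(((1 : ℝ) : ℂ) * z n)) by push_cast; ring]
    exact h2
  · intro n y hy
    have hy : t / 2 < y := hy
    have hy0 : 0 < y := by linarith
    have h0 := hδ.le.trans (hz n)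
    refine (norm_heatTerm_le hK h0 (hzK n) (j + 1) hy0).trans ?_
    gcongr

theorem norm_heatSum_le (j : ℕ) {t : ℝ} (ht : 0 < t) :
    ‖heatSum z j t‖ ≤
      (2 * K / t) ^ j * j.factorial * ∑' n, Real.exp (-(t / 2) * (z n).re) := by
  rw [← tsum_mul_left]
  exact tsum_of_norm_bounded ((hs (t / 2) (by positivity)).mul_left _).hasSum
    fun n => norm_heatTerm_le hK (hδ.le.trans (hz n)) (hzK n) j ht

-- For t ≤ 1 the hypothesis suffices, since e^δ e^{-δt} ≥ 1. For t ≥ 1 the spectral gap gives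
-- e^{-tx} ≤ e^{δ-δt} e^{-x} whenever x ≥ δ, which reduces to the sum at t = 1.
omit hK hzK in
theorem exists_tsum_exp_le {C : ℝ}
    (hC : ∀ t ∈ Ioc (0 : ℝ) 1, ∑' n, Real.exp (-t * (z n).re) ≤ C * t ^ (-(1 / 2) : ℝ)) :
    ∃ C', 0 ≤ C' ∧ ∀ t, 0 < t →
      ∑' n, Real.exp (-t * (z n).re) ≤ C' * (1 + t ^ (-(1 / 2) : ℝ)) * Real.exp (-δ * t) := by
  have hC0 : 0 ≤ C := by
    have := hC 1 (by simp)
    simp only [Real.one_rpow, mul_one] at this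
    exact (tsum_nonneg fun n => (Real.exp_pos _).le).trans this
  have hX0 : 0 ≤ ∑' n, Real.exp (-1 * (z n).re) := tsum_nonneg fun n => (Real.exp_pos _).le
  refine ⟨(C + ∑' n, Real.exp (-1 * (z n).re)) * Real.exp δ, by positivity, fun t ht => ?_⟩
  rcases le_total t 1 with h | h
  · refine (hC t ⟨ht, h⟩).trans ?_
    have h1 : 1 ≤ Real.exp δ * Real.exp (-δ * t) := by
      rw [← Real.exp_add]; exact Real.one_le_exp (by nlinarith)
    have h2 : 0 ≤ t ^ (-(1 / 2) : ℝ) := by positivity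
    calc C * t ^ (-(1 / 2) : ℝ) ≤ (C + ∑' n, Real.exp (-1 * (z n).re)) *
          (1 + t ^ (-(1 / 2) : ℝ)) * 1 := by nlinarith [mul_nonneg hX0 h2]
      _ ≤ (C + ∑' n, Real.exp (-1 * (z n).re)) *
          (1 + t ^ (-(1 / 2) : ℝ)) * (Real.exp δ * Real.exp (-δ * t)) := by gcongr
      _ = _ := by ring
  · have h1 : ∑' n, Real.exp (-t * (z n).re) ≤
        ∑' n, Real.exp (δ - δ * t) * Real.exp (-1 * (z n).re) := by
      refine (hs t ht).tsum_le_tsum (fun n => ?_) ((hs 1 one_pos).mul_left _)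
      rw [← Real.exp_add]
      refine Real.exp_le_exp.2 ?_
      nlinarith [hz n]
    refine h1.trans ?_
    rw [tsum_mul_left, sub_eq_add_neg, Real.exp_add]
    have h2 : 0 ≤ t ^ (-(1 / 2) : ℝ) := by positivity
    have h3 : Real.exp (-(δ * t)) = Real.exp (-δ * t) := by ring_nf
    rw [h3]
    have h4 : 0 < Real.exp δ * Real.exp (-δ * t) := by positivity
    have h5 : ∑' n, Real.exp (-1 * (z n).re) ≤
        (C + ∑' n, Real.exp (-1 * (z n).re)) * (1 + t ^ (-(1 / 2) : ℝ)) := by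
      nlinarith [mul_nonneg hX0 h2, mul_nonneg hC0 h2]
    calc _ ≤ (Real.exp δ * Real.exp (-δ * t)) *
          ((C + ∑' n, Real.exp (-1 * (z n).re)) * (1 + t ^ (-(1 / 2) : ℝ))) := by gcongr
      _ = _ := by ring

/-- Decay of the heat sums, uniformly on `(0, ∞)`. -/
theorem exists_norm_heatSum_le {C : ℝ}
    (hC : ∀ t ∈ Ioc (0 : ℝ) 1, ∑' n, Real.exp (-t * (z n).re) ≤ C * t ^ (-(1 / 2) : ℝ)) (j : ℕ) :
    ∃ C', 0 ≤ C' ∧ ∀ t, 0 < t →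
      ‖heatSum z j t‖ ≤ C' * t ^ (-j : ℝ) * (1 + t ^ (-(1 / 2) : ℝ)) * Real.exp (-(δ / 2) * t) := by
  obtain ⟨C', hC', h⟩ := exists_tsum_exp_le hδ hz hs hC
  refine ⟨(2 * K) ^ j * j.factorial * (C' * 2), by positivity, fun t ht => ?_⟩
  refine (norm_heatSum_le hδ hz hK hzK hs j ht).trans ?_
  have h1 := h (t / 2) (by positivity)
  have h2 : (t / 2) ^ (-(1 / 2) : ℝ) ≤ 2 * t ^ (-(1 / 2) : ℝ) := by
    rw [Real.div_rpow ht.le (by norm_num), Real.rpow_neg (by norm_num : (0 : ℝ) ≤ 2), div_inv_eq_mul,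
      mul_comm]
    gcongr
    calc (2 : ℝ) ^ (1 / 2 : ℝ) ≤ 2 ^ (1 : ℝ) := by gcongr <;> norm_num
      _ = 2 := by norm_num
  have h3 : ∑' n, Real.exp (-(t / 2) * (z n).re) ≤
      C' * 2 * (1 + t ^ (-(1 / 2) : ℝ)) * Real.exp (-(δ / 2) * t) := by
    refine h1.trans ?_
    have h4 : Real.exp (-δ * (t / 2)) = Real.exp (-(δ / 2) * t) := by ring_nf
    rw [h4, mul_assoc C' 2]
    gcongr
    linarith
  calc _ ≤ (2 * K / t) ^ j * j.factorial *
        (C' * 2 * (1 + t ^ (-(1 / 2) : ℝ)) * Real.exp (-(δ / 2) * t)) := by gcongr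
    _ = _ := by
      rw [div_pow, Real.rpow_neg ht.le j, Real.rpow_natCast]
      ring

end HeatSum

/-! ### Landau interpolation for the first derivative -/

section Landau

/-- Landau's interpolation: if `f` is approximated to order five by a function with bounded
derivatives and `f''` grows at most like `t⁻³`, then `f'` is bounded near `0`. -/
theorem bounded_deriv_of_approx {f f' f'' : ℝ → ℂ} (P : Polynomial ℂ) {C C' : ℝ}
    (hf : ∀ t, 0 < t → HasDerivAt f (f' t) t) (hf' : ∀ t, 0 < t → HasDerivAt f' (f'' t) t)
    (hP : ∀ t ∈ Ioc (0 : ℝ) 1, ‖f t - P.eval (t : ℂ)‖ ≤ C * t ^ 5)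
    (hf'' : ∀ t ∈ Ioc (0 : ℝ) 1, ‖f'' t‖ ≤ C' * t ^ (-3 : ℝ)) :
    ∃ B, ∀ t ∈ Ioc (0 : ℝ) (1 / 2), ‖f' t‖ ≤ B := by
  have hPd : ∀ (R : Polynomial ℂ) (t : ℝ), HasDerivAt (fun t : ℝ => R.eval (t : ℂ))
      (R.derivative.eval (t : ℂ)) t := fun R t => (R.hasDerivAt (t : ℂ)).comp_ofReal
  have hbd : ∀ R : Polynomial ℂ, ∃ B, ∀ t ∈ Icc (0 : ℝ) 1, ‖R.eval (t : ℂ)‖ ≤ B := by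
    intro R
    have hc : Continuous fun t : ℝ => R.eval (t : ℂ) :=
      R.continuous.comp Complex.continuous_ofReal
    exact isCompact_Icc.exists_bound_of_continuousOn hc.continuousOn
  obtain ⟨B1, hB1⟩ := hbd P.derivative
  obtain ⟨B2, hB2⟩ := hbd P.derivative.derivative
  have hC : 0 ≤ C := by simpa using (norm_nonneg _).trans (hP 1 (by simp))
  have hC' : 0 ≤ C' := by simpa using (norm_nonneg _).trans (hf'' 1 (by simp))
  have hB2' : 0 ≤ B2 := (norm_nonneg _).trans (hB2 1 (by simp))
  -- 33 = 2⁵ + 1: the order-five error is used at t + h ≤ 2t and at t. The restriction t ≤ 1/2 keeps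
  -- t + h inside (0, 1].
  refine ⟨B1 + (C' + B2) + C * 33, fun t ht => ?_⟩
  obtain ⟨ht0, ht1⟩ := ht
  have ht4 : t ^ 4 ≤ t := by
    calc t ^ 4 ≤ t ^ 1 := pow_le_pow_of_le_one ht0.le (by linarith) (by norm_num)
      _ = t := pow_one t
  have hh : 0 < t ^ 4 := by positivity
  -- The increment t⁴ makes both errors of the difference quotient O(t): the approximation error is
  -- O(t⁵)/h, the curvature error h·O(t⁻³).
  set h := t ^ 4 with hdef
  set r : ℝ → ℂ := fun s => f s - P.eval (s : ℂ)
  set r' : ℝ → ℂ := fun s => f' s - P.derivative.eval (s : ℂ)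
  have hr : ∀ s, 0 < s → HasDerivAt r (r' s) s := fun s hs => (hf s hs).sub (hPd P s)
  have hr' : ∀ s, 0 < s → HasDerivAt r' (f'' s - P.derivative.derivative.eval (s : ℂ)) s :=
    fun s hs => (hf' s hs).sub (hPd _ s)
  have hsub : ∀ s ∈ Icc t (t + h), 0 < s ∧ s ≤ 1 := fun s hs =>
    ⟨ht0.trans_le hs.1, by linarith [hs.2]⟩
  have hb : ∀ s ∈ Icc t (t + h), ‖r' s - r' t‖ ≤ (C' + B2) * t ^ (-3 : ℝ) * h := by
    intro s hs
    have := (convex_Icc t (t + h)).norm_image_sub_le_of_norm_hasDerivWithin_le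
      (f := r') (C := (C' + B2) * t ^ (-3 : ℝ))
      (fun s hs => (hr' s (hsub s hs).1).hasDerivWithinAt) ?_ (left_mem_Icc.2 (by linarith)) hs
    · refine this.trans ?_
      gcongr
      rw [Real.norm_eq_abs, abs_of_nonneg] <;> linarith [hs.1, hs.2]
    · intro s hs
      obtain ⟨hs0, hs1⟩ := hsub s hs
      have h1 : ‖f'' s‖ ≤ C' * t ^ (-3 : ℝ) := by
        refine (hf'' s ⟨hs0, hs1⟩).trans ?_
        gcongr C' * ?_
        exact Real.rpow_le_rpow_of_nonpos ht0 hs.1 (by norm_num)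
      have h2 : ‖P.derivative.derivative.eval (s : ℂ)‖ ≤ B2 * t ^ (-3 : ℝ) := by
        refine (hB2 s ⟨hs0.le, hs1⟩).trans ?_
        exact le_mul_of_one_le_right hB2'
          (Real.one_le_rpow_of_pos_of_le_one_of_nonpos ht0 (by linarith) (by norm_num))
      calc _ ≤ ‖f'' s‖ + ‖P.derivative.derivative.eval (s : ℂ)‖ := norm_sub_le _ _
        _ ≤ _ := by linarith
  have ht3 : t ^ (-3 : ℝ) * h = t := by
    rw [Real.rpow_neg ht0.le, hdef]
    norm_cast
    field_simp
  have hb' : ∀ s ∈ Icc t (t + h), ‖r' s - r' t‖ ≤ (C' + B2) * t := by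
    intro s hs
    have := hb s hs
    rwa [mul_assoc, ht3] at this
  -- Mean value inequality for s ↦ r(s) - s·r'(t), whose derivative r'(s) - r'(t) has just been
  -- bounded.
  have hmv : ‖(r (t + h) - (t + h : ℝ) * r' t) - (r t - t * r' t)‖ ≤ (C' + B2) * t * h := by
    have := (convex_Icc t (t + h)).norm_image_sub_le_of_norm_hasDerivWithin_le
      (f := fun s : ℝ => r s - s * r' t) (f' := fun s => r' s - 1 * r' t) (C := (C' + B2) * t)
      (fun s hs => ((hr s (hsub s hs).1).sub
        ((Complex.ofRealCLM.hasDerivAt (x := s)).mul_const (r' t))).hasDerivWithinAt)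
      (by simpa using hb') (left_mem_Icc.2 (by linarith)) (right_mem_Icc.2 (by linarith))
    refine this.trans ?_
    rw [Real.norm_eq_abs, abs_of_nonneg] <;> linarith
  have hr1 : ‖r (t + h)‖ ≤ C * 32 * t * h := by
    refine (hP (t + h) ⟨by linarith, by linarith⟩).trans ?_
    calc C * (t + h) ^ 5 ≤ C * (2 * t) ^ 5 := by gcongr; linarith
      _ = _ := by rw [hdef]; ring
  have hr2 : ‖r t‖ ≤ C * t * h := by
    refine (hP t ⟨by linarith, by linarith⟩).trans_eq ?_
    rw [hdef]; ring
  have hmul : h * ‖r' t‖ ≤ ((C' + B2) * t + C * 33 * t) * h := by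
    have : (h : ℂ) * r' t = r (t + h) - r t -
        ((r (t + h) - (t + h : ℝ) * r' t) - (r t - t * r' t)) := by push_cast; ring
    calc h * ‖r' t‖ = ‖(h : ℂ) * r' t‖ := by
          rw [norm_mul, Complex.norm_real, Real.norm_eq_abs, abs_of_pos hh]
      _ ≤ ‖r (t + h)‖ + ‖r t‖ + (C' + B2) * t * h := by
          rw [this]
          refine (norm_sub_le _ _).trans ?_
          exact add_le_add (norm_sub_le _ _) hmv
      _ ≤ _ := by nlinarith
  have hr't : ‖r' t‖ ≤ (C' + B2) + C * 33 := by
    have h1 : ‖r' t‖ ≤ (C' + B2) * t + C * 33 * t := by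
      rw [mul_comm] at hmul
      exact le_of_mul_le_mul_right hmul hh
    refine h1.trans ?_
    have : 0 ≤ C' + B2 := by linarith
    nlinarith
  have : f' t = r' t + P.derivative.eval (t : ℂ) := by simp [r']
  rw [this]
  refine (norm_add_le _ _).trans ?_
  linarith [hB1 t ⟨ht0.le, by linarith⟩]

end Landau

end

section

/-! ### Continuation of the modified Mellin transform -/

section Mellin

/-- `Γ(s)⁻¹` times the Mellin transform of a polynomial times `e⁻ᵗ` is entire. -/
theorem exists_hasMellin_polynomial_mul_exp (P : Polynomial ℂ) :
    ∃ E : ℂ → ℂ, Differentiable ℂ E ∧ ∀ s : ℂ, 0 < s.re →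
      HasMellin (fun t : ℝ => P.eval (t : ℂ) * (Real.exp (-t) : ℂ)) s (Complex.Gamma s * E s) := by
  induction P using Polynomial.induction_on' with
  | add P R hP hR =>
    obtain ⟨E, hE, h⟩ := hP
    obtain ⟨F, hF, h'⟩ := hR
    refine ⟨fun s => E s + F s, hE.add hF, fun s hs => ?_⟩
    have := hasMellin_add (h s hs).1 (h' s hs).1
    rw [(h s hs).2, (h' s hs).2, ← mul_add] at this
    simpa only [Polynomial.eval_add, add_mul] using this
  | monomial k a =>
    refine ⟨fun s => a * (ascPochhammer ℂ k).eval s,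
      (ascPochhammer ℂ k).differentiable.const_mul a, fun s hs => ?_⟩
    -- The Mellin transform of t^k e^{-t} is Γ(s + k), and the rising factorial is what remains
    -- after dividing by Γ(s).
    have hG : ∀ k : ℕ, Complex.Gamma (s + k) =
        Complex.Gamma s * (ascPochhammer ℂ k).eval s := by
      intro k
      induction k with
      | zero => simp
      | succ k ih =>
        have hne : s + k ≠ 0 := by
          intro h
          have := congrArg Complex.re h
          simp at this
          have : (0 : ℝ) ≤ k := k.cast_nonneg
          linarith
        rw [Nat.cast_succ, ← add_assoc, Complex.Gamma_add_one _ hne, ih, ascPochhammer_succ_eval]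
        ring
    have hs' : 0 < (s + k).re := by
      have : (0 : ℝ) ≤ k := k.cast_nonneg
      simp; linarith
    have hcongr : ∀ t ∈ Ioi (0 : ℝ), (t : ℂ) ^ (s - 1) •
        ((Polynomial.monomial k a).eval (t : ℂ) * (Real.exp (-t) : ℂ)) =
        a * ((Real.exp (-t) : ℂ) * (t : ℂ) ^ (s + k - 1)) := by
      intro t ht
      have ht0 : (t : ℂ) ≠ 0 := by exact_mod_cast (ne_of_gt ht)
      rw [Polynomial.eval_monomial, smul_eq_mul, add_sub_right_comm, Complex.cpow_add _ _ ht0,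
        Complex.cpow_natCast]
      ring
    constructor
    · refine (integrableOn_congr_fun hcongr measurableSet_Ioi).2 ?_
      exact (Complex.GammaIntegral_convergent hs').const_mul a
    · rw [mellin, setIntegral_congr_fun measurableSet_Ioi hcongr]
      have := Complex.Gamma_eq_integral hs'
      rw [Complex.GammaIntegral] at this
      rw [integral_const_mul, ← this, hG]
      ring

/-- Identity theorem on a convex half-plane, anchored at a point to the left of both boundary lines.
-/
theorem eqOn_halfPlane {f g : ℂ → ℂ} {c d : ℝ} (hf : DifferentiableOn ℂ f {q | q.re < c})
    (hg : DifferentiableOn ℂ g {q | q.re < c}) (h : ∀ q : ℂ, q.re < d → f q = g q) :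
    EqOn f g {q | q.re < c} := by
  have ho : ∀ c : ℝ, IsOpen {q : ℂ | q.re < c} := fun c =>
    isOpen_lt Complex.continuous_re continuous_const
  have hpre : IsPreconnected {q : ℂ | q.re < c} :=
    (convex_halfSpace_re_lt c).isPreconnected
  refine (hf.analyticOnNhd (ho c)).eqOn_of_preconnected_of_eventuallyEq
    (hg.analyticOnNhd (ho c)) hpre (z₀ := ((min c d - 1 : ℝ) : ℂ)) ?_ ?_
  · simp only [mem_ofPred_eq, Complex.ofReal_re]
    linarith [min_le_left c d]
  · refine Filter.eventually_of_mem ((ho d).mem_nhds ?_) h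
    simp only [mem_ofPred_eq, Complex.ofReal_re]
    linarith [min_le_right c d]

/-- Continuations to different half-planes agree on their overlap by the identity theorem, so the
value at q may be read off from any half-plane containing q; near q a single one serves, which gives
differentiability. -/
theorem exists_entire_of_halfPlanes {F : ℂ → ℂ}
    (h : ∀ M : ℕ, ∃ B : ℂ → ℂ, DifferentiableOn ℂ B {q | q.re < M} ∧
      ∀ q : ℂ, q.re < 0 → B q = F q) :
    ∃ B : ℂ → ℂ, Differentiable ℂ B ∧ ∀ q : ℂ, q.re < 0 → B q = F q := by
  choose B hB hF using h
  have hlt : ∀ q : ℂ, q.re < ((⌈q.re⌉₊ + 1 : ℕ) : ℝ) := fun q => by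
    push_cast
    linarith [Nat.le_ceil q.re]
  have key : ∀ (M : ℕ) (q : ℂ), q.re < M → B M q = B (⌈q.re⌉₊ + 1) q := by
    intro M q hq
    have hmono : ∀ z : ℂ, z.re < min (M : ℝ) ((⌈q.re⌉₊ + 1 : ℕ) : ℝ) →
        z.re < M ∧ z.re < ((⌈q.re⌉₊ + 1 : ℕ) : ℝ) := fun z hz =>
      ⟨hz.trans_le (min_le_left _ _), hz.trans_le (min_le_right _ _)⟩
    exact eqOn_halfPlane (d := 0) ((hB M).mono fun z hz => (hmono z hz).1)
      ((hB _).mono fun z hz => (hmono z hz).2) (fun z hz => (hF M z hz).trans (hF _ z hz).symm)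
      (lt_min hq (hlt q))
  refine ⟨fun q => B (⌈q.re⌉₊ + 1) q, fun q => ?_, fun q hq => hF _ q hq⟩
  have hnhds : {z : ℂ | z.re < ((⌈q.re⌉₊ + 1 : ℕ) : ℝ)} ∈ 𝓝 q :=
    (isOpen_lt Complex.continuous_re continuous_const).mem_nhds (hlt q)
  refine ((hB (⌈q.re⌉₊ + 1)).differentiableAt hnhds).congr_of_eventuallyEq ?_
  filter_upwards [hnhds] with z hz
  exact (key _ z hz).symm

variable {f f' : ℝ → ℂ} {a : ℝ}

theorem isBigO_polynomial_mul_exp (P : Polynomial ℂ) {a : ℝ} (ha : a < 1) :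
    (fun t : ℝ => P.eval (t : ℂ) * (Real.exp (-t) : ℂ)) =O[atTop] fun t => Real.exp (-a * t) := by
  induction P using Polynomial.induction_on' with
  | add P R hP hR =>
    simpa only [Polynomial.eval_add, add_mul] using hP.add hR
  | monomial k c =>
    have h1 := (isLittleO_pow_exp_pos_mul_atTop k (sub_pos.2 ha)).isBigO
    have h2 := (h1.mul (isBigO_refl (fun t : ℝ => Real.exp (-t)) atTop)).const_mul_left ‖c‖
    have h3 : (fun t : ℝ => Real.exp ((1 - a) * t) * Real.exp (-t)) =
        fun t => Real.exp (-a * t) := by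
      funext t
      rw [← Real.exp_add]; ring_nf
    rw [h3] at h2
    refine IsBigO.trans (IsBigO.of_bound 1 ?_) h2
    filter_upwards with t
    simp [mul_assoc, Complex.norm_exp]

/-- The modified Mellin transform extends to an entire function. -/
theorem exists_entire_mellin (ha : 0 < a) (hc : ContinuousOn f (Ioi 0))
    (htop : f =O[atTop] fun t => Real.exp (-a * t))
    (hP : ∀ M : ℕ, ∃ (P : Polynomial ℂ) (C : ℝ), ∀ t ∈ Ioc (0 : ℝ) 1,
      ‖f t - P.eval (t : ℂ) * (Real.exp (-t) : ℂ)‖ ≤ C * t ^ M) :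
    ∃ B : ℂ → ℂ, Differentiable ℂ B ∧
      ∀ q : ℂ, q.re < 0 → B q = 1 / Complex.Gamma (-q) * mellin f (-q) := by
  refine exists_entire_of_halfPlanes fun M => ?_
  have hO : ∀ (M : ℕ) (P : Polynomial ℂ) (C : ℝ), (∀ t ∈ Ioc (0 : ℝ) 1,
      ‖f t - P.eval (t : ℂ) * (Real.exp (-t) : ℂ)‖ ≤ C * t ^ M) →
      (fun t : ℝ => f t - P.eval (t : ℂ) * (Real.exp (-t) : ℂ)) =O[𝓝[>] 0]
        (· ^ (-(-M : ℝ)) : ℝ → ℝ) := by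
    intro M P C h
    refine IsBigO.of_bound C ?_
    filter_upwards [Ioc_mem_nhdsGT one_pos] with t ht
    rw [neg_neg, Real.rpow_natCast, Real.norm_eq_abs, abs_of_nonneg (pow_nonneg ht.1.le _)]
    exact h t ht
  have hPc : ∀ P : Polynomial ℂ, Continuous fun t : ℝ => P.eval (t : ℂ) * (Real.exp (-t) : ℂ) :=
    fun P => (P.continuous.comp Complex.continuous_ofReal).mul (by fun_prop)
  -- The decay rate must not exceed a, and must stay below 1 to absorb the polynomial in P(t)
  -- e^{-t}.
  have htop' : ∀ P : Polynomial ℂ, (fun t : ℝ => f t - P.eval (t : ℂ) * (Real.exp (-t) : ℂ))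
      =O[atTop] fun t => Real.exp (-(min a (1 / 2)) * t) := by
    intro P
    refine IsBigO.sub (htop.trans (IsBigO.of_bound 1 ?_))
      (isBigO_polynomial_mul_exp P ((min_le_right _ _).trans_lt (by norm_num)))
    filter_upwards [eventually_ge_atTop 0] with t ht
    rw [Real.norm_eq_abs, Real.norm_eq_abs, abs_of_pos (Real.exp_pos _),
      abs_of_pos (Real.exp_pos _), one_mul]
    refine Real.exp_le_exp.2 ?_
    nlinarith [min_le_left a (1 / 2)]
  have hmin : 0 < min a (1 / 2) := lt_min ha (by norm_num)
  have hloc : ∀ P : Polynomial ℂ, LocallyIntegrableOn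
      (fun t : ℝ => f t - P.eval (t : ℂ) * (Real.exp (-t) : ℂ)) (Ioi 0) := fun P =>
    (hc.sub (hPc P).continuousOn).locallyIntegrableOn measurableSet_Ioi
  obtain ⟨P, C, hPC⟩ := hP M
  obtain ⟨E, hE, hM⟩ := exists_hasMellin_polynomial_mul_exp P
  -- The subtracted part P(t) e^{-t} contributes E(-q) once Γ(-q) cancels. The remainder is O(t^M)
  -- at 0, so its Mellin transform at -q is holomorphic for Re q < M; the factor e^{-t} preserves
  -- the decay at infinity.
  refine ⟨fun q => E (-q) + 1 / Complex.Gamma (-q) *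
    mellin (fun t : ℝ => f t - P.eval (t : ℂ) * (Real.exp (-t) : ℂ)) (-q), ?_, ?_⟩
  · intro q hq
    have h1 : DifferentiableAt ℂ
        (mellin (fun t : ℝ => f t - P.eval (t : ℂ) * (Real.exp (-t) : ℂ))) (-q) :=
      mellin_differentiableAt_of_isBigO_rpow_exp hmin (hloc P) (htop' P) (hO M P C hPC)
        (by simpa using hq)
    have h2 : DifferentiableAt ℂ (fun q => 1 / Complex.Gamma (-q)) q := by
      simp only [one_div]
      exact (Complex.differentiable_one_div_Gamma.comp differentiable_neg) q
    exact (((hE.comp differentiable_neg) q).add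
      (h2.mul (h1.comp q differentiable_neg.differentiableAt))).differentiableWithinAt
  · intro q hq
    have hs : 0 < (-q).re := by simpa using hq
    have hconv : MellinConvergent
        (fun t : ℝ => f t - P.eval (t : ℂ) * (Real.exp (-t) : ℂ)) (-q) :=
      mellinConvergent_of_isBigO_rpow_exp hmin (hloc P) (htop' P) (hO M P C hPC)
        (by
          have : (0 : ℝ) ≤ M := M.cast_nonneg
          linarith)
    have hadd := (hasMellin_add hconv (hM _ hs).1).2
    simp only [sub_add_cancel] at hadd
    have hΓ : Complex.Gamma (-q) ≠ 0 := Complex.Gamma_ne_zero_of_re_pos hs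
    rw [hadd, (hM _ hs).2]
    field_simp
    ring

/-- Integration by parts. The boundary term t^s f(t) vanishes at 0 because f is bounded there and Re
s > 0, and at infinity by exponential decay. -/
theorem mellin_deriv_add_one (ha : 0 < a) (hf : ∀ t, 0 < t → HasDerivAt f (f' t) t)
    (hc' : ContinuousOn f' (Ioi 0)) (htop : f =O[atTop] fun t => Real.exp (-a * t))
    (htop' : f' =O[atTop] fun t => Real.exp (-a * t))
    (hbot : f =O[𝓝[>] 0] (fun _ => (1 : ℝ))) (hbot' : f' =O[𝓝[>] 0] (fun _ => (1 : ℝ)))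
    {s : ℂ} (hs : 0 < s.re) : mellin f' (s + 1) = -(s * mellin f s) := by
  have hb : ∀ {g : ℝ → ℂ}, g =O[𝓝[>] 0] (fun _ => (1 : ℝ)) →
      g =O[𝓝[>] 0] (· ^ (-0 : ℝ) : ℝ → ℝ) := fun h => by simpa using h
  have hc : ContinuousOn f (Ioi 0) := fun t ht => (hf t ht).continuousAt.continuousWithinAt
  have h1 : MellinConvergent f s := mellinConvergent_of_isBigO_rpow_exp ha
    (hc.locallyIntegrableOn measurableSet_Ioi) htop (hb hbot) hs
  have h2 : MellinConvergent f' (s + 1) := mellinConvergent_of_isBigO_rpow_exp ha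
    (hc'.locallyIntegrableOn measurableSet_Ioi) htop' (hb hbot') (by simp; linarith)
  have hs0 : s ≠ 0 := by rintro rfl; simp at hs
  have hint : IntegrableOn (fun t : ℝ => s * (t : ℂ) ^ (s - 1) * f t + (t : ℂ) ^ s * f' t)
      (Ioi 0) := by
    have h3 := (h1.const_mul s).add h2
    refine h3.congr (ae_of_all _ fun t => ?_)
    simp [smul_eq_mul, mul_assoc]
  have hderiv : ∀ t ∈ Ioi (0 : ℝ), HasDerivAt (fun t : ℝ => (t : ℂ) ^ s * f t)
      (s * (t : ℂ) ^ (s - 1) * f t + (t : ℂ) ^ s * f' t) t := by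
    intro t ht
    exact (hasDerivAt_ofReal_cpow_const (ne_of_gt ht) hs0).mul (hf t ht)
  have hnorm : ∀ t : ℝ, 0 < t → ‖(t : ℂ) ^ s‖ = t ^ s.re := fun t ht =>
    Complex.norm_cpow_eq_rpow_re_of_pos ht s
  have hlim : Tendsto (fun t : ℝ => (t : ℂ) ^ s * f t) atTop (𝓝 0) := by
    have h3 : (fun t : ℝ => (t : ℂ) ^ s * f t) =O[atTop]
        fun t => t ^ s.re * Real.exp (-a * t) := by
      refine IsBigO.mul (IsBigO.of_bound 1 ?_) htop
      filter_upwards [eventually_gt_atTop 0] with t ht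
      rw [hnorm t ht, Real.norm_eq_abs, one_mul]
      exact le_abs_self _
    exact h3.trans_tendsto (tendsto_rpow_mul_exp_neg_mul_atTop_nhds_zero s.re a ha)
  have hcont : ContinuousWithinAt (fun t : ℝ => (t : ℂ) ^ s * f t) (Ici 0) 0 := by
    have h3 : Tendsto (fun t : ℝ => (t : ℂ) ^ s * f t) (𝓝[>] 0) (𝓝 0) := by
      have h4 : (fun t : ℝ => (t : ℂ) ^ s * f t) =O[𝓝[>] 0]
          fun t => t ^ s.re * 1 := by
        refine IsBigO.mul (IsBigO.of_bound 1 ?_) hbot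
        filter_upwards [self_mem_nhdsWithin] with t ht
        rw [hnorm t ht, Real.norm_eq_abs, one_mul]
        exact le_abs_self _
      refine h4.trans_tendsto ?_
      have h5 : Tendsto (fun t : ℝ => t ^ s.re) (𝓝[>] 0) (𝓝 (0 ^ s.re)) :=
        ((Real.continuousAt_rpow_const 0 s.re (Or.inr hs.le)).tendsto).mono_left
          nhdsWithin_le_nhds
      simpa [Real.zero_rpow hs.ne'] using h5
    rw [← continuousWithinAt_Ioi_iff_Ici, ContinuousWithinAt]
    simpa [Complex.zero_cpow hs0] using h3
  have := integral_Ioi_of_hasDerivAt_of_tendsto hcont hderiv hint hlim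
  have hsplit : ∫ t in Ioi (0 : ℝ), (s * (t : ℂ) ^ (s - 1) * f t + (t : ℂ) ^ s * f' t) =
      s * mellin f s + mellin f' (s + 1) := by
    rw [mellin, mellin, ← integral_const_mul, ← integral_add (h1.const_mul s) h2]
    refine integral_congr_ae (ae_of_all _ fun t => ?_)
    simp [smul_eq_mul, mul_assoc]
  rw [hsplit] at this
  simp [Complex.zero_cpow hs0] at this
  linear_combination this

/-- The value of the modified Mellin transform at `1/2` in terms of the derivative. -/
theorem modifiedMellin_half (ha : 0 < a) (hf : ∀ t, 0 < t → HasDerivAt f (f' t) t)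
    (hc' : ContinuousOn f' (Ioi 0)) (htop : f =O[atTop] fun t => Real.exp (-a * t))
    (htop' : f' =O[atTop] fun t => Real.exp (-a * t))
    (hbot : f =O[𝓝[>] 0] (fun _ => (1 : ℝ))) (hbot' : f' =O[𝓝[>] 0] (fun _ => (1 : ℝ)))
    {B : ℂ → ℂ} (hB : Differentiable ℂ B)
    (hBf : ∀ q : ℂ, q.re < 0 → B q = 1 / Complex.Gamma (-q) * mellin f (-q)) :
    MellinConvergent f' (1 / 2) ∧
      B (1 / 2) = -((π : ℝ) : ℂ) ^ (-(1 / 2) : ℂ) * mellin f' (1 / 2) := by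
  have hb : f' =O[𝓝[>] 0] (· ^ (-0 : ℝ) : ℝ → ℝ) := by simpa using hbot'
  have hloc := hc'.locallyIntegrableOn (μ := volume) measurableSet_Ioi
  refine ⟨mellinConvergent_of_isBigO_rpow_exp ha hloc htop' hb (by norm_num), ?_⟩
  -- Since Γ(1-q) = -q Γ(-q), integration by parts yields this formula for Re q < 0. Its right side
  -- is holomorphic for Re q < 1 because f' is bounded near 0, so the identity extends past q = 1/2.
  have hE : EqOn B (fun q => -(1 / Complex.Gamma (1 - q)) * mellin f' (1 - q))
      {q | q.re < 1} := by
    refine eqOn_halfPlane (d := 0) hB.differentiableOn ?_ ?_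
    · intro q hq
      have hq' : 0 < (1 - q).re := by
        have : q.re < 1 := hq
        simp; linarith
      have h1 : DifferentiableAt ℂ (mellin f') (1 - q) :=
        mellin_differentiableAt_of_isBigO_rpow_exp ha hloc htop' hb hq'
      have h3 : DifferentiableAt ℂ (fun q : ℂ => 1 - q) q := by fun_prop
      have h2 : DifferentiableAt ℂ (fun q => -(1 / Complex.Gamma (1 - q))) q := by
        simp only [one_div]
        exact ((Complex.differentiable_one_div_Gamma _).comp q h3).neg
      exact (h2.mul (h1.comp q h3)).differentiableWithinAt
    · intro q hq
      have hs : 0 < (-q).re := by simpa using hq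
      have hq0 : -q ≠ 0 := by intro h; rw [h] at hs; simp at hs
      have hΓ : Complex.Gamma (-q) ≠ 0 := Complex.Gamma_ne_zero_of_re_pos hs
      rw [hBf q hq]
      rw [show 1 - q = -q + 1 by ring, Complex.Gamma_add_one _ hq0,
        mellin_deriv_add_one ha hf hc' htop htop' hbot hbot' hs]
      have hq0' : q ≠ 0 := neg_ne_zero.1 hq0
      field_simp
  have h := hE (show ((1 : ℂ) / 2).re < 1 by norm_num)
  simp only at h
  rw [h, show (1 : ℂ) - 1 / 2 = 1 / 2 by norm_num, Complex.Gamma_one_half_eq, Complex.cpow_neg,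
    one_div (_ ^ _)]

end Mellin

end

/-! ### Asymptotic expansions at 0 in nonnegative integer powers -/

section

/-- `f` is approximated near `0⁺` to every order by polynomials. -/
def PolyApprox (f : ℝ → ℂ) : Prop :=
  ∀ M : ℕ, ∃ (P : Polynomial ℂ) (C : ℝ), ∀ t ∈ Ioc (0 : ℝ) 1, ‖f t - P.eval (t : ℂ)‖ ≤ C * t ^ M

namespace PolyApprox

variable {f g : ℝ → ℂ}

theorem congr (hf : PolyApprox f) (h : ∀ t ∈ Ioc (0 : ℝ) 1, f t = g t) : PolyApprox g := by
  intro M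
  obtain ⟨P, C, hP⟩ := hf M
  exact ⟨P, C, fun t ht => h t ht ▸ hP t ht⟩

theorem polynomial (P : Polynomial ℂ) : PolyApprox fun t => P.eval (t : ℂ) :=
  fun M => ⟨P, 0, fun t ht => by simp⟩

theorem add (hf : PolyApprox f) (hg : PolyApprox g) : PolyApprox fun t => f t + g t := by
  intro M
  obtain ⟨P, C, hP⟩ := hf M
  obtain ⟨R, D, hR⟩ := hg M
  refine ⟨P + R, C + D, fun t ht => ?_⟩
  rw [Polynomial.eval_add, add_sub_add_comm, add_mul]
  exact (norm_add_le _ _).trans (add_le_add (hP t ht) (hR t ht))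

theorem sum {ι : Type*} (s : Finset ι) {f : ι → ℝ → ℂ} (h : ∀ i ∈ s, PolyApprox (f i)) :
    PolyApprox fun t => ∑ i ∈ s, f i t := by
  classical
  induction s using Finset.induction_on with
  | empty => simpa using polynomial 0
  | insert i s hi ih =>
    simp only [Finset.sum_insert hi]
    exact (h i (Finset.mem_insert_self i s)).add
      (ih fun j hj => h j (Finset.mem_insert_of_mem hj))

theorem bounded (hf : PolyApprox f) : ∃ B, 0 ≤ B ∧ ∀ t ∈ Ioc (0 : ℝ) 1, ‖f t‖ ≤ B := by
  obtain ⟨P, C, hP⟩ := hf 0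
  have hc : Continuous fun t : ℝ => P.eval (t : ℂ) := P.continuous.comp Complex.continuous_ofReal
  obtain ⟨D, hD⟩ := isCompact_Icc.exists_bound_of_continuousOn
    (hc.continuousOn (s := Icc (0 : ℝ) 1))
  have hb : ∀ t ∈ Ioc (0 : ℝ) 1, ‖f t‖ ≤ C + D := by
    intro t ht
    calc ‖f t‖ = ‖f t - P.eval (t : ℂ) + P.eval (t : ℂ)‖ := by simp
      _ ≤ _ := (norm_add_le _ _).trans
        (add_le_add (by simpa using hP t ht) (hD t ⟨ht.1.le, ht.2⟩))
  exact ⟨C + D, (norm_nonneg _).trans (hb 1 (by simp)), hb⟩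

theorem mul (hf : PolyApprox f) (hg : PolyApprox g) : PolyApprox fun t => f t * g t := by
  intro M
  obtain ⟨A, hA, hfA⟩ := hf.bounded
  obtain ⟨P, C, hP⟩ := hf M
  obtain ⟨R, D, hR⟩ := hg M
  obtain ⟨B, hB, hgB⟩ := (polynomial R).bounded
  refine ⟨P * R, A * D + C * B, fun t ht => ?_⟩
  have h : f t * g t - (P * R).eval (t : ℂ) =
      f t * (g t - R.eval (t : ℂ)) + (f t - P.eval (t : ℂ)) * R.eval (t : ℂ) := by
    rw [Polynomial.eval_mul]; ring
  have hD : 0 ≤ D * t ^ M := (norm_nonneg _).trans (hR t ht)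
  have hC : 0 ≤ C * t ^ M := (norm_nonneg _).trans (hP t ht)
  calc _ ≤ ‖f t‖ * ‖g t - R.eval (t : ℂ)‖ + ‖f t - P.eval (t : ℂ)‖ * ‖R.eval (t : ℂ)‖ := by
        rw [h, ← norm_mul, ← norm_mul]; exact norm_add_le _ _
    _ ≤ A * (D * t ^ M) + C * t ^ M * B :=
        add_le_add (mul_le_mul (hfA t ht) (hR t ht) (norm_nonneg _) hA)
          (mul_le_mul (hP t ht) (hgB t ht) (norm_nonneg _) hC)
    _ = _ := by ring

theorem exp (c : ℂ) : PolyApprox fun t => Complex.exp (t * c) := by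
  intro M
  refine ⟨∑ m ∈ Finset.range M, Polynomial.C (c ^ m / m.factorial) * Polynomial.X ^ m,
    ‖c‖ ^ M * Real.exp ‖c‖, fun t ht => ?_⟩
  have h := Complex.norm_exp_sub_sum_le_norm_mul_exp (t * c) M
  have h1 : ‖(t * c : ℂ)‖ = t * ‖c‖ := by
    rw [norm_mul, Complex.norm_real, Real.norm_eq_abs, abs_of_pos ht.1]
  rw [h1] at h
  have h2 : (∑ m ∈ Finset.range M, Polynomial.C (c ^ m / m.factorial) * Polynomial.X ^ m).eval
      (t : ℂ) = ∑ m ∈ Finset.range M, (t * c) ^ m / m.factorial := by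
    rw [Polynomial.eval_finsetSum]
    refine Finset.sum_congr rfl fun m _ => ?_
    simp only [Polynomial.eval_mul, Polynomial.eval_C, Polynomial.eval_pow, Polynomial.eval_X]
    ring
  rw [h2]
  refine h.trans ?_
  have h3 : Real.exp (t * ‖c‖) ≤ Real.exp ‖c‖ :=
    Real.exp_le_exp.2 (mul_le_of_le_one_left (norm_nonneg _) ht.2)
  calc (t * ‖c‖) ^ M * Real.exp (t * ‖c‖) ≤ (t * ‖c‖) ^ M * Real.exp ‖c‖ := by
        have := ht.1
        gcongr
    _ = _ := by ring

/-- Allows the approximants to have only expansions themselves. It serves twice below: to replace a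
Gaussian sum by a constant, and to truncate the Dyson series. -/
theorem of_approx (h : ∀ M : ℕ, ∃ g : ℝ → ℂ, PolyApprox g ∧
    ∃ C, ∀ t ∈ Ioc (0 : ℝ) 1, ‖f t - g t‖ ≤ C * t ^ M) : PolyApprox f := by
  intro M
  obtain ⟨g, hg, C, hC⟩ := h M
  obtain ⟨P, D, hP⟩ := hg M
  refine ⟨P, C + D, fun t ht => ?_⟩
  rw [← sub_add_sub_cancel _ (g t), add_mul]
  exact (norm_add_le _ _).trans (add_le_add (hC t ht) (hP t ht))

end PolyApprox

/-! ### Regularity of e^{tλ} Ω(t) -/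

section Heat

variable {ι : Type*} {p : ι → ℝ} {lam : ℂ}

/-- Summability of e^{-p n} leaves only finitely many values below Re λ + 1, so the strict
inequalities become uniform. -/
theorem exists_gap (hp : ∀ n, lam.re < p n) (hs : Summable fun n => Real.exp (-1 * p n)) :
    ∃ δ, 0 < δ ∧ ∀ n, δ ≤ p n - lam.re := by
  have hfin : {n | p n < lam.re + 1}.Finite := by
    have h := hs.tendsto_cofinite_zero.eventually (gt_mem_nhds (Real.exp_pos (-1 * (lam.re + 1))))
    rw [Filter.eventually_cofinite] at h
    refine h.subset fun n hn => ?_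
    simp only [mem_ofPred_eq, not_lt, Real.exp_le_exp] at hn ⊢
    linarith
  obtain ⟨δ, hδ, h⟩ : ∃ δ, 0 < δ ∧ ∀ n ∈ {n | p n < lam.re + 1}, δ ≤ p n - lam.re := by
    rcases {n | p n < lam.re + 1}.eq_empty_or_nonempty with he | hne
    · exact ⟨1, one_pos, fun n hn => by simp [he] at hn⟩
    · obtain ⟨m, hm, hmin⟩ := hfin.exists_minimalFor (fun n => p n - lam.re) _ hne
      refine ⟨p m - lam.re, sub_pos.2 (hp m), fun n hn => ?_⟩
      rcases le_total (p m - lam.re) (p n - lam.re) with h | h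
      · exact h
      · exact hmin hn h
  refine ⟨min δ 1, lt_min hδ one_pos, fun n => ?_⟩
  by_cases hn : p n < lam.re + 1
  · exact (min_le_left _ _).trans (h n hn)
  · exact (min_le_right _ _).trans (by linarith)

/-- Properties of `f(t) = e^{tλ} Ω(t)` needed for the Mellin transform. -/
structure HeatRegular (f f' : ℝ → ℂ) (a : ℝ) : Prop where
  pos : 0 < a
  deriv : ∀ t, 0 < t → HasDerivAt f (f' t) t
  cont : ContinuousOn f' (Ioi 0)
  top : f =O[atTop] fun t => Real.exp (-a * t)
  top' : f' =O[atTop] fun t => Real.exp (-a * t)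
  bot : f =O[𝓝[>] 0] (fun _ => (1 : ℝ))
  bot' : f' =O[𝓝[>] 0] (fun _ => (1 : ℝ))
  approx : PolyApprox f

/-- With z n = p n - λ the function is √(4π) t^{1/2} Σ e^{-t z n}, and its derivatives combine terms
t^r times heat sums. The gap gives decay at infinity and the expansion gives boundedness at 0;
boundedness of the derivative at 0 needs Landau interpolation. -/
theorem exists_heatRegular (hp : ∀ n, lam.re < p n)
    (hs : ∀ t : ℝ, 0 < t → Summable fun n => Real.exp (-t * p n))
    (hP : PolyApprox fun t => ((√(4 * π * t) * ∑' n, Real.exp (-t * p n) : ℝ) : ℂ)) :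
    ∃ f' a, HeatRegular (fun t : ℝ => Complex.exp (t * lam) *
      ((√(4 * π * t) * ∑' n, Real.exp (-t * p n) : ℝ) : ℂ)) f' a := by
  obtain ⟨δ, hδ, hgap⟩ := exists_gap hp (hs 1 one_pos)
  set z : ι → ℂ := fun n => (p n : ℂ) - lam with hzdef
  have hre : ∀ n, (z n).re = p n - lam.re := fun n => by simp [z]
  have hz : ∀ n, δ ≤ (z n).re := fun n => (hgap n).trans_eq (hre n).symm
  have hexp : ∀ (t : ℝ) n, Real.exp (-t * (z n).re) =
      Real.exp (t * lam.re) * Real.exp (-t * p n) := fun t n => by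
    rw [hre, ← Real.exp_add]; ring_nf
  have hs' : ∀ t : ℝ, 0 < t → Summable fun n => Real.exp (-t * (z n).re) := fun t ht => by
    simp only [hexp]
    exact (hs t ht).mul_left _
  -- All z n have the same |Im z n| = |Im λ| and real part at least δ, so they lie in one sector.
  set K : ℝ := 1 + |lam.im| / δ with hKdef
  have hK : 0 ≤ K := by positivity
  have hzK : ∀ n, ‖z n‖ ≤ K * (z n).re := by
    intro n
    have h1 := Complex.norm_le_abs_re_add_abs_im (z n)
    have h2 : |(z n).im| = |lam.im| := by simp [z]
    have h3 : 0 < (z n).re := hδ.trans_le (hz n)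
    have h4 : |lam.im| ≤ |lam.im| / δ * (z n).re := by
      rw [div_mul_eq_mul_div, le_div_iff₀ hδ]
      exact mul_le_mul_of_nonneg_left (hz n) (abs_nonneg _)
    rw [h2, abs_of_pos h3] at h1
    rw [hKdef]; linarith
  set Om : ℝ → ℂ := fun t => ((√(4 * π * t) * ∑' n, Real.exp (-t * p n) : ℝ) : ℂ) with hOm
  obtain ⟨B, hB0, hB⟩ := hP.bounded
  have hC : ∀ t ∈ Ioc (0 : ℝ) 1, ∑' n, Real.exp (-t * (z n).re) ≤
      (Real.exp |lam.re| * B) * t ^ (-(1 / 2) : ℝ) := by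
    intro t ht
    have ht0 : 0 < t := ht.1
    simp only [hexp]
    rw [tsum_mul_left]
    have h1 := hB t ht
    have hX0 : 0 ≤ ∑' n, Real.exp (-t * p n) := tsum_nonneg fun n => (Real.exp_pos _).le
    rw [Complex.norm_real, Real.norm_eq_abs, abs_of_nonneg (by positivity)] at h1
    have h2 : √t ≤ √(4 * π * t) := Real.sqrt_le_sqrt (by nlinarith [Real.pi_gt_three])
    have h3 : ∑' n, Real.exp (-t * p n) ≤ B * t ^ (-(1 / 2) : ℝ) := by
      rw [Real.rpow_neg ht0.le, ← Real.sqrt_eq_rpow, ← div_eq_mul_inv,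
        le_div_iff₀ (Real.sqrt_pos.2 ht0)]
      nlinarith
    have h4 : Real.exp (t * lam.re) ≤ Real.exp |lam.re| := by
      refine Real.exp_le_exp.2 ?_
      calc t * lam.re ≤ t * |lam.re| := by gcongr; exact le_abs_self _
        _ ≤ |lam.re| := mul_le_of_le_one_left (abs_nonneg _) ht.2
    rw [mul_assoc]
    exact mul_le_mul h4 h3 hX0 (Real.exp_pos _).le
  have hH := fun j t ht => hasDerivAt_heatSum hδ hz hK hzK hs' j (t := t) ht
  have hbd := exists_norm_heatSum_le hδ hz hK hzK hs' hC
  set c : ℂ := ((√(4 * π) : ℝ) : ℂ) with hc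
  -- powers of `t` times heat sums
  let A : ℝ → ℕ → ℝ → ℂ := fun r j t => ((t ^ r : ℝ) : ℂ) * heatSum z j t
  have hA : ∀ r j t, 0 < t → HasDerivAt (A r j) (r * A (r - 1) j t + A r (j + 1) t) t := by
    intro r j t ht
    have h1 : HasDerivAt (fun t : ℝ => ((t ^ r : ℝ) : ℂ)) ((r * t ^ (r - 1) : ℝ) : ℂ) t :=
      (Real.hasDerivAt_rpow_const (Or.inl ht.ne')).ofReal_comp
    have h2 := h1.mul (hH j t ht)
    refine h2.congr_deriv ?_
    simp only [A]; push_cast; ring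
  have hAtop : ∀ r j, A r j =O[atTop] fun t => Real.exp (-(δ / 4) * t) := by
    intro r j
    obtain ⟨C', hC', h⟩ := hbd j
    have h1 := (isLittleO_rpow_exp_pos_mul_atTop r (by positivity : (0 : ℝ) < δ / 4)).isBigO
    have h2 := h1.mul (isBigO_refl (fun t : ℝ => Real.exp (-(δ / 2) * t)) atTop)
    have h3 : (fun t : ℝ => Real.exp (δ / 4 * t) * Real.exp (-(δ / 2) * t)) =
        fun t => Real.exp (-(δ / 4) * t) := by
      funext t; rw [← Real.exp_add]; ring_nf
    rw [h3] at h2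
    refine IsBigO.trans (IsBigO.of_bound (C' * 2) ?_) h2
    filter_upwards [eventually_ge_atTop 1] with t ht
    have ht0 : 0 < t := one_pos.trans_le ht
    have h4 : t ^ (-j : ℝ) ≤ 1 := Real.rpow_le_one_of_one_le_of_nonpos ht (by simp)
    have h5 : t ^ (-(1 / 2) : ℝ) ≤ 1 := Real.rpow_le_one_of_one_le_of_nonpos ht (by norm_num)
    have h6 : 0 ≤ t ^ r := by positivity
    have h7 : 0 ≤ t ^ (-j : ℝ) := by positivity
    have h8 : 0 ≤ t ^ (-(1 / 2) : ℝ) := by positivity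
    simp only [A]
    rw [norm_mul, Complex.norm_real, Real.norm_eq_abs, Real.norm_eq_abs, abs_of_nonneg h6,
      abs_of_nonneg (by positivity)]
    calc t ^ r * ‖heatSum z j t‖ ≤ t ^ r * (C' * 1 * (1 + 1) * Real.exp (-(δ / 2) * t)) := by
          refine mul_le_mul_of_nonneg_left ((h t ht0).trans ?_) h6
          gcongr
      _ = _ := by ring
  -- The heat sum of index j is O(t^{-j-1/2}), so the term is O(t^{r-j-1/2}), and this exponent is
  -- at least -3 under the hypothesis.
  have hAbot : ∀ (r : ℝ) (j : ℕ), -(5 / 2) ≤ r - (j : ℝ) → ∃ D, ∀ t ∈ Ioc (0 : ℝ) 1,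
      ‖A r j t‖ ≤ D * t ^ (-3 : ℝ) := by
    intro r j hrj
    obtain ⟨C', hC', h⟩ := hbd j
    refine ⟨C' * 2, fun t ht => ?_⟩
    obtain ⟨ht0, ht1⟩ := ht
    have h5 : 1 ≤ t ^ (-(1 / 2) : ℝ) :=
      Real.one_le_rpow_of_pos_of_le_one_of_nonpos ht0 ht1 (by norm_num)
    have h6 : 0 ≤ t ^ r := by positivity
    have h7 : t ^ r * t ^ (-j : ℝ) * t ^ (-(1 / 2) : ℝ) ≤ t ^ (-3 : ℝ) := by
      rw [← Real.rpow_add ht0, ← Real.rpow_add ht0]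
      exact Real.rpow_le_rpow_of_exponent_ge ht0 ht1 (by linarith)
    have h8 : Real.exp (-(δ / 2) * t) ≤ 1 := Real.exp_le_one_iff.2 (by nlinarith)
    simp only [A]
    rw [norm_mul, Complex.norm_real, Real.norm_eq_abs, abs_of_nonneg h6]
    calc t ^ r * ‖heatSum z j t‖ ≤ t ^ r * (C' * t ^ (-j : ℝ) *
          (t ^ (-(1 / 2) : ℝ) + t ^ (-(1 / 2) : ℝ)) * 1) := by
          refine mul_le_mul_of_nonneg_left ((h t ht0).trans ?_) h6
          gcongr
      _ = C' * 2 * (t ^ r * t ^ (-j : ℝ) * t ^ (-(1 / 2) : ℝ)) := by ring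
      _ ≤ _ := by gcongr
  set f : ℝ → ℂ := fun t : ℝ => Complex.exp (t * lam) * Om t with hfdef
  have hfA : ∀ t, 0 < t → f t = c * A (1 / 2) 0 t := by
    intro t ht
    have h1 : heatSum z 0 t = Complex.exp (t * lam) * ((∑' n, Real.exp (-t * p n) : ℝ) : ℂ) := by
      rw [heatSum, Complex.ofReal_tsum, ← tsum_mul_left]
      refine tsum_congr fun n => ?_
      rw [pow_zero, one_mul, Complex.ofReal_exp, ← Complex.exp_add]
      congr 1
      simp only [z]; push_cast; ring
    simp only [hfdef, hOm, A, hc]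
    rw [h1, Real.sqrt_mul (by positivity), Real.sqrt_eq_rpow t]
    push_cast
    ring
  set f1 : ℝ → ℂ := fun t => c * ((1 / 2 : ℝ) * A (1 / 2 - 1) 0 t + A (1 / 2) 1 t) with hf1
  have hd : ∀ t, 0 < t → HasDerivAt f (f1 t) t := by
    intro t ht
    refine ((hA (1 / 2) 0 t ht).const_mul c).congr_of_eventuallyEq ?_
    filter_upwards [Ioi_mem_nhds ht] with s hs using hfA s hs
  have hd' : ∀ t, 0 < t → HasDerivAt f1 (c * ((1 / 2 : ℝ) *
      (((1 / 2 - 1 : ℝ) : ℂ) * A (1 / 2 - 1 - 1) 0 t + A (1 / 2 - 1) 1 t) +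
      (((1 / 2 : ℝ) : ℂ) * A (1 / 2 - 1) 1 t + A (1 / 2) 2 t))) t := by
    intro t ht
    exact (((hA (1 / 2 - 1) 0 t ht).const_mul _).add (hA (1 / 2) 1 t ht)).const_mul c
  have happrox : PolyApprox f := (PolyApprox.exp lam).mul hP
  obtain ⟨B', hB'0, hB'⟩ := happrox.bounded
  refine ⟨f1, δ / 4, by positivity, hd,
    fun t ht => (hd' t ht).continuousAt.continuousWithinAt, ?_, ?_, ?_, ?_, happrox⟩
  · refine ((hAtop (1 / 2) 0).const_mul_left c).congr' ?_ EventuallyEq.rfl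
    filter_upwards [eventually_gt_atTop 0] with t ht using (hfA t ht).symm
  · exact (((hAtop _ _).const_mul_left _).add (hAtop _ _)).const_mul_left c
  · refine IsBigO.of_bound B' ?_
    filter_upwards [Ioc_mem_nhdsGT one_pos] with t ht
    simpa using hB' t ht
  -- Every term of the second derivative has r - j = -3/2, well within the t⁻³ allowed by the
  -- interpolation lemma.
  · obtain ⟨P, C, hPC⟩ := happrox 5
    obtain ⟨D1, h1⟩ := hAbot (1 / 2 - 1 - 1) 0 (by norm_num)
    obtain ⟨D2, h2⟩ := hAbot (1 / 2 - 1) 1 (by norm_num)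
    obtain ⟨D3, h3⟩ := hAbot (1 / 2) 2 (by norm_num)
    have hb : ∃ E, ∀ t ∈ Ioc (0 : ℝ) (1 / 2), ‖f1 t‖ ≤ E := by
      refine bounded_deriv_of_approx P (C' := ‖c‖ * (D1 + D2 + D2 + D3)) hd hd' hPC ?_
      intro t ht
      have e1 := h1 t ht
      have e2 := h2 t ht
      have e3 := h3 t ht
      have hcoef : ∀ (r : ℝ) (w : ℂ), |r| ≤ 1 → ‖(r : ℂ) * w‖ ≤ ‖w‖ := by
        intro r w hr
        rw [norm_mul, Complex.norm_real, Real.norm_eq_abs]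
        exact mul_le_of_le_one_left (norm_nonneg _) hr
      have hhalf : |(1 / 2 : ℝ)| ≤ 1 := by rw [abs_le]; constructor <;> norm_num
      have hhalf' : |(1 / 2 - 1 : ℝ)| ≤ 1 := by rw [abs_le]; constructor <;> norm_num
      rw [norm_mul, mul_assoc]
      refine mul_le_mul_of_nonneg_left ?_ (norm_nonneg _)
      calc _ ≤ ‖((1 / 2 : ℝ) : ℂ) * (((1 / 2 - 1 : ℝ) : ℂ) * A (1 / 2 - 1 - 1) 0 t +
              A (1 / 2 - 1) 1 t)‖ +
            ‖((1 / 2 : ℝ) : ℂ) * A (1 / 2 - 1) 1 t + A (1 / 2) 2 t‖ := norm_add_le _ _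
        _ ≤ (‖A (1 / 2 - 1 - 1) 0 t‖ + ‖A (1 / 2 - 1) 1 t‖) +
            (‖A (1 / 2 - 1) 1 t‖ + ‖A (1 / 2) 2 t‖) := by
            refine add_le_add ((hcoef _ _ hhalf).trans ((norm_add_le _ _).trans ?_))
              ((norm_add_le _ _).trans ?_)
            · exact add_le_add (hcoef _ _ hhalf') le_rfl
            · exact add_le_add (hcoef _ _ hhalf) le_rfl
        _ ≤ _ := by linarith
    obtain ⟨E, hE⟩ := hb
    refine IsBigO.of_bound E ?_
    filter_upwards [Ioc_mem_nhdsGT (show (0 : ℝ) < 1 / 2 by norm_num)] with t ht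
    simpa using hE t ht

end Heat

end

section

/-! ### Meromorphic continuation and the behaviour at s = 0 -/

section Meromorphic

/-- Identity theorem for meromorphic functions: infinite order of vanishing at one point propagates
over the connected plane. Only punctured neighbourhoods are controlled, as values at poles are
arbitrary. -/
theorem eventuallyEq_nhdsNE_of_eqOn_halfPlane {Z F : ℂ → ℂ} (hZ : MeromorphicOn Z univ)
    (hF : MeromorphicOn F univ) {σ : ℝ} (h : ∀ s : ℂ, σ < s.re → Z s = F s) (s : ℂ) :
    Z =ᶠ[𝓝[≠] s] F := by
  have hd : MeromorphicOn (Z - F) univ := hZ.sub hF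
  have h1 : meromorphicOrderAt (Z - F) ((σ + 1 : ℝ) : ℂ) = ⊤ := by
    rw [meromorphicOrderAt_eq_top_iff]
    have ho : {s : ℂ | σ < s.re} ∈ 𝓝 ((σ + 1 : ℝ) : ℂ) :=
      (isOpen_lt continuous_const Complex.continuous_re).mem_nhds (by simp)
    filter_upwards [nhdsWithin_le_nhds ho] with z hz
    simp [h z hz]
  have h2 : meromorphicOrderAt (Z - F) s = ⊤ := by
    by_contra hne
    exact hd.meromorphicOrderAt_ne_top_of_isPreconnected isPreconnected_univ (mem_univ s)
      (mem_univ _) hne h1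
  rw [meromorphicOrderAt_eq_top_iff] at h2
  filter_upwards [h2] with z hz
  simpa [sub_eq_zero] using hz

/-- The expression for `ζ(s,λ)` in terms of the modified Mellin transform `B`. -/
def zetaOfMellin (B : ℂ → ℂ) (s : ℂ) : ℂ :=
  ((4 * π : ℝ) : ℂ) ^ (-(1 / 2) : ℂ) * (Complex.Gamma (s - 1 / 2) / Complex.Gamma s) * B (1 / 2 - s)

variable {B : ℂ → ℂ}

theorem analyticAt_inv_Gamma (s : ℂ) : AnalyticAt ℂ (fun s => (Complex.Gamma s)⁻¹) s :=
  Complex.differentiable_one_div_Gamma.analyticAt s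

/-- Both Gamma factors are expressed through the entire function 1/Γ, from which meromorphy and the
location of the possible poles can be read off. -/
theorem zetaOfMellin_eq (B : ℂ → ℂ) : zetaOfMellin B = fun s =>
    ((4 * π : ℝ) : ℂ) ^ (-(1 / 2) : ℂ) *
      (((Complex.Gamma (s - 1 / 2))⁻¹)⁻¹ * (Complex.Gamma s)⁻¹) * B (1 / 2 - s) := by
  funext s
  simp only [zetaOfMellin, inv_inv, div_eq_mul_inv]

theorem analyticAt_inv_Gamma_sub (s : ℂ) :
    AnalyticAt ℂ (fun s => (Complex.Gamma (s - 1 / 2))⁻¹) s :=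
  (Complex.differentiable_one_div_Gamma.comp (differentiable_id.sub_const _)).analyticAt s

theorem analyticAt_comp_half_sub (hB : Differentiable ℂ B) (s : ℂ) :
    AnalyticAt ℂ (fun s => B (1 / 2 - s)) s :=
  (hB.comp (differentiable_id.const_sub _)).analyticAt s

theorem meromorphicOn_zetaOfMellin (hB : Differentiable ℂ B) :
    MeromorphicOn (zetaOfMellin B) univ := by
  intro s _
  rw [zetaOfMellin_eq]
  exact ((MeromorphicAt.const _ s).mul ((analyticAt_inv_Gamma_sub s).meromorphicAt.inv.mul
    (analyticAt_inv_Gamma s).meromorphicAt)).mul (analyticAt_comp_half_sub hB s).meromorphicAt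

theorem analyticAt_zetaOfMellin (hB : Differentiable ℂ B) {s : ℂ}
    (hs : ∀ k : ℕ, s ≠ 1 / 2 - (k : ℂ)) : AnalyticAt ℂ (zetaOfMellin B) s := by
  rw [zetaOfMellin_eq]
  refine (analyticAt_const.mul (((analyticAt_inv_Gamma_sub s).inv ?_).mul
    (analyticAt_inv_Gamma s))).mul (analyticAt_comp_half_sub hB s)
  refine inv_ne_zero (Complex.Gamma_ne_zero fun m hm => hs m ?_)
  linear_combination hm

theorem half_lt_re_ne {s : ℂ} (hs : 1 / 2 < s.re) (k : ℕ) : s ≠ 1 / 2 - (k : ℂ) := by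
  intro h
  have h1 := congrArg Complex.re h
  have : (0 : ℝ) ≤ k := k.cast_nonneg
  simp at h1
  linarith

/-- 1/Γ(s) = s · 1/Γ(s + 1), and Γ(1) = 1. -/
theorem hasDerivAt_inv_Gamma_zero : HasDerivAt (fun s => (Complex.Gamma s)⁻¹) 1 0 := by
  have h1 : HasDerivAt (fun s => (Complex.Gamma (s + 1))⁻¹)
      (deriv (fun s => (Complex.Gamma (s + 1))⁻¹) 0) 0 :=
    (Complex.differentiable_one_div_Gamma.comp
      (differentiable_id.add_const (1 : ℂ))).differentiableAt.hasDerivAt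
  have h2 := (hasDerivAt_id (0 : ℂ)).mul h1
  have h3 : (fun s => (Complex.Gamma s)⁻¹) = id * fun s => (Complex.Gamma (s + 1))⁻¹ := by
    funext s
    exact Complex.one_div_Gamma_eq_self_mul_one_div_Gamma_add_one s
  rw [h3]
  simpa using h2

/-- Γ(-1/2) = -2√π by the functional equation, and (4π)^{-1/2} = 1/(2√π). -/
theorem four_pi_cpow_mul_Gamma :
    ((4 * π : ℝ) : ℂ) ^ (-(1 / 2) : ℂ) * Complex.Gamma (0 - 1 / 2) = -1 := by
  have h1 : Complex.Gamma (1 / 2) = -(1 / 2) * Complex.Gamma (0 - 1 / 2) := by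
    have := Complex.Gamma_add_one (0 - 1 / 2 : ℂ) (by norm_num)
    rw [show (0 - 1 / 2 + 1 : ℂ) = 1 / 2 by norm_num] at this
    rw [this]; ring
  rw [Complex.Gamma_one_half_eq] at h1
  have h2 : ((4 * π : ℝ) : ℂ) ^ (-(1 / 2) : ℂ) * (π : ℂ) ^ (1 / 2 : ℂ) = 1 / 2 := by
    have h3 : ((4 * π : ℝ) : ℂ) ^ (-(1 / 2) : ℂ) = (((4 * π) ^ (-(1 / 2) : ℝ) : ℝ) : ℂ) := by
      rw [Complex.ofReal_cpow (by positivity)]; norm_num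
    have h4 : (π : ℂ) ^ (1 / 2 : ℂ) = ((π ^ (1 / 2 : ℝ) : ℝ) : ℂ) := by
      rw [Complex.ofReal_cpow (by positivity)]; norm_num
    rw [h3, h4, ← Complex.ofReal_mul, Real.mul_rpow (by norm_num) (by positivity), mul_assoc,
      ← Real.rpow_add Real.pi_pos]
    have h5 : (4 : ℝ) ^ (-(1 / 2) : ℝ) = 1 / 2 := by
      rw [Real.rpow_neg (by norm_num), ← Real.sqrt_eq_rpow,
        show (4 : ℝ) = 2 ^ 2 by norm_num, Real.sqrt_sq (by norm_num)]
      norm_num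
    rw [h5]; norm_num
  linear_combination (-2) * h2 + (-2) * ((4 * π : ℝ) : ℂ) ^ (-(1 / 2) : ℂ) * (-h1)

/-- 1/Γ vanishes at 0 with derivative 1, so the derivative of the product is the value at 0 of the
remaining factor, which is -B(1/2). -/
theorem hasDerivAt_zetaOfMellin_zero (hB : Differentiable ℂ B) :
    HasDerivAt (zetaOfMellin B) (-B (1 / 2)) 0 := by
  set H : ℂ → ℂ := fun s =>
    ((4 * π : ℝ) : ℂ) ^ (-(1 / 2) : ℂ) * Complex.Gamma (s - 1 / 2) * B (1 / 2 - s) with hH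
  have h1 : DifferentiableAt ℂ H 0 := by
    have h2 : DifferentiableAt ℂ (fun s => Complex.Gamma (s - 1 / 2)) 0 := by
      have h3 : DifferentiableAt ℂ Complex.Gamma ((fun s : ℂ => s - 1 / 2) 0) := by
        refine Complex.differentiableAt_Gamma _ fun m hm => ?_
        have h4 := congrArg (fun z => 2 * z) hm
        norm_num at h4
        have h5 : ((2 * m : ℕ) : ℂ) = ((1 : ℕ) : ℂ) := by
          push_cast; linear_combination -h4
        have h6 : 2 * m = 1 := Nat.cast_injective h5
        omega
      exact h3.comp 0 (differentiableAt_id.sub_const _)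
    exact (h2.const_mul _).mul (analyticAt_comp_half_sub hB 0).differentiableAt
  have h2 := h1.hasDerivAt.mul hasDerivAt_inv_Gamma_zero
  have h3 : zetaOfMellin B = H * fun s => (Complex.Gamma s)⁻¹ := by
    funext s
    simp only [zetaOfMellin, Pi.mul_apply, hH, div_eq_mul_inv]
    ring
  rw [h3]
  refine h2.congr_deriv ?_
  simp only [Complex.Gamma_zero, inv_zero, mul_zero, zero_add, mul_one, hH]
  rw [four_pi_cpow_mul_Gamma, sub_zero]
  ring

end Meromorphic

/-! ### The Gamma integral with a complex rate -/

section GammaIntegral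

/-- `∫₀^∞ tˢ⁻¹ e^{-rt} dt = r⁻ˢ Γ(s)` for complex `r` with positive real part. -/
theorem integral_cpow_mul_cexp_Ioi {s : ℂ} (hs : 0 < s.re) {r : ℂ} (hr : 0 < r.re) :
    ∫ t in Ioi (0 : ℝ), (t : ℂ) ^ (s - 1) * Complex.exp (-(r * t)) =
      r ^ (-s) * Complex.Gamma s := by
  let F : ℂ → ℂ := fun r => ∫ t in Ioi (0 : ℝ), (t : ℂ) ^ (s - 1) * Complex.exp (-(r * t))
  have hexpO : ∀ {r : ℂ}, 0 < r.re →
      (fun t : ℝ => Complex.exp (-(r * t))) =O[atTop] fun t => Real.exp (-r.re * t) := by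
    intro r _
    refine IsBigO.of_bound 1 (Eventually.of_forall fun t => ?_)
    rw [Complex.norm_exp]
    simp
  have hone : ∀ {g : ℝ → ℂ}, Continuous g → g =O[𝓝[>] 0] (fun _ => (1 : ℝ)) := fun hg =>
    (hg.continuousAt.isBigO_one ℝ).mono nhdsWithin_le_nhds
  have hconv : ∀ {r : ℂ} {u : ℂ}, 0 < r.re → 0 < u.re →
      MellinConvergent (fun t : ℝ => Complex.exp (-(r * t))) u := by
    intro r u hr hu
    refine mellinConvergent_of_isBigO_rpow_exp hr
      ((Continuous.locallyIntegrable (by fun_prop)).locallyIntegrableOn _) (hexpO hr) (b := 0) ?_ hu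
    simpa using hone (by fun_prop : Continuous fun t : ℝ => Complex.exp (-(r * t)))
  -- Differentiation under the integral followed by integration by parts gives F' = -(s/r) F. Hence
  -- r^s F(r) is constant on the right half-plane, and its value at r = 1 is Γ(s).
  have hF : ∀ r : ℂ, 0 < r.re → HasDerivAt F (-(s / r) * F r) r := by
    intro r hr
    have hr0 : r ≠ 0 := by rintro rfl; simp at hr
    have hU : {w : ℂ | r.re / 2 < w.re} ∈ 𝓝 r :=
      (isOpen_lt continuous_const Complex.continuous_re).mem_nhds (by simp [hr])
    have hmeas : ∀ (u w : ℂ), AEStronglyMeasurable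
        (fun t : ℝ => (t : ℂ) ^ u * Complex.exp (-(w * t))) (volume.restrict (Ioi 0)) := by
      intro u w
      refine ContinuousOn.aestronglyMeasurable (fun t ht => ?_) measurableSet_Ioi
      exact ((Complex.continuousAt_ofReal_cpow_const _ _ (Or.inr (ne_of_gt ht))).mul
        (by fun_prop)).continuousWithinAt
    -- Near r the rate has real part above Re r / 2, so the integrand with that real rate dominates
    -- the derivative.
    have hcv := hconv (r := ((r.re / 2 : ℝ) : ℂ)) (u := s + 1) (by simpa using hr)
      (by simp; linarith)
    have hd := (hasDerivAt_integral_of_dominated_loc_of_deriv_le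
      (μ := volume.restrict (Ioi (0 : ℝ)))
      (F := fun (w : ℂ) (t : ℝ) => (t : ℂ) ^ (s - 1) * Complex.exp (-(w * t)))
      (F' := fun (w : ℂ) (t : ℝ) => -((t : ℂ) ^ s * Complex.exp (-(w * t))))
      (bound := fun t => ‖(t : ℂ) ^ (s + 1 - 1) • Complex.exp (-(((r.re / 2 : ℝ) : ℂ) * t))‖)
      (x₀ := r) hU (Eventually.of_forall fun w => hmeas _ _) (hconv hr hs)
      (hmeas _ _).neg ?_ hcv.norm ?_).2
    · refine hd.congr_deriv ?_
      have hpart := mellin_deriv_add_one (f := fun t : ℝ => Complex.exp (-(r * t)))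
        (f' := fun t : ℝ => -r * Complex.exp (-(r * t))) hr ?_ (by fun_prop) (hexpO hr)
        ((hexpO hr).const_mul_left _) (hone (by fun_prop)) (hone (by fun_prop)) hs
      · rw [mellin, mellin] at hpart
        simp only [smul_eq_mul, add_sub_cancel_right] at hpart
        have h1 : ∫ t in Ioi (0 : ℝ), (t : ℂ) ^ s * (-r * Complex.exp (-(r * t))) =
            r * ∫ t in Ioi (0 : ℝ), -((t : ℂ) ^ s * Complex.exp (-(r * t))) := by
          rw [← integral_const_mul]
          refine integral_congr_ae (ae_of_all _ fun t => ?_)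
          ring
        rw [h1] at hpart
        change _ = -(s / r) * ∫ t in Ioi (0 : ℝ), (t : ℂ) ^ (s - 1) * Complex.exp (-(r * t))
        field_simp
        linear_combination hpart
      · intro t _
        have h1 : HasDerivAt (fun y : ℝ => -(r * (y : ℂ))) (-(r * ((1 : ℝ) : ℂ))) t :=
          ((hasDerivAt_id t).ofReal_comp.const_mul r).neg
        refine h1.cexp.congr_deriv ?_
        push_cast; ring
    · filter_upwards [ae_restrict_mem measurableSet_Ioi] with t ht w hw
      have ht : 0 < t := ht
      have hw : r.re / 2 < w.re := hw
      rw [norm_neg, norm_smul, norm_mul, add_sub_cancel_right, Complex.norm_exp, Complex.norm_exp]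
      refine mul_le_mul_of_nonneg_left (Real.exp_le_exp.2 ?_) (norm_nonneg _)
      simp only [Complex.neg_re, Complex.re_mul_ofReal, Complex.ofReal_re]
      nlinarith
    · filter_upwards [ae_restrict_mem measurableSet_Ioi] with t ht w _
      have ht0 : (t : ℂ) ≠ 0 := by exact_mod_cast (ne_of_gt ht)
      have h1 : HasDerivAt (fun w : ℂ => -(w * (t : ℂ))) (-(1 * (t : ℂ))) w :=
        ((hasDerivAt_id w).mul_const _).neg
      refine (h1.cexp.const_mul ((t : ℂ) ^ (s - 1))).congr_deriv ?_
      have h2 : (t : ℂ) ^ s = (t : ℂ) ^ (s - 1) * t := by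
        rw [Complex.cpow_sub _ _ ht0, Complex.cpow_one, div_mul_cancel₀ _ ht0]
      rw [h2]; ring
  have hslit : ∀ {w : ℂ}, 0 < w.re → w ∈ Complex.slitPlane := fun h => Or.inl h
  have hprod : ∀ w ∈ {w : ℂ | 0 < w.re}, HasDerivAt (fun w => w ^ s * F w) 0 w := by
    intro w hw
    have hw0 : w ≠ 0 := Complex.slitPlane_ne_zero (hslit hw)
    have h1 : HasDerivAt (fun w : ℂ => w ^ s) (s * w ^ (s - 1) * 1) w :=
      (hasDerivAt_id w).cpow_const (hslit hw)
    refine (h1.mul (hF w hw)).congr_deriv ?_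
    rw [Complex.cpow_sub _ _ hw0, Complex.cpow_one]
    field_simp
    ring
  have hconst : r ^ s * F r = (1 : ℂ) ^ s * F 1 := by
    refine (convex_halfSpace_re_gt 0).is_const_of_fderivWithin_eq_zero (𝕜 := ℂ)
      (f := fun w => w ^ s * F w)
      (fun w hw => (hprod w hw).differentiableAt.differentiableWithinAt) (fun w hw => ?_)
      (show r ∈ {w : ℂ | 0 < w.re} from hr) (show (1 : ℂ) ∈ {w : ℂ | 0 < w.re} by simp)
    have ho : IsOpen {w : ℂ | 0 < w.re} := isOpen_lt continuous_const Complex.continuous_re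
    rw [fderivWithin_of_isOpen ho hw, (hprod w hw).hasFDerivAt.fderiv]
    ext; simp
  have hF1 : F 1 = Complex.Gamma s := by
    have := Complex.integral_cpow_mul_exp_neg_mul_Ioi hs one_pos
    simpa [F] using this
  have hr0 : r ≠ 0 := Complex.slitPlane_ne_zero (hslit hr)
  rw [hF1, Complex.one_cpow, one_mul] at hconst
  rw [Complex.cpow_neg, ← hconst, inv_mul_cancel_left₀ ((Complex.cpow_ne_zero_iff_of_exponent_ne_zero
    (by rintro rfl; simp at hs)).2 hr0)]

end GammaIntegral

/-! ### From the expansion of Ω to the zeta function and the determinant -/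

section Conclusion

variable {N : ℕ} {a : ℝ} {W : Matrix.unitaryGroup (Fin N) ℂ} {Q : Potential a W} {lam : ℂ}

theorem isModifiedMellin_iff {f' : ℝ → ℂ} {r : ℝ} (hf : HeatRegular (expOmega Q lam) f' r)
    {B : ℂ → ℂ} : IsModifiedMellin Q lam B ↔ Differentiable ℂ B ∧
      ∀ q : ℂ, q.re < 0 → B q = 1 / Complex.Gamma (-q) * mellin (expOmega Q lam) (-q) := by
  refine and_congr_right fun _ => ⟨fun h q hq => (h q hq).2, fun h q hq => ⟨?_, h q hq⟩⟩
  have hc : ContinuousOn (expOmega Q lam) (Ioi 0) := fun t ht =>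
    (hf.deriv t ht).continuousAt.continuousWithinAt
  have := mellinConvergent_of_isBigO_rpow_exp (s := -q) (b := 0) hf.pos
    (hc.locallyIntegrableOn measurableSet_Ioi) hf.top (by simpa using hf.bot) (by simpa using hq)
  exact this

/-- Each eigenvalue term is a Gamma integral. To exchange sum and integral each integrand is
dominated by its own norm: the factors e^{-tλₙ} being positive, these norms add up to the norm of
the integrand defining B at 1/2 - s, integrable as Re(1/2 - s) < 0. The √t inside Ω accounts for the
shift by 1/2. -/
theorem hasSum_zeta (hp : ∀ n : EigenIndex Q, lam.re < eigenvalue Q n)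
    (hs : ∀ t : ℝ, 0 < t → Summable fun n : EigenIndex Q => Real.exp (-t * eigenvalue Q n))
    {B : ℂ → ℂ} (hB : IsModifiedMellin Q lam B) {s : ℂ} (hs2 : 1 / 2 < s.re) :
    HasSum (fun n : EigenIndex Q => ((eigenvalue Q n : ℂ) - lam) ^ (-s)) (zetaOfMellin B s) := by
  have hcount : Countable (EigenIndex Q) := by
    have h := (hs 1 one_pos).countable_support
    rw [show Function.support (fun n : EigenIndex Q => Real.exp (-1 * eigenvalue Q n)) = univ from
      eq_univ_of_forall fun n => (Real.exp_pos _).ne'] at h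
    exact countable_univ_iff.1 h
  obtain ⟨hint, hBq⟩ := hB.2 (1 / 2 - s) (by simp; linarith)
  set c : ℂ := ((√(4 * π) : ℝ) : ℂ) with hc
  have hc0 : c ≠ 0 := by
    rw [hc]; exact_mod_cast (Real.sqrt_pos.2 (by positivity)).ne'
  have hs0 : 0 < s.re := by linarith
  -- pointwise sums
  have hterm : ∀ t : ℝ, 0 < t → HasSum (fun n : EigenIndex Q =>
      (t : ℂ) ^ (s - 1) * Complex.exp (-(((eigenvalue Q n : ℂ) - lam) * t)))
      (c⁻¹ * ((t : ℂ) ^ (-(1 / 2 - s) - 1) * expOmega Q lam t)) := by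
    intro t ht
    have h1 : HasSum (fun n : EigenIndex Q => ((Real.exp (-t * eigenvalue Q n) : ℝ) : ℂ))
        (heatTrace Q t : ℂ) := Complex.hasSum_ofReal.2 (hs t ht).hasSum
    have h2 := h1.mul_left ((t : ℂ) ^ (s - 1) * Complex.exp (t * lam))
    have ht0 : (t : ℂ) ≠ 0 := by exact_mod_cast ht.ne'
    convert! h2 using 1
    · funext n
      rw [Complex.ofReal_exp, mul_assoc, ← Complex.exp_add]
      congr 2
      push_cast; ring
    · rw [expOmega, Omega, Real.sqrt_mul (by positivity : (0 : ℝ) ≤ 4 * π)]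
      have h3 : (t : ℂ) ^ (s - 1) = (t : ℂ) ^ (-(1 / 2 - s) - 1) * ((√t : ℝ) : ℂ) := by
        rw [Real.sqrt_eq_rpow, Complex.ofReal_cpow ht.le, ← Complex.cpow_add _ _ ht0]
        congr 1
        push_cast; ring
      rw [h3]
      push_cast
      rw [← hc]
      field_simp
  have hnorm : ∀ t : ℝ, 0 < t → ∀ n : EigenIndex Q,
      ‖(t : ℂ) ^ (s - 1) * Complex.exp (-(((eigenvalue Q n : ℂ) - lam) * t))‖ =
        t ^ (s.re - 1) * Real.exp (t * lam.re) * Real.exp (-t * eigenvalue Q n) := by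
    intro t ht n
    rw [norm_mul, Complex.norm_cpow_eq_rpow_re_of_pos ht, Complex.norm_exp, mul_assoc,
      ← Real.exp_add]
    congr 2
    simp; ring
  have hsum : ∀ t : ℝ, 0 < t → ∑' n : EigenIndex Q,
      ‖(t : ℂ) ^ (s - 1) * Complex.exp (-(((eigenvalue Q n : ℂ) - lam) * t))‖ =
        ‖c⁻¹ * ((t : ℂ) ^ (-(1 / 2 - s) - 1) * expOmega Q lam t)‖ := by
    intro t ht
    have h1 : 0 ≤ heatTrace Q t := tsum_nonneg fun n => (Real.exp_pos _).le
    simp only [hnorm t ht]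
    rw [tsum_mul_left, norm_mul, norm_mul, norm_inv, hc, Complex.norm_real, Real.norm_eq_abs,
      abs_of_nonneg (Real.sqrt_nonneg _), Complex.norm_cpow_eq_rpow_re_of_pos ht, expOmega, Omega,
      norm_mul, Complex.norm_real, Real.norm_eq_abs, abs_of_nonneg (by positivity),
      Complex.norm_exp, Real.sqrt_mul (by positivity : (0 : ℝ) ≤ 4 * π), Real.sqrt_eq_rpow t]
    have h4 : √(4 * π) ≠ 0 := (Real.sqrt_pos.2 (by positivity)).ne'
    have h3 : t ^ (s.re - 1) = t ^ (-(1 / 2 - s) - 1).re * t ^ (1 / 2 : ℝ) := by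
      rw [← Real.rpow_add ht]
      congr 1
      simp; ring
    rw [h3, heatTrace]
    simp only [Complex.re_ofReal_mul]
    field_simp
  have hmain := hasSum_integral_of_dominated_convergence (μ := volume.restrict (Ioi (0 : ℝ)))
    (F := fun (n : EigenIndex Q) (t : ℝ) =>
      (t : ℂ) ^ (s - 1) * Complex.exp (-(((eigenvalue Q n : ℂ) - lam) * t)))
    (f := fun t : ℝ => c⁻¹ * ((t : ℂ) ^ (-(1 / 2 - s) - 1) * expOmega Q lam t))
    (fun n t => ‖(t : ℂ) ^ (s - 1) * Complex.exp (-(((eigenvalue Q n : ℂ) - lam) * t))‖)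
    (fun n => by
      refine ContinuousOn.aestronglyMeasurable ?_ measurableSet_Ioi
      intro t ht
      refine ContinuousAt.continuousWithinAt (ContinuousAt.mul ?_ (by fun_prop))
      exact Complex.continuousAt_ofReal_cpow_const _ _ (Or.inr (ne_of_gt ht)))
    (fun n => ae_of_all _ fun t => le_rfl)
    ((ae_restrict_mem measurableSet_Ioi).mono fun t ht => by
      simp only [hnorm t ht]
      exact (hs t ht).mul_left _)
    ((hint.const_mul c⁻¹).norm.congr
      ((ae_restrict_mem measurableSet_Ioi).mono fun t ht => (hsum t ht).symm))
    ((ae_restrict_mem measurableSet_Ioi).mono fun t ht => hterm t ht)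
  have hre : ∀ n, 0 < ((eigenvalue Q n : ℂ) - lam).re := fun n => by simpa using hp n
  have hΓ : Complex.Gamma s ≠ 0 := Complex.Gamma_ne_zero_of_re_pos hs0
  have hΓ' : Complex.Gamma (s - 1 / 2) ≠ 0 :=
    Complex.Gamma_ne_zero_of_re_pos (by simp; linarith)
  have h := hmain.mul_right (Complex.Gamma s)⁻¹
  convert! h using 1
  · funext n
    rw [integral_cpow_mul_cexp_Ioi hs0 (hre n), mul_inv_cancel_right₀ hΓ]
  · rw [integral_const_mul, zetaOfMellin, hBq, neg_sub]
    have hc' : ((4 * π : ℝ) : ℂ) ^ (-(1 / 2) : ℂ) = c⁻¹ := by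
      rw [hc, Real.sqrt_eq_rpow, Complex.ofReal_cpow (by positivity), ← Complex.cpow_neg]
      norm_num
    rw [hc']
    generalize Complex.Gamma (s - 1 / 2) = g at hΓ'
    generalize (∫ t in Ioi (0 : ℝ), (t : ℂ) ^ (-(1 / 2 - s) - 1) * expOmega Q lam t) = J
    field_simp

/-- Purely analytic part: convergence of the heat trace and the expansion of Ω imply all the claims.
Uniqueness is the identity theorem; normal form upgrades equality on punctured neighbourhoods to
equality everywhere. -/
theorem conclusion_of_polyApprox (hp : ∀ n : EigenIndex Q, lam.re < eigenvalue Q n)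
    (hs : ∀ t : ℝ, 0 < t → Summable fun n : EigenIndex Q => Real.exp (-t * eigenvalue Q n))
    (hP : PolyApprox fun t => (Omega Q t : ℂ)) :
    (∃! B : ℂ → ℂ, IsModifiedMellin Q lam B) ∧
    (∃! Z : ℂ → ℂ, IsZeta Q lam Z) ∧
    ∀ B Z : ℂ → ℂ, IsModifiedMellin Q lam B → IsZeta Q lam Z →
      (∀ s : ℂ, 1 / 2 < s.re →
        HasSum (fun n : EigenIndex Q => ((eigenvalue Q n : ℂ) - lam) ^ (-s)) (Z s)) ∧
      (∀ s : ℂ, (∀ k : ℕ, s ≠ 1 / 2 - (k : ℂ)) →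
        Z s = ((4 * π : ℝ) : ℂ) ^ (-(1 / 2) : ℂ) *
          (Complex.Gamma (s - 1 / 2) / Complex.Gamma s) * B (1 / 2 - s)) ∧
      AnalyticAt ℂ Z 0 ∧
      Z 0 = 0 ∧
      logDet Z = B (1 / 2) ∧
      DifferentiableOn ℝ (expOmega Q lam) (Set.Ioi 0) ∧
      MeasureTheory.IntegrableOn
        (fun t : ℝ => (t : ℂ) ^ (-(1 / 2) : ℂ) * deriv (expOmega Q lam) t) (Set.Ioi 0) ∧
      B (1 / 2) = -((π : ℝ) : ℂ) ^ (-(1 / 2) : ℂ) *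
        ∫ t in Set.Ioi (0 : ℝ), (t : ℂ) ^ (-(1 / 2) : ℂ) * deriv (expOmega Q lam) t := by
  obtain ⟨f', r, hf⟩ : ∃ f' r, HeatRegular (expOmega Q lam) f' r := exists_heatRegular hp hs hP
  have hiff := fun B => isModifiedMellin_iff (B := B) hf
  have hcf : ContinuousOn (expOmega Q lam) (Ioi 0) := fun t ht =>
    (hf.deriv t ht).continuousAt.continuousWithinAt
  obtain ⟨B₀, hB₀⟩ : ∃ B, IsModifiedMellin Q lam B := by
    simp only [hiff]
    refine exists_entire_mellin hf.pos hcf hf.top fun M => ?_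
    -- Expanding e^t f(t) instead of f(t) gives an approximation of f by P(t) e^{-t}; the error only
    -- shrinks, as e^{-t} ≤ 1.
    obtain ⟨P, C, hPC⟩ := ((PolyApprox.exp 1).mul hf.approx) M
    refine ⟨P, C, fun t ht => ?_⟩
    have h1 : expOmega Q lam t - P.eval (t : ℂ) * (Real.exp (-t) : ℂ) =
        (Real.exp (-t) : ℂ) *
          (Complex.exp (t * 1) * expOmega Q lam t - P.eval (t : ℂ)) := by
      have h2 : (Real.exp (-t) : ℂ) * Complex.exp (t * 1) = 1 := by
        rw [Complex.ofReal_exp, ← Complex.exp_add]; simp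
      linear_combination (-expOmega Q lam t) * h2
    rw [h1, norm_mul, Complex.norm_real, Real.norm_eq_abs, abs_of_pos (Real.exp_pos _)]
    exact (mul_le_of_le_one_left (norm_nonneg _)
      (Real.exp_le_one_iff.2 (by linarith [ht.1]))).trans (hPC t ht)
  have hBuniq : ∀ B, IsModifiedMellin Q lam B → B = B₀ := by
    intro B hB
    funext q
    refine eqOn_halfPlane (c := q.re + 1) (d := 0) hB.1.differentiableOn hB₀.1.differentiableOn
      (fun q hq => (hB.2 q hq).2.trans (hB₀.2 q hq).2.symm) ?_
    simp
  have hmer := meromorphicOn_zetaOfMellin hB₀.1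
  have hZloc : ∀ Z, IsZeta Q lam Z → ∀ s, Z =ᶠ[𝓝[≠] s] zetaOfMellin B₀ := by
    rintro Z ⟨hNF, σ, hσ⟩ s
    refine eventuallyEq_nhdsNE_of_eqOn_halfPlane hNF.meromorphicOn hmer (σ := max σ (1 / 2))
      (fun s hs' => ?_) s
    exact (hσ s ((le_max_left _ _).trans_lt hs')).unique
      (hasSum_zeta hp hs hB₀ ((le_max_right _ _).trans_lt hs'))
  have hZan : ∀ Z, IsZeta Q lam Z → ∀ s : ℂ, (∀ k : ℕ, s ≠ 1 / 2 - (k : ℂ)) →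
      Z =ᶠ[𝓝 s] zetaOfMellin B₀ := fun Z hZ s hs' =>
    ((hZ.1 (mem_univ s)).eventuallyEq_nhdsNE_iff_eventuallyEq_nhds
      (analyticAt_zetaOfMellin hB₀.1 hs').meromorphicNFAt).1 (hZloc Z hZ s)
  obtain ⟨Z₀, hZ₀⟩ : ∃ Z, IsZeta Q lam Z := by
    -- Passing to normal form changes nothing at points of analyticity, in particular nothing where
    -- Re s > 1/2.
    refine ⟨toMeromorphicNFOn (zetaOfMellin B₀) univ, meromorphicNFOn_toMeromorphicNFOn _ _,
      1 / 2, fun s hs' => ?_⟩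
    rw [toMeromorphicNFOn_eq_toMeromorphicNFAt hmer (mem_univ s),
      toMeromorphicNFAt_eq_self.2
        (analyticAt_zetaOfMellin hB₀.1 (half_lt_re_ne hs')).meromorphicNFAt]
    exact hasSum_zeta hp hs hB₀ hs'
  refine ⟨⟨B₀, hB₀, hBuniq⟩, ⟨Z₀, hZ₀, fun Z hZ => ?_⟩, fun B Z hB hZ => ?_⟩
  · funext s
    exact (((hZ.1 (mem_univ s)).eventuallyEq_nhdsNE_iff_eventuallyEq_nhds
      (hZ₀.1 (mem_univ s))).1 ((hZloc Z hZ s).trans (hZloc Z₀ hZ₀ s).symm)).eq_of_nhds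
  · obtain rfl := hBuniq B hB
    have h0 : ∀ k : ℕ, (0 : ℂ) ≠ 1 / 2 - (k : ℂ) := by
      intro k hk
      have h5 : ((2 * k : ℕ) : ℂ) = ((1 : ℕ) : ℂ) := by
        push_cast; linear_combination 2 * hk
      have h6 : 2 * k = 1 := Nat.cast_injective h5
      omega
    have hd : ∀ t ∈ Ioi (0 : ℝ), deriv (expOmega Q lam) t = f' t := fun t ht =>
      (hf.deriv t ht).deriv
    obtain ⟨hconv, hhalf⟩ := modifiedMellin_half hf.pos hf.deriv hf.cont hf.top hf.top' hf.bot
      hf.bot' hB.1 ((hiff B).1 hB).2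
    have hcongr : ∀ t ∈ Ioi (0 : ℝ), (t : ℂ) ^ (1 / 2 - 1 : ℂ) • f' t =
        (t : ℂ) ^ (-(1 / 2) : ℂ) * deriv (expOmega Q lam) t := fun t ht => by
      rw [hd t ht, smul_eq_mul, show (1 / 2 - 1 : ℂ) = -(1 / 2) by norm_num]
    refine ⟨fun s hs' => ?_, fun s hs' => (hZan Z hZ s hs').eq_of_nhds,
      (analyticAt_zetaOfMellin hB.1 h0).congr (hZan Z hZ 0 h0).symm, ?_, ?_,
      fun t ht => (hf.deriv t ht).differentiableAt.differentiableWithinAt, ?_, ?_⟩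
    · rw [(hZan Z hZ s (half_lt_re_ne hs')).eq_of_nhds]
      exact hasSum_zeta hp hs hB hs'
    · rw [(hZan Z hZ 0 h0).eq_of_nhds, zetaOfMellin]
      simp
    · rw [logDet, (hZan Z hZ 0 h0).deriv_eq, (hasDerivAt_zetaOfMellin_zero hB.1).deriv, neg_neg]
    · exact (integrableOn_congr_fun hcongr measurableSet_Ioi).1 hconv
    · rw [hhalf, mellin, setIntegral_congr_fun measurableSet_Ioi hcongr]

end Conclusion

end

/-! ### The operator in Fourier space -/

section

open scoped ENNReal NNReal

/-- The operator `-∂² + Q` in Fourier space: the frequencies are `om * m + β j` and the matrix of `Q`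
is `q j k (m - n)`, Hermitian and rapidly decaying. -/
structure FourierData (N : ℕ) where
  om : ℝ
  om_pos : 0 < om
  β : Fin N → ℝ
  q : Fin N → Fin N → ℤ → ℂ
  herm : ∀ j k m, starRingEnd ℂ (q j k m) = q k j (-m)
  decay : ∀ p : ℕ, ∃ C : ℝ, ∀ j k m, ‖q j k m‖ * (1 + m.natAbs : ℝ) ^ p ≤ C

theorem summable_one_add_natAbs : Summable fun m : ℤ => 1 / (1 + m.natAbs : ℝ) ^ 2 := by
  have h : Summable fun n : ℕ => 1 / (1 + n : ℝ) ^ 2 := by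
    have := (summable_nat_add_iff 1).2 (Real.summable_one_div_nat_pow.2 (by norm_num : 1 < 2))
    refine this.congr fun n => ?_
    push_cast; ring
  exact Summable.of_nat_of_neg (by simpa using h) (by simpa using h)

namespace FourierData

variable {N : ℕ} (D : FourierData N)

/-- The frequency of a Fourier mode. -/
def freq (i : ℤ × Fin N) : ℝ := D.om * i.1 + D.β i.2

/-- The matrix of the potential in the Fourier basis. -/
def mat (i j : ℤ × Fin N) : ℂ := D.q i.2 j.2 (i.1 - j.1)

theorem conj_mat (i j : ℤ × Fin N) : starRingEnd ℂ (D.mat i j) = D.mat j i := by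
  rw [mat, D.herm, mat, neg_sub]

theorem norm_mat_comm (i j : ℤ × Fin N) : ‖D.mat i j‖ = ‖D.mat j i‖ := by
  rw [← D.conj_mat, RCLike.norm_conj]

/-- Translation of Fourier modes. -/
def shift (l : ℤ) (i : ℤ × Fin N) : ℤ × Fin N := (i.1 + l, i.2)

theorem mat_shift (l : ℤ) (i j : ℤ × Fin N) : D.mat (shift l i) (shift l j) = D.mat i j := by
  simp [mat, shift]

theorem freq_shift (l : ℤ) (i : ℤ × Fin N) : D.freq (shift l i) = D.freq i + D.om * l := by
  simp [freq, shift]; ring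

/-- Decay of order p + 2 pays for the weight and leaves the summable factor (1 + |m|)⁻². The bound
is uniform in j because entries depend on the modes only through their difference. Values in `ℝ≥0∞`
fit the later use of Tonelli's theorem. -/
theorem exists_tsum_mat_le (p : ℕ) : ∃ C : ℝ≥0, ∀ j,
    ∑' i, ‖D.mat i j‖ₑ * ((1 + (i.1 - j.1).natAbs : ℕ) : ℝ≥0∞) ^ p ≤ C := by
  obtain ⟨C, hC⟩ := D.decay (p + 2)
  have hs := summable_one_add_natAbs.mul_left C
  refine ⟨N * (∑' m : ℤ, C * (1 / (1 + m.natAbs : ℝ) ^ 2)).toNNReal, fun j => ?_⟩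
  have hC0 : 0 ≤ C := by
    have h := hC j.2 j.2 0
    exact (by positivity : (0 : ℝ) ≤ _).trans h
  have hb : ∀ i : ℤ × Fin N, ‖D.mat i j‖ₑ * ((1 + (i.1 - j.1).natAbs : ℕ) : ℝ≥0∞) ^ p ≤
      ENNReal.ofReal (C * (1 / (1 + (i.1 - j.1).natAbs : ℝ) ^ 2)) := by
    intro i
    have h1 := hC i.2 j.2 (i.1 - j.1)
    have h2 : ‖D.mat i j‖ₑ * ((1 + (i.1 - j.1).natAbs : ℕ) : ℝ≥0∞) ^ p =
        ENNReal.ofReal (‖D.mat i j‖ * (1 + (i.1 - j.1).natAbs : ℝ) ^ p) := by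
      rw [ENNReal.ofReal_mul (norm_nonneg _), ofReal_norm, ENNReal.ofReal_pow (by positivity)]
      congr 2
      rw [show (1 + (i.1 - j.1).natAbs : ℝ) = ((1 + (i.1 - j.1).natAbs : ℕ) : ℝ) by push_cast; rfl,
        ENNReal.ofReal_natCast]
    rw [h2]
    refine ENNReal.ofReal_le_ofReal ?_
    rw [mul_one_div, le_div_iff₀ (by positivity), mul_assoc, ← pow_add]
    exact h1
  calc _ ≤ ∑' i : ℤ × Fin N, ENNReal.ofReal (C * (1 / (1 + (i.1 - j.1).natAbs : ℝ) ^ 2)) :=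
        ENNReal.tsum_le_tsum hb
    _ = ∑' m : ℤ, N * ENNReal.ofReal (C * (1 / (1 + (m - j.1).natAbs : ℝ) ^ 2)) := by
        rw [ENNReal.tsum_prod (f := fun (m : ℤ) (_ : Fin N) =>
          ENNReal.ofReal (C * (1 / (1 + (m - j.1).natAbs : ℝ) ^ 2)))]
        refine tsum_congr fun m => ?_
        simp [tsum_fintype]
    _ = N * ∑' m : ℤ, ENNReal.ofReal (C * (1 / (1 + m.natAbs : ℝ) ^ 2)) := by
        rw [ENNReal.tsum_mul_left]
        congr 1
        exact (Equiv.subRight j.1).tsum_eq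
          fun m : ℤ => ENNReal.ofReal (C * (1 / (1 + m.natAbs : ℝ) ^ 2))
    _ = _ := by
        rw [← ENNReal.ofReal_tsum_of_nonneg (fun m => by positivity) hs]
        push_cast
        rfl

/-- The constant bounding the weighted column sums of the potential. -/
def colBound (p : ℕ) : ℝ≥0 := (D.exists_tsum_mat_le p).choose

theorem tsum_mat_le (p : ℕ) (j : ℤ × Fin N) :
    ∑' i, ‖D.mat i j‖ₑ * ((1 + (i.1 - j.1).natAbs : ℕ) : ℝ≥0∞) ^ p ≤ D.colBound p :=
  (D.exists_tsum_mat_le p).choose_spec j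

theorem tsum_enorm_mat_col_le (j : ℤ × Fin N) : ∑' i, ‖D.mat i j‖ₑ ≤ D.colBound 0 := by
  simpa using D.tsum_mat_le 0 j

theorem summable_norm_col (j : ℤ × Fin N) : Summable fun i => ‖D.mat i j‖ := by
  have h : ∑' i, ‖D.mat i j‖ₑ ≠ ⊤ :=
    ((D.tsum_enorm_mat_col_le j).trans_lt ENNReal.coe_lt_top).ne
  have := ENNReal.summable_toReal h
  simpa using this

theorem tsum_norm_col_le (j : ℤ × Fin N) : ∑' i, ‖D.mat i j‖ ≤ D.colBound 0 := by
  have h := D.tsum_enorm_mat_col_le j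
  have h1 : ∑' i, ‖D.mat i j‖ₑ = ENNReal.ofReal (∑' i, ‖D.mat i j‖) := by
    rw [ENNReal.ofReal_tsum_of_nonneg (fun _ => norm_nonneg _) (D.summable_norm_col j)]
    simp
  rw [h1, ENNReal.ofReal_le_iff_le_toReal ENNReal.coe_ne_top] at h
  simpa using h

theorem summable_norm_row (i : ℤ × Fin N) : Summable fun j => ‖D.mat i j‖ := by
  simpa only [D.norm_mat_comm i] using D.summable_norm_col i

theorem tsum_norm_row_le (i : ℤ × Fin N) : ∑' j, ‖D.mat i j‖ ≤ D.colBound 0 := by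
  simpa only [D.norm_mat_comm i] using D.tsum_norm_col_le i

theorem norm_mat_le (i j : ℤ × Fin N) : ‖D.mat i j‖ ≤ D.colBound 0 :=
  ((D.summable_norm_row i).le_tsum j fun _ _ => norm_nonneg _).trans (D.tsum_norm_row_le i)

/-- A bound for the growth of frequencies. -/
def growth : ℝ := D.om + ∑ j, |D.β j|

theorem growth_nonneg : 0 ≤ D.growth :=
  add_nonneg D.om_pos.le (Finset.sum_nonneg fun _ _ => abs_nonneg _)

theorem abs_freq_le (i : ℤ × Fin N) : |D.freq i| ≤ D.growth * (1 + i.1.natAbs : ℕ) := by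
  have h1 : |D.β i.2| ≤ ∑ j, |D.β j| :=
    Finset.single_le_sum (f := fun j => |D.β j|) (fun _ _ => abs_nonneg _) (Finset.mem_univ i.2)
  have h2 : |(i.1 : ℝ)| = (i.1.natAbs : ℝ) := by rw [Nat.cast_natAbs, Int.cast_abs]
  have h3 : (0 : ℝ) ≤ i.1.natAbs := Nat.cast_nonneg _
  have h4 := D.om_pos
  calc |D.freq i| ≤ |D.om * i.1| + |D.β i.2| := abs_add_le _ _
    _ = D.om * i.1.natAbs + |D.β i.2| := by rw [abs_mul, abs_of_pos h4, h2]
    _ ≤ _ := by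
      rw [growth]; push_cast
      nlinarith [abs_nonneg (D.β i.2)]

end FourierData

/-- A mixture of Gaussians `exp(-t((ξ + b)² + V))`, each carrying a final Fourier mode `e`. -/
structure GaussMix {N : ℕ} (D : FourierData N) where
  X : Type
  [mX : MeasurableSpace X]
  μ : Measure X
  [sf : SFinite μ]
  w : X → ℂ
  b : X → ℝ
  V : X → ℝ
  e : X → ℤ × Fin N
  -- A single size function controls final mode, centre and variance; its moments against the weight
  -- yield all moments of V.
  R : X → ℕ
  hw : Measurable w
  hb : Measurable b
  hV : Measurable V
  he : Measurable e
  hR : Measurable R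
  V_nonneg : ∀ x, 0 ≤ V x
  e_le : ∀ x, 1 + (e x).1.natAbs ≤ R x
  b_le : ∀ x, |b x| ≤ D.growth * R x
  V_le : ∀ x, V x ≤ (2 * (D.growth * R x)) ^ 2
  moment : ∀ p : ℕ, ∫⁻ x, ‖w x‖ₑ * (R x : ℝ≥0∞) ^ p ∂μ < ⊤

attribute [instance] GaussMix.mX GaussMix.sf

/-! ### Dyson terms as mixtures of Gaussians -/

namespace GaussMix

variable {N : ℕ} {D : FourierData N}

/-- The mixture consisting of a single Gaussian. -/
def single (D : FourierData N) (i₀ : ℤ × Fin N) : GaussMix D where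
  X := Unit
  μ := Measure.dirac ()
  w _ := 1
  b _ := D.freq i₀
  V _ := 0
  e _ := i₀
  R _ := 1 + i₀.1.natAbs
  hw := measurable_const
  hb := measurable_const
  hV := measurable_const
  he := measurable_const
  hR := measurable_const
  V_nonneg _ := le_rfl
  e_le _ := le_rfl
  b_le _ := D.abs_freq_le i₀
  V_le _ := by positivity
  moment p := by
    simp only [lintegral_const, Measure.dirac_apply_of_mem (mem_univ _), mul_one, enorm_one, one_mul]
    exact ENNReal.pow_lt_top (ENNReal.natCast_lt_top _)

/-- The density of the weights of the next mixture. -/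
def stepWeight (G : GaussMix D) (k : ℕ) (y : G.X × ((ℤ × Fin N) × ℝ)) : ℂ :=
  -(D.mat y.2.1 (G.e y.1)) * G.w y.1 * ((y.2.2 ^ k : ℝ) : ℂ)

/-- The size function of the next mixture. -/
def stepSize (G : GaussMix D) (y : G.X × ((ℤ × Fin N) × ℝ)) : ℕ :=
  G.R y.1 * (1 + (y.2.1.1 - (G.e y.1).1).natAbs)

/-- The measure of the next mixture: a new Fourier mode and a new time are chosen. -/
def stepMeasure (G : GaussMix D) : Measure (G.X × ((ℤ × Fin N) × ℝ)) :=
  G.μ.prod (Measure.count.prod (volume.restrict (Icc (0 : ℝ) 1)))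

instance (G : GaussMix D) : SFinite G.stepMeasure := by
  unfold stepMeasure; infer_instance

theorem measurable_modes (G : GaussMix D) {α : Type*} [MeasurableSpace α]
    (f : (ℤ × Fin N) → (ℤ × Fin N) → α) :
    Measurable fun y : G.X × ((ℤ × Fin N) × ℝ) => f y.2.1 (G.e y.1) :=
  (measurable_of_countable fun ij : (ℤ × Fin N) × (ℤ × Fin N) => f ij.1 ij.2).comp
    (measurable_snd.fst.prodMk (G.he.comp measurable_fst))

theorem measurable_stepWeight (G : GaussMix D) (k : ℕ) : Measurable (G.stepWeight k) :=
  (((G.measurable_modes D.mat).neg).mul (G.hw.comp measurable_fst)).mul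
    (Complex.measurable_ofReal.comp (measurable_snd.snd.pow_const k))

theorem measurable_stepSize (G : GaussMix D) : Measurable G.stepSize :=
  (G.hR.comp measurable_fst).mul
    (G.measurable_modes fun i j => 1 + (i.1 - j.1).natAbs)

/-- The factors 1/(k+1) obtained here multiply up to the 1/k! that makes the Dyson series converge.
-/
theorem lintegral_pow_Icc (k : ℕ) :
    ∫⁻ τ in Icc (0 : ℝ) 1, ‖((τ ^ k : ℝ) : ℂ)‖ₑ = ENNReal.ofReal (1 / (k + 1)) := by
  have h1 : ∫ τ in Icc (0 : ℝ) 1, τ ^ k = 1 / (k + 1) := by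
    rw [integral_Icc_eq_integral_Ioc, ← intervalIntegral.integral_of_le zero_le_one, integral_pow]
    simp
  rw [← h1, ofReal_integral_eq_lintegral_ofReal]
  · refine setLIntegral_congr_fun measurableSet_Icc fun τ hτ => ?_
    rw [← ofReal_norm, Complex.norm_real, Real.norm_eq_abs, abs_of_nonneg (pow_nonneg hτ.1 k)]
  · exact (continuous_pow k).continuousOn.integrableOn_Icc
  · exact (ae_restrict_mem measurableSet_Icc).mono fun τ hτ => pow_nonneg hτ.1 k

/-- Tonelli: weight and size are products, so the integral splits into a weighted column sum, a time
integral and the corresponding moment of the previous mixture. -/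
theorem lintegral_step (G : GaussMix D) (k p : ℕ) :
    ∫⁻ y, ‖G.stepWeight k y‖ₑ * (G.stepSize y : ℝ≥0∞) ^ p ∂G.stepMeasure ≤
    D.colBound p * ENNReal.ofReal (1 / (k + 1)) *
      ∫⁻ x, ‖G.w x‖ₑ * (G.R x : ℝ≥0∞) ^ p ∂G.μ := by
  have hm : Measurable fun y => ‖G.stepWeight k y‖ₑ * (G.stepSize y : ℝ≥0∞) ^ p :=
    (G.measurable_stepWeight k).enorm.mul
      (((measurable_of_countable fun n : ℕ => (n : ℝ≥0∞)).comp G.measurable_stepSize).pow_const p)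
  rw [stepMeasure, lintegral_prod _ hm.aemeasurable, ← lintegral_const_mul' _ _
    (ENNReal.mul_ne_top ENNReal.coe_ne_top ENNReal.ofReal_ne_top)]
  refine lintegral_mono fun x => ?_
  have hm' : Measurable fun z : (ℤ × Fin N) × ℝ =>
      ‖G.stepWeight k (x, z)‖ₑ * (G.stepSize (x, z) : ℝ≥0∞) ^ p :=
    hm.comp measurable_prodMk_left
  rw [lintegral_prod _ hm'.aemeasurable, lintegral_count]
  have hi : ∀ i : ℤ × Fin N, ∫⁻ τ in Icc (0 : ℝ) 1,
      ‖G.stepWeight k (x, (i, τ))‖ₑ * (G.stepSize (x, (i, τ)) : ℝ≥0∞) ^ p =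
      (‖D.mat i (G.e x)‖ₑ * ((1 + (i.1 - (G.e x).1).natAbs : ℕ) : ℝ≥0∞) ^ p) *
        (ENNReal.ofReal (1 / (k + 1)) * (‖G.w x‖ₑ * (G.R x : ℝ≥0∞) ^ p)) := by
    intro i
    rw [← lintegral_pow_Icc k, mul_left_comm, mul_comm (∫⁻ τ in Icc (0 : ℝ) 1, _),
      ← mul_assoc, ← lintegral_const_mul' _ _ ?_]
    · refine lintegral_congr fun τ => ?_
      simp only [stepWeight, stepSize]
      rw [enorm_mul, enorm_mul, enorm_neg, Nat.cast_mul, mul_pow]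
      ring
    · finiteness
  simp only [hi]
  rw [ENNReal.tsum_mul_right, mul_assoc]
  gcongr
  exact D.tsum_mat_le p (G.e x)

/-- Clamping to the unit interval. -/
def clamp (τ : ℝ) : ℝ := max 0 (min τ 1)

theorem clamp_nonneg (τ : ℝ) : 0 ≤ clamp τ := le_max_left _ _

theorem clamp_le_one (τ : ℝ) : clamp τ ≤ 1 := max_le zero_le_one (min_le_right _ _)

theorem clamp_of_mem {τ : ℝ} (h : τ ∈ Icc (0 : ℝ) 1) : clamp τ = τ := by
  rw [clamp, min_eq_left h.2, max_eq_right h.1]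

theorem measurable_clamp : Measurable clamp :=
  measurable_const.max (measurable_id.min measurable_const)

theorem R_le_stepSize (G : GaussMix D) (y : G.X × ((ℤ × Fin N) × ℝ)) : G.R y.1 ≤ G.stepSize y :=
  Nat.le_mul_of_pos_right _ (by omega)

/-- Submultiplicativity: 1 + |m| ≤ (1 + |n|)(1 + |m - n|). -/
theorem mode_le_stepSize (G : GaussMix D) (y : G.X × ((ℤ × Fin N) × ℝ)) :
    1 + y.2.1.1.natAbs ≤ G.stepSize y := by
  have h1 := G.e_le y.1
  have h2 : y.2.1.1.natAbs ≤ (y.2.1.1 - (G.e y.1).1).natAbs + (G.e y.1).1.natAbs := by omega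
  rw [stepSize]
  nlinarith [Nat.zero_le (y.2.1.1 - (G.e y.1).1).natAbs, Nat.zero_le (G.e y.1).1.natAbs]

/-- One step of the Dyson expansion. -/
def step (G : GaussMix D) (k : ℕ) : GaussMix D where
  X := G.X × ((ℤ × Fin N) × ℝ)
  μ := G.stepMeasure
  w := G.stepWeight k
  -- New centre and variance come from (1-τ)(ξ+k)² + τ((ξ+b)² + V) = (ξ+b')² + V', where b' = (1-τ)k
  -- + τb and V' = τV + τ(1-τ)(k-b)². Clamping makes the structure bounds hold for every real τ,
  -- though the measure only sees [0, 1].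
  b y := (1 - clamp y.2.2) * D.freq y.2.1 + clamp y.2.2 * G.b y.1
  V y := clamp y.2.2 * G.V y.1 +
    clamp y.2.2 * (1 - clamp y.2.2) * (D.freq y.2.1 - G.b y.1) ^ 2
  e y := y.2.1
  R := G.stepSize
  hw := G.measurable_stepWeight k
  hb := by
    have h1 := measurable_clamp.comp (measurable_snd.snd :
      Measurable fun y : G.X × ((ℤ × Fin N) × ℝ) => y.2.2)
    have h2 := G.measurable_modes fun i _ => D.freq i
    exact ((measurable_const.sub h1).mul h2).add (h1.mul (G.hb.comp measurable_fst))
  hV := by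
    have h1 := measurable_clamp.comp (measurable_snd.snd :
      Measurable fun y : G.X × ((ℤ × Fin N) × ℝ) => y.2.2)
    have h2 := G.measurable_modes fun i _ => D.freq i
    exact (h1.mul (G.hV.comp measurable_fst)).add ((h1.mul (measurable_const.sub h1)).mul
      ((h2.sub (G.hb.comp measurable_fst)).pow_const 2))
  he := measurable_snd.fst
  hR := G.measurable_stepSize
  V_nonneg y := by
    have h1 := clamp_nonneg y.2.2
    have h2 := sub_nonneg.2 (clamp_le_one y.2.2)
    have h3 := G.V_nonneg y.1
    positivity
  e_le := G.mode_le_stepSize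
  b_le y := by
    have h1 := clamp_nonneg y.2.2
    have h2 := sub_nonneg.2 (clamp_le_one y.2.2)
    have hκ := D.growth_nonneg
    have h3 : |D.freq y.2.1| ≤ D.growth * G.stepSize y := (D.abs_freq_le _).trans
      (mul_le_mul_of_nonneg_left (by exact_mod_cast G.mode_le_stepSize y) hκ)
    have h4 : |G.b y.1| ≤ D.growth * G.stepSize y := (G.b_le _).trans
      (mul_le_mul_of_nonneg_left (by exact_mod_cast G.R_le_stepSize y) hκ)
    calc _ ≤ |(1 - clamp y.2.2) * D.freq y.2.1| + |clamp y.2.2 * G.b y.1| := abs_add_le _ _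
      _ = (1 - clamp y.2.2) * |D.freq y.2.1| + clamp y.2.2 * |G.b y.1| := by
        rw [abs_mul, abs_mul, abs_of_nonneg h1, abs_of_nonneg h2]
      _ ≤ (1 - clamp y.2.2) * (D.growth * G.stepSize y) +
          clamp y.2.2 * (D.growth * G.stepSize y) := by gcongr
      _ = _ := by ring
  V_le y := by
    have h1 := clamp_nonneg y.2.2
    have h2 := sub_nonneg.2 (clamp_le_one y.2.2)
    have hκ := D.growth_nonneg
    have h3 : |D.freq y.2.1| ≤ D.growth * G.stepSize y := (D.abs_freq_le _).trans
      (mul_le_mul_of_nonneg_left (by exact_mod_cast G.mode_le_stepSize y) hκ)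
    have hR : (G.R y.1 : ℝ) ≤ G.stepSize y := by exact_mod_cast G.R_le_stepSize y
    have h4 : |G.b y.1| ≤ D.growth * G.stepSize y := (G.b_le _).trans
      (mul_le_mul_of_nonneg_left hR hκ)
    have h5 : (D.freq y.2.1 - G.b y.1) ^ 2 ≤ (2 * (D.growth * G.stepSize y)) ^ 2 := by
      rw [← sq_abs]
      refine pow_le_pow_left₀ (abs_nonneg _) ((abs_sub _ _).trans ?_) 2
      linarith
    have h6 : G.V y.1 ≤ (2 * (D.growth * G.stepSize y)) ^ 2 := (G.V_le _).trans
      (pow_le_pow_left₀ (by positivity) (by gcongr) 2)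
    have h7 := sq_nonneg (2 * (D.growth * G.stepSize y))
    -- Weakening τ(1-τ) to 1-τ turns the two terms into a convex combination of the same bound.
    calc _ ≤ clamp y.2.2 * (2 * (D.growth * G.stepSize y)) ^ 2 +
          1 * (1 - clamp y.2.2) * (2 * (D.growth * G.stepSize y)) ^ 2 := by
          gcongr
          exact clamp_le_one _
      _ = _ := by ring
  moment p := (G.lintegral_step k p).trans_lt (ENNReal.mul_lt_top
    (ENNReal.mul_lt_top ENNReal.coe_lt_top ENNReal.ofReal_lt_top) (G.moment p))

/-- The terms of the Dyson expansion of the heat semigroup starting from the mode `i₀`. -/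
def dyson (D : FourierData N) (i₀ : ℤ × Fin N) : ℕ → GaussMix D
  | 0 => single D i₀
  | k + 1 => (dyson D i₀ k).step k

theorem integrable_w (G : GaussMix D) : Integrable G.w G.μ := by
  refine ⟨G.hw.aestronglyMeasurable, ?_⟩
  simpa [HasFiniteIntegral] using G.moment 0

/-- The total mass of a mixture. -/
def mass (G : GaussMix D) : ℝ := ∫ x, ‖G.w x‖ ∂G.μ

theorem lintegral_dyson_le (i₀ : ℤ × Fin N) (k : ℕ) :
    ∫⁻ x, ‖(dyson D i₀ k).w x‖ₑ ∂(dyson D i₀ k).μ ≤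
      ENNReal.ofReal ((D.colBound 0 : ℝ) ^ k / k.factorial) := by
  induction k with
  | zero =>
    change ∫⁻ x : Unit, ‖(1 : ℂ)‖ₑ ∂(Measure.dirac ()) ≤ _
    rw [lintegral_const]
    simp
  | succ k ih =>
    have h := (dyson D i₀ k).lintegral_step k 0
    simp only [pow_zero, mul_one] at h
    refine h.trans ((mul_le_mul_right ih _).trans ?_)
    rw [← ENNReal.ofReal_coe_nnreal, ← ENNReal.ofReal_mul (by positivity),
      ← ENNReal.ofReal_mul (by positivity)]
    refine ENNReal.ofReal_le_ofReal (le_of_eq ?_)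
    rw [Nat.factorial_succ]
    push_cast
    field_simp
    ring

theorem mass_dyson_le (i₀ : ℤ × Fin N) (k : ℕ) :
    (dyson D i₀ k).mass ≤ (D.colBound 0 : ℝ) ^ k / k.factorial := by
  rw [mass, integral_norm_eq_lintegral_enorm (dyson D i₀ k).hw.aestronglyMeasurable]
  exact ENNReal.toReal_le_of_le_ofReal (by positivity) (lintegral_dyson_le i₀ k)

/-- The mixture paired with a function of the final mode. -/
def pair (G : GaussMix D) (h : ℤ × Fin N → ℂ) (t ξ : ℝ) : ℂ :=
  ∫ x, h (G.e x) * G.w x * (Real.exp (-(t * ((ξ + G.b x) ^ 2 + G.V x))) : ℂ) ∂G.μ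

/-- The part of the mixture with final mode `i`. -/
def ker (G : GaussMix D) (t ξ : ℝ) (i : ℤ × Fin N) : ℂ :=
  G.pair (fun j => if j = i then 1 else 0) t ξ

variable {h : ℤ × Fin N → ℂ} {M : ℝ}

theorem measurable_pair (G : GaussMix D) (h : ℤ × Fin N → ℂ) (t ξ : ℝ) :
    Measurable fun x => h (G.e x) * G.w x *
      (Real.exp (-(t * ((ξ + G.b x) ^ 2 + G.V x))) : ℂ) :=
  (((measurable_of_countable h).comp G.he).mul G.hw).mul (Complex.measurable_ofReal.comp
    (Real.measurable_exp.comp (((((G.hb.const_add ξ).pow_const 2).add G.hV).const_mul t).neg)))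

theorem norm_pair_integrand_le (G : GaussMix D) (hM : ∀ i, ‖h i‖ ≤ M) {t : ℝ} (ht : 0 ≤ t)
    (ξ : ℝ) (x : G.X) :
    ‖h (G.e x) * G.w x * (Real.exp (-(t * ((ξ + G.b x) ^ 2 + G.V x))) : ℂ)‖ ≤ M * ‖G.w x‖ := by
  have h1 : Real.exp (-(t * ((ξ + G.b x) ^ 2 + G.V x))) ≤ 1 := by
    have := G.V_nonneg x
    exact Real.exp_le_one_iff.2 (neg_nonpos.2 (by positivity))
  rw [norm_mul, norm_mul, Complex.norm_real, Real.norm_eq_abs, abs_of_pos (Real.exp_pos _)]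
  have hM0 : 0 ≤ M := (norm_nonneg _).trans (hM (G.e x))
  calc ‖h (G.e x)‖ * ‖G.w x‖ * _ ≤ M * ‖G.w x‖ * 1 := by
        gcongr
        exact hM _
    _ = _ := mul_one _

theorem integrable_pair (G : GaussMix D) (hM : ∀ i, ‖h i‖ ≤ M) {t : ℝ} (ht : 0 ≤ t) (ξ : ℝ) :
    Integrable (fun x => h (G.e x) * G.w x *
      (Real.exp (-(t * ((ξ + G.b x) ^ 2 + G.V x))) : ℂ)) G.μ :=
  (G.integrable_w.norm.const_mul M).mono' (G.measurable_pair h t ξ).aestronglyMeasurable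
    (ae_of_all _ (G.norm_pair_integrand_le hM ht ξ))

theorem norm_pair_le (G : GaussMix D) (hM : ∀ i, ‖h i‖ ≤ M) {t : ℝ} (ht : 0 ≤ t) (ξ : ℝ) :
    ‖G.pair h t ξ‖ ≤ M * G.mass := by
  rw [mass, ← integral_const_mul]
  exact norm_integral_le_of_norm_le (G.integrable_w.norm.const_mul M)
    (ae_of_all _ (G.norm_pair_integrand_le hM ht ξ))

theorem continuousOn_pair (G : GaussMix D) (hM : ∀ i, ‖h i‖ ≤ M) (ξ : ℝ) :
    ContinuousOn (fun t => G.pair h t ξ) (Ici 0) := by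
  refine continuousOn_of_dominated (bound := fun x => M * ‖G.w x‖)
    (fun t _ => (G.measurable_pair h t ξ).aestronglyMeasurable)
    (fun t ht => ae_of_all _ (G.norm_pair_integrand_le hM ht ξ))
    (G.integrable_w.norm.const_mul M) (ae_of_all _ fun x => ?_)
  fun_prop

theorem norm_ite_le (i j : ℤ × Fin N) : ‖(if j = i then 1 else 0 : ℂ)‖ ≤ 1 := by
  split_ifs <;> simp

theorem norm_ker_le (G : GaussMix D) {t : ℝ} (ht : 0 ≤ t) (ξ : ℝ) (i : ℤ × Fin N) :
    ‖G.ker t ξ i‖ ≤ G.mass := by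
  have h := G.norm_pair_le (norm_ite_le i) ht ξ
  rwa [one_mul] at h

/-- Splitting by final mode: at each point of the mixture exactly one mode can contribute, so
dominated convergence applies with the full integrand as bound. -/
theorem hasSum_pair (G : GaussMix D) (hM : ∀ i, ‖h i‖ ≤ M) {t : ℝ} (ht : 0 ≤ t) (ξ : ℝ) :
    HasSum (fun i => h i * G.ker t ξ i) (G.pair h t ξ) := by
  have hsum : ∀ x (r : ℝ), HasSum (fun i => if i = G.e x then r else 0) r :=
    fun x r => hasSum_ite_eq (G.e x) r
  have key := hasSum_integral_of_dominated_convergence (μ := G.μ)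
    (F := fun i x => h i * ((if G.e x = i then 1 else 0) * G.w x *
      (Real.exp (-(t * ((ξ + G.b x) ^ 2 + G.V x))) : ℂ)))
    (f := fun x => h (G.e x) * G.w x * (Real.exp (-(t * ((ξ + G.b x) ^ 2 + G.V x))) : ℂ))
    (fun i x => if i = G.e x then M * ‖G.w x‖ else 0)
    (fun i => ((G.measurable_pair (fun j => if j = i then 1 else 0) t ξ).const_mul
      (h i)).aestronglyMeasurable) ?_
    (ae_of_all _ fun x => (hsum x _).summable) ?_ (ae_of_all _ fun x => ?_)
  · simp only [integral_const_mul] at key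
    exact key
  · refine fun i => ae_of_all _ fun x => ?_
    by_cases hi : i = G.e x
    · subst hi
      simp only [if_true]
      rw [one_mul, ← mul_assoc]
      exact G.norm_pair_integrand_le hM ht ξ x
    · simp [hi, Ne.symm hi]
  · refine (G.integrable_w.norm.const_mul M).congr (ae_of_all _ fun x => ?_)
    exact (hsum x _).tsum_eq.symm
  · have h1 := hasSum_ite_eq (G.e x)
      (h (G.e x) * G.w x * (Real.exp (-(t * ((ξ + G.b x) ^ 2 + G.V x))) : ℂ))
    refine h1.congr_fun fun i => ?_
    by_cases hi : i = G.e x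
    · subst hi
      simp only [if_true]
      ring
    · simp [hi, Ne.symm hi]

/-- The recursion satisfied by the Dyson terms. -/
theorem step_ker (G : GaussMix D) (k : ℕ) {t : ℝ} (ht : 0 ≤ t) (ξ : ℝ) (i : ℤ × Fin N) :
    (t : ℂ) ^ (k + 1) * (G.step k).ker t ξ i =
      -∫ s in (0 : ℝ)..t, (Real.exp (-((t - s) * (ξ + D.freq i) ^ 2)) : ℂ) *
        ((s : ℂ) ^ k * G.pair (D.mat i) s ξ) := by
  let f : G.X × ((ℤ × Fin N) × ℝ) → ℂ := fun y =>
    (if y.2.1 = i then 1 else 0) * G.stepWeight k y *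
      (Real.exp (-(t * ((ξ + ((1 - clamp y.2.2) * D.freq y.2.1 + clamp y.2.2 * G.b y.1)) ^ 2 +
        (clamp y.2.2 * G.V y.1 +
          clamp y.2.2 * (1 - clamp y.2.2) * (D.freq y.2.1 - G.b y.1) ^ 2)))) : ℂ)
  have hint : Integrable f (G.μ.prod (Measure.count.prod (volume.restrict (Icc (0 : ℝ) 1)))) :=
    (G.step k).integrable_pair (norm_ite_le i) ht ξ
  -- By Fubini the indicator retains only the new mode i; the convex combination identity then
  -- splits the exponential into free evolution for time t - tτ and the old mixture at time tτ.
  have hprod : (G.step k).ker t ξ i = ∫ τ in Icc (0 : ℝ) 1,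
      -((Real.exp (-((t - t * τ) * (ξ + D.freq i) ^ 2)) : ℂ) *
        ((τ : ℂ) ^ k * G.pair (D.mat i) (t * τ) ξ)) := by
    have h1 : (G.step k).ker t ξ i = ∫ z : (ℤ × Fin N) × ℝ, ∫ x, f (x, z) ∂G.μ
        ∂(Measure.count.prod (volume.restrict (Icc (0 : ℝ) 1))) :=
      integral_prod_symm _ hint
    have h2 := hint.integral_prod_right
    rw [h1, integral_prod _ h2, integral_countable h2.integral_prod_left, tsum_eq_single i]
    · simp only [Measure.real, Measure.count_singleton, ENNReal.toReal_one, one_smul]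
      refine setIntegral_congr_fun measurableSet_Icc fun τ hτ => ?_
      simp only [pair]
      rw [← integral_const_mul, ← integral_const_mul, ← integral_neg]
      refine integral_congr_ae (ae_of_all _ fun x => ?_)
      simp only [f, stepWeight, clamp_of_mem hτ, if_true, one_mul]
      have h3 : Real.exp (-(t * ((ξ + ((1 - τ) * D.freq i + τ * G.b x)) ^ 2 +
          (τ * G.V x + τ * (1 - τ) * (D.freq i - G.b x) ^ 2)))) =
          Real.exp (-((t - t * τ) * (ξ + D.freq i) ^ 2)) *
            Real.exp (-(t * τ * ((ξ + G.b x) ^ 2 + G.V x))) := by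
        rw [← Real.exp_add]; congr 1; ring
      rw [h3]
      push_cast
      ring
    · intro j hj
      simp [f, hj]
  -- Substituting s = tτ turns t^{k+1} τ^k dτ into s^k ds.
  have hsub := intervalIntegral.smul_integral_comp_mul_left (a := 0) (b := 1) (fun s : ℝ =>
    (Real.exp (-((t - s) * (ξ + D.freq i) ^ 2)) : ℂ) *
      ((s : ℂ) ^ k * G.pair (D.mat i) s ξ)) t
  simp only [mul_zero, mul_one] at hsub
  rw [← hsub, hprod, integral_neg, integral_Icc_eq_integral_Ioc,
    ← intervalIntegral.integral_of_le zero_le_one, mul_neg, Complex.real_smul, pow_succ', mul_assoc,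
    ← intervalIntegral.integral_const_mul]
  congr 2
  refine intervalIntegral.integral_congr fun τ _ => ?_
  push_cast
  ring

end GaussMix

end

/-! ### Convergence of the Dyson expansion -/

section

open scoped ENNReal NNReal

namespace GaussMix

variable {N : ℕ} {D : FourierData N} {y : ℤ × Fin N → ℝ → ℂ} {T Y ξ : ℝ} {i₀ : ℤ × Fin N}

theorem single_ker (t ξ : ℝ) (i : ℤ × Fin N) : (single D i₀).ker t ξ i =
    if i = i₀ then (Real.exp (-(t * (ξ + D.freq i) ^ 2)) : ℂ) else 0 := by
  change ∫ _ : Unit, _ ∂(Measure.dirac ()) = _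
  rw [integral_dirac]
  simp only [single, mul_one, add_zero]
  by_cases h : i = i₀
  · simp [h]
  · simp [h, Ne.symm h]

theorem norm_tsum_mat_mul_le (D : FourierData N) {v : ℤ × Fin N → ℂ} (hv : ∀ j, ‖v j‖ ≤ Y)
    (i : ℤ × Fin N) : ‖∑' j, D.mat i j * v j‖ ≤ D.colBound 0 * Y := by
  have hY : 0 ≤ Y := (norm_nonneg _).trans (hv i)
  refine (tsum_of_norm_bounded ((D.summable_norm_row i).mul_right Y).hasSum fun j => ?_).trans ?_
  · rw [norm_mul]
    gcongr
    exact hv j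
  · rw [tsum_mul_right]
    exact mul_le_mul_of_nonneg_right (D.tsum_norm_row_le i) hY

/-- The Dyson expansion converges to any bounded solution of the Volterra equation of the heat
semigroup, and quantitatively so. -/
theorem norm_sub_dyson_le (hc : ∀ i, ContinuousOn (y i) (Icc 0 T))
    (hb : ∀ i, ∀ t ∈ Icc 0 T, ‖y i t‖ ≤ Y)
    (heq : ∀ i, ∀ t ∈ Icc 0 T, y i t =
      (if i = i₀ then (Real.exp (-(t * (ξ + D.freq i) ^ 2)) : ℂ) else 0) -
      ∫ s in (0 : ℝ)..t, (Real.exp (-((t - s) * (ξ + D.freq i) ^ 2)) : ℂ) *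
        ∑' j, D.mat i j * y j s) (K : ℕ) :
    ∀ i, ∀ t ∈ Icc 0 T, ‖y i t - ∑ k ∈ Finset.range K, (t : ℂ) ^ k * (dyson D i₀ k).ker t ξ i‖ ≤
      Y * (D.colBound 0 * t) ^ K / K.factorial := by
  induction K with
  | zero => simpa using hb
  | succ K ih =>
    intro i t ht
    have hsub : Icc 0 t ⊆ Icc 0 T := Icc_subset_Icc_right ht.2
    have hE : Continuous fun s : ℝ => (Real.exp (-((t - s) * (ξ + D.freq i) ^ 2)) : ℂ) := by
      fun_prop
    have hy : ContinuousOn (fun s => ∑' j, D.mat i j * y j s) (Icc 0 t) := by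
      refine continuousOn_tsum (fun j => continuousOn_const.mul ((hc j).mono hsub))
        ((D.summable_norm_row i).mul_right Y) fun j s hs => ?_
      rw [norm_mul]
      gcongr
      exact hb j s (hsub hs)
    have hp : ∀ k, ContinuousOn (fun s : ℝ => (s : ℂ) ^ k * (dyson D i₀ k).pair (D.mat i) s ξ)
        (Icc 0 t) := fun k => ContinuousOn.mul (by fun_prop)
      (((dyson D i₀ k).continuousOn_pair (D.norm_mat_le i) ξ).mono Icc_subset_Ici_self)
    have hI : ∀ g : ℝ → ℂ, ContinuousOn g (Icc 0 t) → IntervalIntegrable (fun s =>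
        (Real.exp (-((t - s) * (ξ + D.freq i) ^ 2)) : ℂ) * g s) volume 0 t := fun g hg =>
      (hE.continuousOn.mul hg).intervalIntegrable_of_Icc ht.1
    -- The error after K + 1 terms is the Volterra operator applied to the error after K terms.
    -- Integrating the bound s^K then improves t^K/K! to t^{K+1}/(K+1)!.
    have hrec : y i t - ∑ k ∈ Finset.range (K + 1), (t : ℂ) ^ k * (dyson D i₀ k).ker t ξ i =
        -∫ s in (0 : ℝ)..t, (Real.exp (-((t - s) * (ξ + D.freq i) ^ 2)) : ℂ) *
          ((∑' j, D.mat i j * y j s) -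
            ∑ k ∈ Finset.range K, (s : ℂ) ^ k * (dyson D i₀ k).pair (D.mat i) s ξ) := by
      simp only [mul_sub, Finset.mul_sum]
      rw [intervalIntegral.integral_sub (hI _ hy), intervalIntegral.integral_finsetSum]
      · rw [Finset.sum_range_succ', heq i t ht]
        simp only [dyson, (dyson D i₀ _).step_ker _ ht.1 ξ i, pow_zero, one_mul, single_ker,
          Finset.sum_neg_distrib]
        ring
      · exact fun k _ => hI _ (hp k)
      · have := IntervalIntegrable.sum (μ := volume) (a := 0) (b := t) (Finset.range K)
          (f := fun k s => (Real.exp (-((t - s) * (ξ + D.freq i) ^ 2)) : ℂ) *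
            ((s : ℂ) ^ k * (dyson D i₀ k).pair (D.mat i) s ξ)) fun k _ => hI _ (hp k)
        simpa [Finset.sum_fn] using this
    rw [hrec, norm_neg]
    have hbound : ∀ s ∈ Ioc 0 t, ‖(Real.exp (-((t - s) * (ξ + D.freq i) ^ 2)) : ℂ) *
          ((∑' j, D.mat i j * y j s) -
            ∑ k ∈ Finset.range K, (s : ℂ) ^ k * (dyson D i₀ k).pair (D.mat i) s ξ)‖ ≤
        Y * (D.colBound 0 : ℝ) ^ (K + 1) / K.factorial * s ^ K := by
      intro s hs
      have hs' : s ∈ Icc 0 T := hsub (Ioc_subset_Icc_self hs)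
      have h1 : HasSum (fun j => D.mat i j * (y j s -
          ∑ k ∈ Finset.range K, (s : ℂ) ^ k * (dyson D i₀ k).ker s ξ j))
          ((∑' j, D.mat i j * y j s) -
            ∑ k ∈ Finset.range K, (s : ℂ) ^ k * (dyson D i₀ k).pair (D.mat i) s ξ) := by
        have h2 : Summable fun j => D.mat i j * y j s := by
          refine Summable.of_norm_bounded ((D.summable_norm_row i).mul_right Y) fun j => ?_
          rw [norm_mul]
          gcongr
          exact hb j s hs'
        have h3 := h2.hasSum.sub (hasSum_sum (s := Finset.range K) fun k _ =>
          ((dyson D i₀ k).hasSum_pair (D.norm_mat_le i) hs'.1 ξ).mul_left ((s : ℂ) ^ k))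
        refine h3.congr_fun fun j => ?_
        rw [mul_sub, Finset.mul_sum]
        congr 1
        exact Finset.sum_congr rfl fun k _ => by ring
      rw [← h1.tsum_eq, norm_mul, Complex.norm_real, Real.norm_eq_abs, abs_of_pos (Real.exp_pos _)]
      have h4 := norm_tsum_mat_mul_le D (fun j => ih j s hs') i
      have h5 : Real.exp (-((t - s) * (ξ + D.freq i) ^ 2)) ≤ 1 :=
        Real.exp_le_one_iff.2 (neg_nonpos.2 (mul_nonneg (sub_nonneg.2 hs.2) (sq_nonneg _)))
      refine (mul_le_mul h5 h4 (norm_nonneg _) zero_le_one).trans (le_of_eq ?_)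
      rw [mul_pow]
      ring
    refine (intervalIntegral.norm_integral_le_of_norm_le ht.1 (ae_of_all _ hbound)
      (Continuous.intervalIntegrable (by fun_prop) 0 t)).trans (le_of_eq ?_)
    rw [intervalIntegral.integral_const_mul, integral_pow, Nat.factorial_succ]
    push_cast
    field_simp
    ring

theorem hasSum_dyson (hc : ∀ i, ContinuousOn (y i) (Icc 0 T))
    (hb : ∀ i, ∀ t ∈ Icc 0 T, ‖y i t‖ ≤ Y)
    (heq : ∀ i, ∀ t ∈ Icc 0 T, y i t =
      (if i = i₀ then (Real.exp (-(t * (ξ + D.freq i) ^ 2)) : ℂ) else 0) -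
      ∫ s in (0 : ℝ)..t, (Real.exp (-((t - s) * (ξ + D.freq i) ^ 2)) : ℂ) *
        ∑' j, D.mat i j * y j s) (i : ℤ × Fin N) {t : ℝ} (ht : t ∈ Icc 0 T) :
    HasSum (fun k => (t : ℂ) ^ k * (dyson D i₀ k).ker t ξ i) (y i t) := by
  have hexp := Real.summable_pow_div_factorial ((D.colBound 0 : ℝ) * t)
  have hsum : Summable fun k => (t : ℂ) ^ k * (dyson D i₀ k).ker t ξ i := by
    refine Summable.of_norm_bounded hexp fun k => ?_
    rw [norm_mul, norm_pow, Complex.norm_real, Real.norm_eq_abs, abs_of_nonneg ht.1, mul_pow,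
      mul_comm, mul_div_right_comm]
    gcongr
    · exact pow_nonneg ht.1 _
    · exact ((dyson D i₀ k).norm_ker_le ht.1 ξ i).trans (mass_dyson_le i₀ k)
  rw [hsum.hasSum_iff_tendsto_nat, tendsto_iff_norm_sub_tendsto_zero]
  refine squeeze_zero (fun _ => norm_nonneg _) (fun K => ?_)
    (by simpa using hexp.tendsto_atTop_zero.const_mul Y)
  rw [norm_sub_rev, ← mul_div_assoc]
  exact norm_sub_dyson_le hc hb heq K i t ht

end GaussMix

end

/-! ### Gaussian sums and Poisson summation -/

section

open scoped ENNReal NNReal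

section GaussSum

variable {om b t : ℝ}

/-- A Gaussian sum over a shifted lattice. -/
def gaussSum (om t b : ℝ) : ℝ := ∑' l : ℤ, Real.exp (-(t * (om * l + b) ^ 2))

theorem summable_exp_neg_sq {c : ℝ} (hc : 0 < c) :
    Summable fun l : ℤ => Real.exp (-(c * (l : ℝ) ^ 2)) := by
  refine Summable.of_nonneg_of_le (fun _ => (Real.exp_pos _).le) (fun l => ?_)
    (summable_one_add_natAbs.mul_left (2 * (1 + 1 / c)))
  have h2 : (l : ℝ) ^ 2 = (l.natAbs : ℝ) ^ 2 := by
    rw [← sq_abs, Nat.cast_natAbs, Int.cast_abs]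
  rw [h2, Real.exp_neg, mul_one_div, inv_le_comm₀ (Real.exp_pos _) (by positivity), inv_div]
  set n : ℝ := (l.natAbs : ℝ)
  have h3 : c * n ^ 2 + 1 ≤ Real.exp (c * n ^ 2) := Real.add_one_le_exp _
  refine le_trans ?_ h3
  rw [div_le_iff₀ (by positivity)]
  have h4 : (c * n ^ 2 + 1) * (2 * (1 + 1 / c)) =
      2 * n ^ 2 + 2 + 2 * c * n ^ 2 + 2 / c := by field_simp; ring
  rw [h4]
  have h5 : 0 ≤ c * n ^ 2 := by positivity
  have h6 : 0 ≤ 2 / c := by positivity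
  nlinarith [sq_nonneg (n - 1)]

/-- Comparison with the centred sum through (om·l + b)² ≥ om² l²/2 - b². -/
theorem summable_gaussSum (hom : 0 < om) (ht : 0 < t) (b : ℝ) :
    Summable fun l : ℤ => Real.exp (-(t * (om * l + b) ^ 2)) := by
  refine Summable.of_nonneg_of_le (fun _ => (Real.exp_pos _).le) (fun l => ?_)
    ((summable_exp_neg_sq (show 0 < t * om ^ 2 / 2 by positivity)).mul_left (Real.exp (t * b ^ 2)))
  rw [← Real.exp_add, Real.exp_le_exp]
  nlinarith [mul_nonneg ht.le (sq_nonneg (om * l + 2 * b))]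

/-- e^{-x} ≤ (M+1)!/x^{M+1} at x = c l²/t makes every term with l ≠ 0 of size t^{M+1} l⁻². The
factor 4 is from (1 + n)² ≤ 4n² for n ≥ 1. -/
theorem tsum_exp_inv_le {c : ℝ} (hc : 0 < c) (M : ℕ) : ∃ C, 0 ≤ C ∧ ∀ t > 0,
    (Summable fun l : ℤ => if l = 0 then 0 else Real.exp (-(c / t * (l : ℝ) ^ 2))) ∧
    ∑' l : ℤ, (if l = 0 then 0 else Real.exp (-(c / t * (l : ℝ) ^ 2))) ≤ C * t ^ (M + 1) := by
  refine ⟨∑' l : ℤ, (M + 1).factorial * c⁻¹ ^ (M + 1) * 4 * (1 / (1 + l.natAbs : ℝ) ^ 2),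
    tsum_nonneg fun l => by positivity, fun t ht => ?_⟩
  have hs := (summable_one_add_natAbs.mul_left ((M + 1).factorial * c⁻¹ ^ (M + 1) * 4)).mul_right
    (t ^ (M + 1))
  have hle : ∀ l : ℤ, (if l = 0 then 0 else Real.exp (-(c / t * (l : ℝ) ^ 2))) ≤
      (M + 1).factorial * c⁻¹ ^ (M + 1) * 4 * (1 / (1 + l.natAbs : ℝ) ^ 2) * t ^ (M + 1) := by
    intro l
    split_ifs with hl
    · positivity
    have h2 : (l : ℝ) ^ 2 = (l.natAbs : ℝ) ^ 2 := by
      rw [← sq_abs, Nat.cast_natAbs, Int.cast_abs]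
    have h1 : (1 : ℝ) ≤ l.natAbs := by exact_mod_cast Int.natAbs_pos.2 hl
    rw [h2]
    set n : ℝ := (l.natAbs : ℝ)
    have h3 := Real.pow_div_factorial_le_exp (c / t * n ^ 2) (by positivity) (M + 1)
    rw [Real.exp_neg]
    calc (Real.exp (c / t * n ^ 2))⁻¹ ≤ ((c / t * n ^ 2) ^ (M + 1) / (M + 1).factorial)⁻¹ :=
          inv_anti₀ (by positivity) h3
      _ = (M + 1).factorial * c⁻¹ ^ (M + 1) * (1 / (n ^ 2) ^ (M + 1)) * t ^ (M + 1) := by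
          rw [mul_pow, div_pow, inv_pow]; field_simp
      _ ≤ (M + 1).factorial * c⁻¹ ^ (M + 1) * (1 / n ^ 2) * t ^ (M + 1) := by
          gcongr
          exact le_self_pow₀ (one_le_pow₀ h1) (by omega)
      _ ≤ (M + 1).factorial * c⁻¹ ^ (M + 1) * (4 * (1 / (1 + n) ^ 2)) * t ^ (M + 1) := by
          gcongr
          rw [mul_one_div, div_le_div_iff₀ (by positivity) (by positivity)]
          nlinarith
      _ = _ := by ring
  have hsum := Summable.of_nonneg_of_le (fun l => by split_ifs <;> positivity) hle hs
  exact ⟨hsum, (hsum.tsum_le_tsum hle hs).trans (le_of_eq tsum_mul_right)⟩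

/-- Poisson summation, after cancelling e^{tb²} on both sides. On the dual side the shift b survives
only as a phase, the source of uniformity in b. -/
theorem gaussSum_eq (hom : 0 < om) (ht : 0 < t) (b : ℝ) :
    (√(t / π) * om : ℂ) * (gaussSum om t b : ℂ) =
      ∑' n : ℤ, Complex.exp (-(π ^ 2 / om ^ 2 / t * (n : ℝ) ^ 2 : ℝ) + 2 * π * b / om * n * Complex.I) := by
  have hπ := Real.pi_pos
  have ha : 0 < ((t * om ^ 2 / π : ℝ) : ℂ).re := by
    rw [Complex.ofReal_re]; positivity
  have h := Complex.tsum_exp_neg_quadratic ha ((-(t * om * b / π) : ℝ) : ℂ)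
  have hom' : (om : ℂ) ≠ 0 := by exact_mod_cast hom.ne'
  have ht' : (t : ℂ) ≠ 0 := by exact_mod_cast ht.ne'
  have hπ' : (π : ℂ) ≠ 0 := by exact_mod_cast hπ.ne'
  have hsq : ((t * om ^ 2 / π : ℝ) : ℂ) ^ (1 / 2 : ℂ) = (√(t / π) * om : ℂ) := by
    rw [show t * om ^ 2 / π = t / π * om ^ 2 by ring, show (1 / 2 : ℂ) = ((1 / 2 : ℝ) : ℂ) by simp,
      ← Complex.ofReal_cpow (by positivity), ← Real.sqrt_eq_rpow, Real.sqrt_mul (by positivity),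
      Real.sqrt_sq hom.le]
    push_cast; rfl
  have hl : ∀ n : ℤ, Complex.exp (-π * ((t * om ^ 2 / π : ℝ) : ℂ) * n ^ 2 +
      2 * π * ((-(t * om * b / π) : ℝ) : ℂ) * n) =
      Complex.exp (t * b ^ 2) * ((Real.exp (-(t * (om * n + b) ^ 2)) : ℝ) : ℂ) := by
    intro n
    rw [Complex.ofReal_exp, ← Complex.exp_add]
    congr 1
    push_cast
    field_simp
    ring
  have hr : ∀ n : ℤ, Complex.exp (-π / ((t * om ^ 2 / π : ℝ) : ℂ) *
      (n + Complex.I * ((-(t * om * b / π) : ℝ) : ℂ)) ^ 2) = Complex.exp (t * b ^ 2) *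
      Complex.exp (-(π ^ 2 / om ^ 2 / t * (n : ℝ) ^ 2 : ℝ) + 2 * π * b / om * n * Complex.I) := by
    intro n
    rw [← Complex.exp_add]
    congr 1
    push_cast
    field_simp
    ring_nf
    simp only [Complex.I_sq]
    ring
  simp only [hl, hr, hsq] at h
  rw [tsum_mul_left, tsum_mul_left] at h
  have hne : (√(t / π) * om : ℂ) ≠ 0 := by
    refine mul_ne_zero ?_ hom'
    exact_mod_cast (Real.sqrt_pos.2 (by positivity)).ne'
  rw [gaussSum, Complex.ofReal_tsum]
  have h2 : Complex.exp (t * b ^ 2) ≠ 0 := Complex.exp_ne_zero _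
  refine mul_left_cancel₀ h2 ?_
  rw [mul_left_comm, h, one_div, mul_inv_cancel_left₀ hne]

/-- Gaussian sums are constant up to errors of arbitrarily high order for small times. -/
theorem exists_gaussSum_sub_le (hom : 0 < om) (M : ℕ) : ∃ C, 0 ≤ C ∧ ∀ t > 0, ∀ b,
    |√(4 * π * t) * gaussSum om t b - 2 * π / om| ≤ C * t ^ (M + 1) := by
  have hπ := Real.pi_pos
  obtain ⟨C, hC, h⟩ := tsum_exp_inv_le (show 0 < π ^ 2 / om ^ 2 by positivity) M
  refine ⟨2 * π / om * C, by positivity, fun t ht b => ?_⟩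
  obtain ⟨hs, hle⟩ := h t ht
  have hg := gaussSum_eq hom ht b
  set F : ℤ → ℂ := fun n =>
    Complex.exp (-(π ^ 2 / om ^ 2 / t * (n : ℝ) ^ 2 : ℝ) + 2 * π * b / om * n * Complex.I)
  have hF : ∀ n, ‖F n‖ = Real.exp (-(π ^ 2 / om ^ 2 / t * (n : ℝ) ^ 2)) := by
    intro n
    simp only [F, Complex.norm_exp]
    congr 1
    rw [Complex.add_re, ← Complex.ofReal_neg, Complex.ofReal_re,
      show (2 * π * b / om * n * Complex.I : ℂ) = ((2 * π * b / om * n : ℝ) : ℂ) * Complex.I by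
        push_cast; ring, Complex.re_ofReal_mul, Complex.I_re, mul_zero, add_zero]
  have hF0 : F 0 = 1 := by simp [F]
  have hFs : Summable F := by
    refine Summable.of_norm ?_
    simp only [hF]
    exact summable_exp_neg_sq (by positivity)
  -- The dual mode n = 0 contributes the constant; all other modes have modulus e^{-c n²/t} whatever
  -- b is.
  have h1 : (∑' n, F n) - 1 = ∑' n : ℤ, (if n = 0 then 0 else F n) := by
    rw [hFs.tsum_eq_add_tsum_ite 0, hF0]; ring
  have h2 : ‖(∑' n, F n) - 1‖ ≤ C * t ^ (M + 1) := by
    rw [h1]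
    refine (tsum_of_norm_bounded hs.hasSum fun n => ?_).trans hle
    split_ifs
    · simp
    · exact (hF n).le
  have h3 : √(4 * π * t) = 2 * π * √(t / π) := by
    rw [show 4 * π * t = (2 * π) ^ 2 * (t / π) by field_simp; ring, Real.sqrt_mul (by positivity),
      Real.sqrt_sq (by positivity)]
  have h4 : √(4 * π * t) * gaussSum om t b - 2 * π / om =
      2 * π / om * (√(t / π) * om * gaussSum om t b - 1) := by
    rw [h3]; field_simp
  rw [h4, abs_mul, abs_of_pos (by positivity), mul_assoc (2 * π / om) C]
  refine mul_le_mul_of_nonneg_left ?_ (by positivity)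
  rw [← hg] at h2
  rw [← Real.norm_eq_abs, ← Complex.norm_real]
  simpa using h2

theorem gaussSum_nonneg (om t b : ℝ) : 0 ≤ gaussSum om t b :=
  tsum_nonneg fun _ => (Real.exp_pos _).le

end GaussSum

end

/-! ### Mixtures summed over the frequency lattice -/

section

open scoped ENNReal NNReal

theorem measurable_gaussSum (om t : ℝ) :
    Measurable (gaussSum om t) := by
  exact Measurable.tsum fun l => by fun_prop

/-- Needed for all x ≥ 0, since tV is unbounded over a mixture. For x ≤ 1 it is Taylor's remainder
with e ≤ 3; for x ≥ 1 all monomials are at most x^M, their coefficients sum to at most 3, and e^{-x}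
≤ x^M. -/
theorem abs_exp_neg_sub_sum_le {x : ℝ} (hx : 0 ≤ x) (M : ℕ) :
    |Real.exp (-x) - ∑ m ∈ Finset.range M, (-x) ^ m / m.factorial| ≤ 4 * x ^ M := by
  have he : Real.exp 1 ≤ 3 := (Real.exp_one_lt_d9.trans (by norm_num)).le
  rcases le_total x 1 with h1 | h1
  · have h := Complex.norm_exp_sub_sum_le_norm_mul_exp ((-x : ℝ) : ℂ) M
    have h2 : Complex.exp ((-x : ℝ) : ℂ) - ∑ m ∈ Finset.range M, ((-x : ℝ) : ℂ) ^ m / m.factorial =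
        ((Real.exp (-x) - ∑ m ∈ Finset.range M, (-x) ^ m / m.factorial : ℝ) : ℂ) := by
      push_cast; rfl
    rw [h2, Complex.norm_real, Complex.norm_real, norm_neg, Real.norm_eq_abs, Real.norm_eq_abs,
      abs_of_nonneg hx, mul_comm] at h
    refine h.trans (mul_le_mul_of_nonneg_right ?_ (pow_nonneg hx _))
    linarith [Real.exp_le_exp.2 h1]
  · have h2 : |∑ m ∈ Finset.range M, (-x) ^ m / m.factorial| ≤ 3 * x ^ M := by
      calc _ ≤ ∑ m ∈ Finset.range M, |(-x) ^ m / m.factorial| := Finset.abs_sum_le_sum_abs _ _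
        _ ≤ ∑ m ∈ Finset.range M, 1 ^ m / m.factorial * x ^ M := by
          refine Finset.sum_le_sum fun m hm => ?_
          rw [abs_div, abs_pow, abs_neg, abs_of_nonneg hx, Nat.abs_cast, one_pow, one_div_mul_eq_div]
          gcongr
          exact (Finset.mem_range.1 hm).le
        _ ≤ 3 * x ^ M := by
          rw [← Finset.sum_mul]
          exact mul_le_mul_of_nonneg_right ((Real.sum_le_exp_of_nonneg zero_le_one M).trans he)
            (pow_nonneg hx _)
    have h3 : |Real.exp (-x)| ≤ x ^ M := by
      rw [abs_of_pos (Real.exp_pos _)]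
      exact (Real.exp_le_one_iff.2 (neg_nonpos.2 hx)).trans (one_le_pow₀ h1)
    exact (abs_sub _ _).trans (by linarith)

namespace GaussMix

variable {N : ℕ} {D : FourierData N} {h : ℤ × Fin N → ℂ} {M : ℝ}

theorem exists_gaussSum_le (D : FourierData N) : ∃ C, 0 ≤ C ∧ ∀ t > 0, ∀ b,
    √(4 * π * t) * gaussSum D.om t b ≤ C * (1 + t) := by
  obtain ⟨C, hC, h⟩ := exists_gaussSum_sub_le D.om_pos 0
  have hom := D.om_pos
  have hπ := Real.pi_pos
  refine ⟨2 * π / D.om + C, by positivity, fun t ht b => ?_⟩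
  have h1 := (abs_le.1 (h t ht b)).2
  have h2 : 0 ≤ 2 * π / D.om * t := by positivity
  simp only [zero_add, pow_one] at h1
  nlinarith

/-- The bound for Gaussian sums over the frequency lattice. -/
def latticeBound (D : FourierData N) : ℝ := (exists_gaussSum_le D).choose

theorem latticeBound_nonneg (D : FourierData N) : 0 ≤ latticeBound D :=
  (exists_gaussSum_le D).choose_spec.1

theorem gaussSum_le (D : FourierData N) {t : ℝ} (ht : 0 < t) (b : ℝ) :
    gaussSum D.om t b ≤ latticeBound D * (1 + t) / √(4 * π * t) := by
  have hπ := Real.pi_pos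
  rw [le_div_iff₀ (Real.sqrt_pos.2 (by positivity)), mul_comm]
  exact (exists_gaussSum_le D).choose_spec.2 t ht b

theorem norm_pair_integrand_le' (G : GaussMix D) (hM : ∀ i, ‖h i‖ ≤ M) {t : ℝ} (ht : 0 ≤ t)
    (ξ : ℝ) (x : G.X) :
    ‖h (G.e x) * G.w x * (Real.exp (-(t * ((ξ + G.b x) ^ 2 + G.V x))) : ℂ)‖ ≤
      M * ‖G.w x‖ * Real.exp (-(t * (ξ + G.b x) ^ 2)) := by
  have h1 : Real.exp (-(t * ((ξ + G.b x) ^ 2 + G.V x))) ≤ Real.exp (-(t * (ξ + G.b x) ^ 2)) :=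
    Real.exp_le_exp.2 (by nlinarith [mul_nonneg ht (G.V_nonneg x)])
  have hM0 : 0 ≤ M := (norm_nonneg _).trans (hM (G.e x))
  rw [norm_mul, norm_mul, Complex.norm_real, Real.norm_eq_abs, abs_of_pos (Real.exp_pos _)]
  gcongr
  exact hM _

/-- Under the integral every finite lattice sum is at most the full Gaussian sum, which is bounded
uniformly in its centre; so the bound does not depend on u. -/
theorem sum_integral_norm_le (G : GaussMix D) (hM : ∀ i, ‖h i‖ ≤ M) {t : ℝ} (ht : 0 < t)
    (u : Finset ℤ) :
    ∑ l ∈ u, ∫ x, ‖h (G.e x) * G.w x *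
      (Real.exp (-(t * ((D.om * l + G.b x) ^ 2 + G.V x))) : ℂ)‖ ∂G.μ ≤
      M * G.mass * (latticeBound D * (1 + t) / √(4 * π * t)) := by
  rw [← integral_finsetSum _ fun l _ => (G.integrable_pair hM ht.le _).norm, mass,
    mul_right_comm, ← integral_const_mul]
  refine integral_mono (integrable_finsetSum _ fun l _ => (G.integrable_pair hM ht.le _).norm)
    (G.integrable_w.norm.const_mul _) fun x => ?_
  have hM0 : 0 ≤ M := (norm_nonneg _).trans (hM (G.e x))
  calc _ ≤ ∑ l ∈ u, M * ‖G.w x‖ * Real.exp (-(t * (D.om * l + G.b x) ^ 2)) :=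
        Finset.sum_le_sum fun l _ => G.norm_pair_integrand_le' hM ht.le _ x
    _ = M * ‖G.w x‖ * ∑ l ∈ u, Real.exp (-(t * (D.om * l + G.b x) ^ 2)) := by rw [Finset.mul_sum]
    _ ≤ M * ‖G.w x‖ * gaussSum D.om t (G.b x) := by
        gcongr
        exact (summable_gaussSum D.om_pos ht _).sum_le_tsum _ fun _ _ => (Real.exp_pos _).le
    _ ≤ M * ‖G.w x‖ * (latticeBound D * (1 + t) / √(4 * π * t)) := by
        gcongr
        exact gaussSum_le D ht _
    _ = _ := by ring

theorem summable_norm_pair (G : GaussMix D) (hM : ∀ i, ‖h i‖ ≤ M) {t : ℝ} (ht : 0 < t) :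
    Summable fun l : ℤ => ‖G.pair h t (D.om * l)‖ :=
  Summable.of_nonneg_of_le (fun _ => norm_nonneg _) (fun _ => norm_integral_le_integral_norm _)
    (summable_of_sum_le (fun _ => integral_nonneg fun _ => norm_nonneg _)
      (G.sum_integral_norm_le hM ht))

theorem tsum_norm_pair_le (G : GaussMix D) (hM : ∀ i, ‖h i‖ ≤ M) {t : ℝ} (ht : 0 < t) :
    ∑' l : ℤ, ‖G.pair h t (D.om * l)‖ ≤
      M * G.mass * (latticeBound D * (1 + t) / √(4 * π * t)) :=
  (G.summable_norm_pair hM ht).tsum_le_of_sum_le fun u =>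
    (Finset.sum_le_sum fun _ _ => norm_integral_le_integral_norm _).trans
      (G.sum_integral_norm_le hM ht u)

/-- The lattice variable enters only through the Gaussian in ξ + b, so the sum can be carried out
inside the mixture. -/
theorem hasSum_pair_lattice (G : GaussMix D) (hM : ∀ i, ‖h i‖ ≤ M) {t : ℝ} (ht : 0 < t) :
    HasSum (fun l : ℤ => G.pair h t (D.om * l))
      (∫ x, h (G.e x) * G.w x * (Real.exp (-(t * G.V x)) : ℂ) * (gaussSum D.om t (G.b x) : ℂ)
        ∂G.μ) := by
  have key := hasSum_integral_of_summable_integral_norm (μ := G.μ)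
    (F := fun (l : ℤ) x => h (G.e x) * G.w x *
      (Real.exp (-(t * ((D.om * l + G.b x) ^ 2 + G.V x))) : ℂ))
    (fun l => G.integrable_pair hM ht.le _)
    (summable_of_sum_le (fun _ => integral_nonneg fun _ => norm_nonneg _)
      (G.sum_integral_norm_le hM ht))
  convert! key using 1
  refine integral_congr_ae (ae_of_all _ fun x => ?_)
  simp only [gaussSum, Complex.ofReal_tsum]
  rw [← tsum_mul_left]
  refine tsum_congr fun l => ?_
  rw [mul_assoc _ (Complex.ofReal _), ← Complex.ofReal_mul, ← Real.exp_add]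
  congr 4
  ring

theorem measurable_damped (G : GaussMix D) (h : ℤ × Fin N → ℂ) (t : ℝ) :
    Measurable fun x => h (G.e x) * G.w x * (Real.exp (-(t * G.V x)) : ℂ) :=
  (((measurable_of_countable h).comp G.he).mul G.hw).mul (Complex.measurable_ofReal.comp
    (Real.measurable_exp.comp (G.hV.const_mul t).neg))

theorem norm_damped_le (G : GaussMix D) (hM : ∀ i, ‖h i‖ ≤ M) {t : ℝ} (ht : 0 ≤ t) (x : G.X) :
    ‖h (G.e x) * G.w x * (Real.exp (-(t * G.V x)) : ℂ)‖ ≤ M * ‖G.w x‖ := by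
  have h1 : Real.exp (-(t * G.V x)) ≤ 1 :=
    Real.exp_le_one_iff.2 (neg_nonpos.2 (mul_nonneg ht (G.V_nonneg x)))
  rw [norm_mul, norm_mul, Complex.norm_real, Real.norm_eq_abs, abs_of_pos (Real.exp_pos _)]
  have hM0 : 0 ≤ M := (norm_nonneg _).trans (hM (G.e x))
  calc ‖h (G.e x)‖ * ‖G.w x‖ * _ ≤ M * ‖G.w x‖ * 1 := by
        gcongr
        exact hM _
    _ = _ := mul_one _

/-- V is at most a multiple of R², and R has all moments. -/
theorem integrable_w_mul_V_pow (G : GaussMix D) (m : ℕ) :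
    Integrable (fun x => ‖G.w x‖ * G.V x ^ m) G.μ := by
  have h1 : Integrable (fun x => ‖G.w x‖ * (G.R x : ℝ) ^ (2 * m)) G.μ := by
    refine ⟨(G.hw.norm.mul ((measurable_from_nat (f := fun n : ℕ => (n : ℝ))).comp
      G.hR |>.pow_const _)).aestronglyMeasurable, ?_⟩
    refine lt_of_le_of_lt (lintegral_mono fun x => ?_) (G.moment (2 * m))
    rw [enorm_mul, enorm_norm, enorm_pow]
    gcongr
    rw [← ofReal_norm, Real.norm_natCast, ENNReal.ofReal_natCast]
  refine (h1.mul_const ((2 * D.growth) ^ (2 * m))).mono'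
    ((G.hw.norm.mul (G.hV.pow_const m)).aestronglyMeasurable) (ae_of_all _ fun x => ?_)
  rw [norm_mul, norm_norm, norm_pow, Real.norm_eq_abs, abs_of_nonneg (G.V_nonneg x)]
  calc ‖G.w x‖ * G.V x ^ m ≤ ‖G.w x‖ * ((2 * (D.growth * G.R x)) ^ 2) ^ m := by
        gcongr
        exacts [G.V_nonneg x, G.V_le x]
    _ = _ := by rw [← pow_mul, ← mul_assoc 2, mul_pow _ (G.R x : ℝ)]; ring

/-- Taylor expansion of e^{-tV} under the integral; the coefficients and the remainder are
controlled by the moments of V. -/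
theorem polyApprox_damped (G : GaussMix D) (hM : ∀ i, ‖h i‖ ≤ M) :
    PolyApprox fun t => ∫ x, h (G.e x) * G.w x * (Real.exp (-(t * G.V x)) : ℂ) ∂G.μ := by
  intro K
  have hint : ∀ m, Integrable (fun x => h (G.e x) * G.w x * (G.V x : ℂ) ^ m) G.μ := by
    intro m
    refine ((G.integrable_w_mul_V_pow m).const_mul M).mono'
      (((measurable_of_countable h).comp G.he).mul G.hw |>.mul
        ((Complex.measurable_ofReal.comp G.hV).pow_const m)).aestronglyMeasurable
      (ae_of_all _ fun x => ?_)
    rw [norm_mul, norm_mul, norm_pow, Complex.norm_real, Real.norm_eq_abs,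
      abs_of_nonneg (G.V_nonneg x), mul_assoc]
    exact mul_le_mul_of_nonneg_right (hM _)
      (mul_nonneg (norm_nonneg _) (pow_nonneg (G.V_nonneg x) _))
  refine ⟨∑ m ∈ Finset.range K, Polynomial.C ((-1) ^ m / m.factorial *
    ∫ x, h (G.e x) * G.w x * (G.V x : ℂ) ^ m ∂G.μ) * Polynomial.X ^ m,
    ∫ x, 4 * (M * (‖G.w x‖ * G.V x ^ K)) ∂G.μ, fun t ht => ?_⟩
  have hd : Integrable (fun x => h (G.e x) * G.w x * (Real.exp (-(t * G.V x)) : ℂ)) G.μ :=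
    (G.integrable_w.norm.const_mul M).mono' (G.measurable_damped h t).aestronglyMeasurable
      (ae_of_all _ (G.norm_damped_le hM ht.1.le))
  have h1 : (∑ m ∈ Finset.range K, Polynomial.C ((-1) ^ m / m.factorial *
      ∫ x, h (G.e x) * G.w x * (G.V x : ℂ) ^ m ∂G.μ) * Polynomial.X ^ m).eval (t : ℂ) =
      ∫ x, ∑ m ∈ Finset.range K,
        ((-t) ^ m / m.factorial : ℂ) * (h (G.e x) * G.w x * (G.V x : ℂ) ^ m) ∂G.μ := by
    rw [Polynomial.eval_finsetSum, integral_finsetSum _ fun m _ => (hint m).const_mul _]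
    refine Finset.sum_congr rfl fun m _ => ?_
    rw [integral_const_mul]
    simp only [Polynomial.eval_mul, Polynomial.eval_C, Polynomial.eval_pow, Polynomial.eval_X]
    rw [neg_pow (t : ℂ)]
    ring
  rw [h1, ← integral_sub hd (integrable_finsetSum _ fun m _ => (hint m).const_mul _),
    ← integral_mul_const]
  refine norm_integral_le_of_norm_le
    ((((G.integrable_w_mul_V_pow K).const_mul M).const_mul 4).mul_const _)
    (ae_of_all _ fun x => ?_)
  have hV := G.V_nonneg x
  have h2 : h (G.e x) * G.w x * (Real.exp (-(t * G.V x)) : ℂ) - ∑ m ∈ Finset.range K,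
        ((-t) ^ m / m.factorial : ℂ) * (h (G.e x) * G.w x * (G.V x : ℂ) ^ m) =
      h (G.e x) * G.w x * ((Real.exp (-(t * G.V x)) -
        ∑ m ∈ Finset.range K, (-(t * G.V x)) ^ m / m.factorial : ℝ) : ℂ) := by
    push_cast
    rw [mul_sub, Finset.mul_sum]
    congr 1
    refine Finset.sum_congr rfl fun m _ => ?_
    rw [← neg_mul, mul_pow]
    ring
  rw [h2, norm_mul, norm_mul, Complex.norm_real, Real.norm_eq_abs]
  have hM0 : 0 ≤ M := (norm_nonneg _).trans (hM (G.e x))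
  calc _ ≤ M * ‖G.w x‖ * (4 * (t * G.V x) ^ K) := by
        gcongr
        · exact hM _
        · exact abs_exp_neg_sub_sum_le (mul_nonneg ht.1.le hV) K
    _ = _ := by ring

/-- The sum of a mixture over the frequency lattice, normalised as in `Ω`. -/
def latticeSum (G : GaussMix D) (h : ℤ × Fin N → ℂ) (t : ℝ) : ℂ :=
  √(4 * π * t) * ∑' l : ℤ, G.pair h t (D.om * l)

/-- Poisson summation replaces the Gaussian sum by the constant 2π/om at a cost O(t^K), uniformly
over the mixture; the damped integral that remains has an expansion. -/
theorem polyApprox_latticeSum (G : GaussMix D) (hM : ∀ i, ‖h i‖ ≤ M) :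
    PolyApprox (G.latticeSum h) := by
  refine PolyApprox.of_approx fun K => ?_
  obtain ⟨C, hC, hCb⟩ := exists_gaussSum_sub_le D.om_pos K
  refine ⟨_, (PolyApprox.polynomial (Polynomial.C (2 * π / D.om : ℂ))).mul
    (G.polyApprox_damped hM), M * G.mass * C, fun t ht => ?_⟩
  have hd : Integrable (fun x => h (G.e x) * G.w x * (Real.exp (-(t * G.V x)) : ℂ)) G.μ :=
    (G.integrable_w.norm.const_mul M).mono' (G.measurable_damped h t).aestronglyMeasurable
      (ae_of_all _ (G.norm_damped_le hM ht.1.le))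
  have hg : Integrable (fun x => h (G.e x) * G.w x * (Real.exp (-(t * G.V x)) : ℂ) *
      (gaussSum D.om t (G.b x) : ℂ)) G.μ := by
    refine hd.mul_bdd (c := latticeBound D * (1 + t) / √(4 * π * t))
      (Complex.measurable_ofReal.comp ((measurable_gaussSum D.om t).comp
        G.hb)).aestronglyMeasurable (ae_of_all _ fun x => ?_)
    rw [Complex.norm_real, Real.norm_eq_abs, abs_of_nonneg (gaussSum_nonneg _ _ _)]
    exact gaussSum_le D ht.1 _
  rw [latticeSum, (G.hasSum_pair_lattice hM ht.1).tsum_eq, Polynomial.eval_C,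
    ← integral_const_mul, ← integral_const_mul, ← integral_sub (hg.const_mul _) (hd.const_mul _),
    mass, show (M * ∫ x, ‖G.w x‖ ∂G.μ) * C * t ^ K = M * C * t ^ K * ∫ x, ‖G.w x‖ ∂G.μ by ring,
    ← integral_const_mul]
  refine norm_integral_le_of_norm_le (G.integrable_w.norm.const_mul _) (ae_of_all _ fun x => ?_)
  rw [show (√(4 * π * t) : ℂ) * (h (G.e x) * G.w x * (Real.exp (-(t * G.V x)) : ℂ) *
      (gaussSum D.om t (G.b x) : ℂ)) - 2 * π / D.om *
        (h (G.e x) * G.w x * (Real.exp (-(t * G.V x)) : ℂ)) =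
      h (G.e x) * G.w x * (Real.exp (-(t * G.V x)) : ℂ) *
        ((√(4 * π * t) * gaussSum D.om t (G.b x) - 2 * π / D.om : ℝ) : ℂ) by push_cast; ring,
    norm_mul, Complex.norm_real, Real.norm_eq_abs]
  have hM0 : 0 ≤ M := (norm_nonneg _).trans (hM (G.e x))
  calc _ ≤ M * ‖G.w x‖ * (C * t ^ (K + 1)) :=
        mul_le_mul (G.norm_damped_le hM ht.1.le x) (hCb t ht.1 _) (abs_nonneg _) (by positivity)
    _ ≤ M * ‖G.w x‖ * (C * t ^ K) := by
        refine mul_le_mul_of_nonneg_left (mul_le_mul_of_nonneg_left ?_ hC) (by positivity)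
        exact pow_le_pow_of_le_one ht.1.le ht.2 (Nat.le_succ K)
    _ = _ := by ring

theorem norm_latticeSum_le (G : GaussMix D) (hM : ∀ i, ‖h i‖ ≤ M) {t : ℝ} (ht : 0 < t) :
    ‖G.latticeSum h t‖ ≤ M * G.mass * (latticeBound D * (1 + t)) := by
  have hπ := Real.pi_pos
  have h0 : 0 < √(4 * π * t) := Real.sqrt_pos.2 (by positivity)
  rw [latticeSum, norm_mul, Complex.norm_real, Real.norm_eq_abs, abs_of_pos h0, mul_comm,
    ← le_div_iff₀ h0, mul_div_assoc]
  exact (norm_tsum_le_tsum_norm (G.summable_norm_pair hM ht)).trans (G.tsum_norm_pair_le hM ht)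

/-- The Dyson expansion summed over the frequency lattice. -/
def dysonSum (D : FourierData N) (i : ℤ × Fin N) (t : ℝ) : ℂ :=
  ∑' k : ℕ, (t : ℂ) ^ k * ∑' l : ℤ, (dyson D i k).ker t (D.om * l) i

/-- The double series over Dyson order and lattice is absolutely convergent, an exponential series
times the Gaussian sum bound, so the two summations may be exchanged. -/
theorem hasSum_dysonSum {i : ℤ × Fin N} {t : ℝ} (ht : 0 < t) {y : ℤ → ℂ}
    (hy : ∀ l : ℤ, HasSum (fun k => (t : ℂ) ^ k * (dyson D i k).ker t (D.om * l) i) (y l)) :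
    HasSum y (dysonSum D i t) := by
  have hB : 0 ≤ latticeBound D * (1 + t) / √(4 * π * t) := by
    have := latticeBound_nonneg D
    positivity
  set B := latticeBound D * (1 + t) / √(4 * π * t)
  have hs : Summable fun p : ℕ × ℤ => (t : ℂ) ^ p.1 * (dyson D i p.1).ker t (D.om * p.2) i := by
    refine Summable.of_norm ((summable_prod_of_nonneg fun _ => norm_nonneg _).2 ⟨fun k => ?_, ?_⟩)
    · simp only [norm_mul]
      exact ((dyson D i k).summable_norm_pair (norm_ite_le i) ht).mul_left _
    · refine Summable.of_nonneg_of_le (fun _ => tsum_nonneg fun _ => norm_nonneg _) (fun k => ?_)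
        ((Real.summable_pow_div_factorial ((D.colBound 0 : ℝ) * t)).mul_right B)
      simp only [norm_mul, norm_pow, Complex.norm_real, Real.norm_eq_abs, abs_of_pos ht]
      rw [tsum_mul_left]
      calc _ ≤ t ^ k * (1 * ((D.colBound 0 : ℝ) ^ k / k.factorial) * B) := by
            gcongr
            refine ((dyson D i k).tsum_norm_pair_le (norm_ite_le i) ht).trans ?_
            gcongr
            exact mass_dyson_le i k
        _ = _ := by rw [mul_pow]; ring
  have h1 := hs.hasSum.prod_fiberwise fun k => (((dyson D i k).summable_norm_pair
    (norm_ite_le i) ht).of_norm.hasSum.mul_left ((t : ℂ) ^ k))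
  have h2 := ((Equiv.prodComm ℤ ℕ).hasSum_iff.2 hs.hasSum).prod_fiberwise hy
  rw [← h1.tsum_eq] at h2
  exact h2

/-- The term of order k carries t^k, so for t ≤ 1 the tail from K on is O(t^K), and the finitely
many terms before it have expansions. -/
theorem polyApprox_dysonSum (D : FourierData N) (i : ℤ × Fin N) :
    PolyApprox fun t => √(4 * π * t) * dysonSum D i t := by
  refine PolyApprox.of_approx fun K => ?_
  have hL := latticeBound_nonneg D
  have hexp := Real.summable_pow_div_factorial (D.colBound 0 : ℝ)
  refine ⟨fun t => ∑ k ∈ Finset.range K, (Polynomial.X ^ k : Polynomial ℂ).eval (t : ℂ) *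
      (dyson D i k).latticeSum (fun j => if j = i then 1 else 0) t,
    PolyApprox.sum _ fun k _ => (PolyApprox.polynomial _).mul
      ((dyson D i k).polyApprox_latticeSum (norm_ite_le i)),
    (∑' k, (D.colBound 0 : ℝ) ^ k / k.factorial) * (latticeBound D * 2), fun t ht => ?_⟩
  set F : ℕ → ℂ := fun k => (t : ℂ) ^ k * (dyson D i k).latticeSum (fun j => if j = i then 1 else 0) t
  have hF : ∀ k, ‖F k‖ ≤ (D.colBound 0 : ℝ) ^ k / k.factorial * (latticeBound D * 2) * t ^ k := by
    intro k
    rw [norm_mul, norm_pow, Complex.norm_real, Real.norm_eq_abs, abs_of_pos ht.1]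
    calc _ ≤ t ^ k * (1 * ((D.colBound 0 : ℝ) ^ k / k.factorial) *
          (latticeBound D * (1 + 1))) := by
          refine mul_le_mul_of_nonneg_left (((dyson D i k).norm_latticeSum_le (norm_ite_le i)
            ht.1).trans ?_) (pow_nonneg ht.1.le _)
          have := ht.2
          have := ht.1
          gcongr
          exact mass_dyson_le i k
      _ = _ := by ring
  have hFK : ∀ k, ‖F (k + K)‖ ≤
      (D.colBound 0 : ℝ) ^ (k + K) / (k + K).factorial * (latticeBound D * 2 * t ^ K) := by
    intro k
    refine (hF _).trans ?_
    rw [mul_assoc]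
    gcongr ?_ * (?_ * ?_)
    exact pow_le_pow_of_le_one ht.1.le ht.2 (Nat.le_add_left K k)
  have hs : Summable F := by
    refine (summable_nat_add_iff K).1 (Summable.of_norm_bounded ?_ hFK)
    exact ((summable_nat_add_iff K).2 hexp).mul_right _
  have h1 : (√(4 * π * t) : ℂ) * dysonSum D i t = ∑' k, F k := by
    rw [dysonSum, ← tsum_mul_left]
    refine tsum_congr fun k => ?_
    simp only [F, latticeSum, ker]
    ring
  simp only [Polynomial.eval_pow, Polynomial.eval_X]
  rw [h1, ← hs.sum_add_tsum_nat_add K, add_sub_cancel_left]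
  refine (tsum_of_norm_bounded (((summable_nat_add_iff K).2 hexp).mul_right _).hasSum hFK).trans ?_
  have h2 : 0 ≤ latticeBound D * 2 * t ^ K := by
    have := ht.1
    positivity
  rw [tsum_mul_right, mul_assoc _ (latticeBound D * 2)]
  refine mul_le_mul_of_nonneg_right ?_ h2
  rw [← hexp.sum_add_tsum_nat_add K]
  exact le_add_of_nonneg_left (Finset.sum_nonneg fun _ _ => by positivity)

end GaussMix

end

/-! ### The heat kernel of an orthonormal eigenbasis -/

section

open scoped ENNReal NNReal

/-- An orthonormal basis of eigenvectors of the operator in Fourier space. -/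
structure IsEigenbasis {N : ℕ} (D : FourierData N) {ι : Type*} (p : ι → ℝ)
    (φ : ι → ℤ × Fin N → ℂ) : Prop where
  norm_sq : ∀ n, HasSum (fun i => ‖φ n i‖ ^ 2) 1
  complete : ∀ i j, HasSum (fun n => φ n i * starRingEnd ℂ (φ n j)) (if i = j then 1 else 0)
  eigen : ∀ n i, ((D.freq i ^ 2 : ℝ) : ℂ) * φ n i + ∑' j, D.mat i j * φ n j = p n * φ n i

namespace IsEigenbasis

variable {N : ℕ} {D : FourierData N} {ι : Type*} {p : ι → ℝ} {φ : ι → ℤ × Fin N → ℂ}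

theorem hasSum_norm_sq (H : IsEigenbasis D p φ) (i : ℤ × Fin N) :
    HasSum (fun n => ‖φ n i‖ ^ 2) 1 := by
  have h := H.complete i i
  rw [if_pos rfl] at h
  simp only [Complex.mul_conj, Complex.normSq_eq_norm_sq] at h
  exact Complex.hasSum_ofReal.1 (by simpa using h)

theorem norm_le_one (H : IsEigenbasis D p φ) (n : ι) (i : ℤ × Fin N) : ‖φ n i‖ ≤ 1 := by
  have h := le_hasSum (H.norm_sq n) i fun _ _ => sq_nonneg _
  nlinarith [norm_nonneg (φ n i)]

/-- Every basis vector has a nonzero coordinate, and by completeness each coordinate is nonzero for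
only countably many vectors. -/
theorem countable (H : IsEigenbasis D p φ) : Countable ι := by
  rw [← Set.countable_univ_iff]
  refine (Set.countable_iUnion fun i => (H.hasSum_norm_sq i).summable.countable_support).mono ?_
  intro n _
  rw [mem_iUnion]
  by_contra! h
  have h0 : ∀ i, ‖φ n i‖ ^ 2 = 0 := fun i => Function.notMem_support.1 (h i)
  have h1 := H.norm_sq n
  simp only [h0] at h1
  exact one_ne_zero (h1.unique hasSum_zero)

/-- Maximum principle in the sup norm: if p n < -colBound, the eigenvalue equation bounds every |φ n
i| by a factor less than 1 times their supremum. -/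
theorem neg_colBound_le (H : IsEigenbasis D p φ) (n : ι) : -(D.colBound 0 : ℝ) ≤ p n := by
  by_contra! hlt
  have hbdd : BddAbove (range fun i => ‖φ n i‖) := ⟨1, by rintro _ ⟨i, rfl⟩; exact H.norm_le_one n i⟩
  have hle : ∀ i, ‖φ n i‖ ≤ ⨆ i, ‖φ n i‖ := le_ciSup hbdd
  set m := ⨆ i, ‖φ n i‖
  have hne : ∃ i, φ n i ≠ 0 := by
    by_contra! h
    have h1 := H.norm_sq n
    simp only [h, norm_zero, ne_eq, OfNat.ofNat_ne_zero, not_false_eq_true, zero_pow] at h1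
    exact one_ne_zero (h1.unique hasSum_zero)
  obtain ⟨i₀, hi₀⟩ := hne
  have hm : 0 < m := (norm_pos_iff.2 hi₀).trans_le (hle i₀)
  have hp : 0 < -p n := lt_of_le_of_lt (NNReal.coe_nonneg (D.colBound 0)) (by linarith)
  have key : ∀ i, ‖φ n i‖ ≤ D.colBound 0 * m / -p n := by
    intro i
    rw [le_div_iff₀ hp]
    have h1 := GaussMix.norm_tsum_mat_mul_le D hle i
    have h2 : ∑' j, D.mat i j * φ n j = ((p n - D.freq i ^ 2 : ℝ) : ℂ) * φ n i := by
      have := H.eigen n i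
      push_cast at this ⊢
      linear_combination this
    rw [h2, norm_mul, Complex.norm_real, Real.norm_eq_abs, mul_comm] at h1
    refine le_trans (mul_le_mul_of_nonneg_left ?_ (norm_nonneg _)) h1
    have := neg_abs_le (p n - D.freq i ^ 2)
    nlinarith [sq_nonneg (D.freq i)]
  have : Nonempty (ℤ × Fin N) := ⟨i₀⟩
  have h3 : m ≤ D.colBound 0 * m / -p n := ciSup_le key
  rw [le_div_iff₀ hp] at h3
  nlinarith

theorem exp_le (H : IsEigenbasis D p φ) {s T : ℝ} (hs : s ∈ Icc 0 T) (n : ι) :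
    Real.exp (-(s * p n)) ≤ Real.exp (T * D.colBound 0) := by
  rw [Real.exp_le_exp]
  have h1 := H.neg_colBound_le n
  have h2 : (0 : ℝ) ≤ D.colBound 0 := NNReal.coe_nonneg _
  nlinarith [hs.1, hs.2]

theorem summable_norm_mul (H : IsEigenbasis D p φ) (i j : ℤ × Fin N) :
    Summable (fun n => ‖φ n i‖ * ‖φ n j‖) ∧ ∑' n, ‖φ n i‖ * ‖φ n j‖ ≤ 1 := by
  have h := ((H.hasSum_norm_sq i).add (H.hasSum_norm_sq j)).mul_left (1 / 2)
  have hle : ∀ n, ‖φ n i‖ * ‖φ n j‖ ≤ 1 / 2 * (‖φ n i‖ ^ 2 + ‖φ n j‖ ^ 2) := fun n => by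
    nlinarith [sq_nonneg (‖φ n i‖ - ‖φ n j‖)]
  have hs := Summable.of_nonneg_of_le (fun n => by positivity) hle h.summable
  refine ⟨hs, (hs.tsum_le_tsum hle h.summable).trans ?_⟩
  rw [h.tsum_eq]; norm_num

/-- The heat kernel. -/
def heatKer (p : ι → ℝ) (φ : ι → ℤ × Fin N → ℂ) (t : ℝ) (i j : ℤ × Fin N) : ℂ :=
  ∑' n, (Real.exp (-(t * p n)) : ℂ) * (φ n i * starRingEnd ℂ (φ n j))

theorem norm_heatKer_term_le (H : IsEigenbasis D p φ) {s T : ℝ} (hs : s ∈ Icc 0 T)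
    (i j : ℤ × Fin N) (n : ι) :
    ‖(Real.exp (-(s * p n)) : ℂ) * (φ n i * starRingEnd ℂ (φ n j))‖ ≤
      Real.exp (T * D.colBound 0) * (‖φ n i‖ * ‖φ n j‖) := by
  rw [norm_mul, norm_mul, RCLike.norm_conj, Complex.norm_real, Real.norm_eq_abs,
    abs_of_pos (Real.exp_pos _)]
  exact mul_le_mul_of_nonneg_right (H.exp_le hs n) (by positivity)

theorem norm_heatKer_le (H : IsEigenbasis D p φ) {s T : ℝ} (hs : s ∈ Icc 0 T)
    (i j : ℤ × Fin N) : ‖heatKer p φ s i j‖ ≤ Real.exp (T * D.colBound 0) := by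
  obtain ⟨h1, h2⟩ := H.summable_norm_mul i j
  refine (tsum_of_norm_bounded (h1.mul_left _).hasSum (H.norm_heatKer_term_le hs i j)).trans ?_
  rw [tsum_mul_left]
  exact mul_le_of_le_one_right (Real.exp_pos _).le h2

theorem continuousOn_heatKer (H : IsEigenbasis D p φ) (T : ℝ) (i j : ℤ × Fin N) :
    ContinuousOn (fun s => heatKer p φ s i j) (Icc 0 T) :=
  continuousOn_tsum (fun n => by fun_prop) ((H.summable_norm_mul i j).1.mul_left _)
    fun n _ hs => H.norm_heatKer_term_le hs i j n

/-- Duhamel's formula for two scalars: the integrand is an exact derivative in s. -/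
theorem integral_exp_mul_exp (x y t : ℝ) : ∫ s in (0 : ℝ)..t,
    (y - x) * (Real.exp (-((t - s) * x)) * Real.exp (-(s * y))) =
      Real.exp (-(t * x)) - Real.exp (-(t * y)) := by
  have hd : ∀ s ∈ uIcc 0 t, HasDerivAt (fun s => -(Real.exp (-((t - s) * x)) * Real.exp (-(s * y))))
      ((y - x) * (Real.exp (-((t - s) * x)) * Real.exp (-(s * y)))) s := by
    intro s _
    have h1 : HasDerivAt (fun s => -((t - s) * x)) x s := by
      convert! (((hasDerivAt_id s).const_sub t).mul_const x).neg using 1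
      simp
    have h2 : HasDerivAt (fun s => -(s * y)) (-y) s := by
      convert! ((hasDerivAt_id s).mul_const y).neg using 1
      simp
    convert! (h1.exp.mul h2.exp).neg using 1
    ring
  rw [intervalIntegral.integral_eq_sub_of_hasDerivAt hd
    (Continuous.intervalIntegrable (by fun_prop) _ _)]
  simp
  ring

/-- Duhamel's formula for the heat kernel. -/
theorem heatKer_eq (H : IsEigenbasis D p φ) {t : ℝ} (ht : 0 ≤ t) (i j : ℤ × Fin N) :
    heatKer p φ t i j = (if i = j then (Real.exp (-(t * D.freq i ^ 2)) : ℂ) else 0) -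
      ∫ s in (0 : ℝ)..t, (Real.exp (-((t - s) * D.freq i ^ 2)) : ℂ) *
        ∑' k, D.mat i k * heatKer p φ s k j := by
  have := H.countable
  set E := Real.exp (t * D.colBound 0)
  have hQ : ∀ n, ∑' k, D.mat i k * φ n k = ((p n - D.freq i ^ 2 : ℝ) : ℂ) * φ n i := by
    intro n
    have := H.eigen n i
    push_cast at this ⊢
    linear_combination this
  have hdouble : Summable fun x : (ℤ × Fin N) × ι => ‖D.mat i x.1‖ * (‖φ x.2 x.1‖ * ‖φ x.2 j‖) := by
    refine (summable_prod_of_nonneg fun _ => by positivity).2 ⟨fun k => ?_, ?_⟩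
    · exact (H.summable_norm_mul k j).1.mul_left ‖D.mat i k‖
    · refine Summable.of_nonneg_of_le (fun _ => tsum_nonneg fun _ => by positivity) (fun k => ?_)
        (D.summable_norm_row i)
      dsimp only
      rw [tsum_mul_left]
      exact mul_le_of_le_one_right (norm_nonneg _) (H.summable_norm_mul k j).2
  have hdouble' : Summable fun x : ι × (ℤ × Fin N) =>
      ‖D.mat i x.2‖ * (‖φ x.1 x.2‖ * ‖φ x.1 j‖) := (Equiv.prodComm _ _).summable_iff.2 hdouble
  set B : ι → ℝ := fun n => ∑' k, ‖D.mat i k‖ * (‖φ n k‖ * ‖φ n j‖)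
  have hB : Summable B := hdouble'.prod
  have hrow : ∀ n, Summable fun k => ‖D.mat i k‖ * (‖φ n k‖ * ‖φ n j‖) := fun n =>
    hdouble'.prod_factor n
  have hrowC : ∀ n (c : ℂ), Summable fun k => c * (D.mat i k * (φ n k * starRingEnd ℂ (φ n j))) :=
    fun n c => (Summable.of_norm ((hrow n).congr fun k => by simp)).mul_left c
  have hinner : ∀ n, ∑' k, D.mat i k * (φ n k * starRingEnd ℂ (φ n j)) =
      ((p n - D.freq i ^ 2 : ℝ) : ℂ) * (φ n i * starRingEnd ℂ (φ n j)) := by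
    intro n
    simp only [← mul_assoc]
    rw [tsum_mul_right, hQ]
  -- The potential acts on the kernel through an absolutely convergent double sum over modes and
  -- eigenvectors; summing over modes first, the eigenvalue equation replaces it by the factor p n -
  -- freq².
  have hswap : ∀ s ∈ Icc 0 t, HasSum (fun n => (Real.exp (-(s * p n)) : ℂ) *
      (((p n - D.freq i ^ 2 : ℝ) : ℂ) * (φ n i * starRingEnd ℂ (φ n j))))
      (∑' k, D.mat i k * heatKer p φ s k j) := by
    intro s hs
    have hF : Summable fun x : ι × (ℤ × Fin N) => (Real.exp (-(s * p x.1)) : ℂ) *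
        (D.mat i x.2 * (φ x.1 x.2 * starRingEnd ℂ (φ x.1 j))) := by
      refine Summable.of_norm_bounded (hdouble'.mul_left E) fun x => ?_
      rw [norm_mul, norm_mul, norm_mul, RCLike.norm_conj, Complex.norm_real, Real.norm_eq_abs,
        abs_of_pos (Real.exp_pos _)]
      exact mul_le_mul_of_nonneg_right (H.exp_le hs _) (by positivity)
    have h1 := hF.hasSum.prod_fiberwise fun n => (hrowC n (Real.exp (-(s * p n)))).hasSum
    have h2 : ∑' x : ι × (ℤ × Fin N), (Real.exp (-(s * p x.1)) : ℂ) *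
        (D.mat i x.2 * (φ x.1 x.2 * starRingEnd ℂ (φ x.1 j))) =
        ∑' k, D.mat i k * heatKer p φ s k j := by
      refine ((Equiv.prodComm (ℤ × Fin N) ι).tsum_eq _).symm.trans
        ((Summable.tsum_prod ((Equiv.prodComm (ℤ × Fin N) ι).summable_iff.2 hF)).trans ?_)
      refine tsum_congr fun k => ?_
      rw [heatKer, ← tsum_mul_left]
      exact tsum_congr fun n => mul_left_comm _ _ _
    rw [h2] at h1
    refine h1.congr_fun fun n => ?_
    rw [tsum_mul_left, hinner]
  have hint := intervalIntegral.hasSum_integral_of_dominated_convergence (μ := volume)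
    (a := 0) (b := t)
    (F := fun n s => (Real.exp (-((t - s) * D.freq i ^ 2)) : ℂ) * ((Real.exp (-(s * p n)) : ℂ) *
      (((p n - D.freq i ^ 2 : ℝ) : ℂ) * (φ n i * starRingEnd ℂ (φ n j)))))
    (f := fun s => (Real.exp (-((t - s) * D.freq i ^ 2)) : ℂ) *
      ∑' k, D.mat i k * heatKer p φ s k j)
    (fun n _ => E * B n) (fun n => (Continuous.aestronglyMeasurable (by fun_prop)))
    (fun n => ae_of_all _ fun s hs => ?_) (ae_of_all _ fun s _ => hB.mul_left E)
    intervalIntegrable_const (ae_of_all _ fun s hs => ?_)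
  -- Each eigenvector contributes a scalar Duhamel identity; completeness sums the free parts to the
  -- Kronecker delta.
  · have hterm : ∀ n, ∫ s in (0 : ℝ)..t, (Real.exp (-((t - s) * D.freq i ^ 2)) : ℂ) *
        ((Real.exp (-(s * p n)) : ℂ) * (((p n - D.freq i ^ 2 : ℝ) : ℂ) *
          (φ n i * starRingEnd ℂ (φ n j)))) =
        (Real.exp (-(t * D.freq i ^ 2)) : ℂ) * (φ n i * starRingEnd ℂ (φ n j)) -
          (Real.exp (-(t * p n)) : ℂ) * (φ n i * starRingEnd ℂ (φ n j)) := by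
      intro n
      rw [← sub_mul, ← Complex.ofReal_sub, ← integral_exp_mul_exp, ← intervalIntegral.integral_ofReal,
        ← intervalIntegral.integral_mul_const]
      refine intervalIntegral.integral_congr fun s _ => ?_
      push_cast
      ring
    have h3 := ((H.complete i j).mul_left (Real.exp (-(t * D.freq i ^ 2)) : ℂ)).sub
      (hint.congr_fun fun n => (hterm n).symm)
    have h4 := h3.congr_fun fun n => (sub_sub_cancel _ _).symm
    rw [heatKer, h4.tsum_eq, mul_ite, mul_one, mul_zero]
  · rw [uIoc_of_le ht] at hs
    have hs' := Ioc_subset_Icc_self hs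
    rw [norm_mul, norm_mul, Complex.norm_real, Complex.norm_real, Real.norm_eq_abs,
      Real.norm_eq_abs, abs_of_pos (Real.exp_pos _), abs_of_pos (Real.exp_pos _), ← hinner]
    have h5 : Real.exp (-((t - s) * D.freq i ^ 2)) ≤ 1 :=
      Real.exp_le_one_iff.2 (neg_nonpos.2 (mul_nonneg (sub_nonneg.2 hs.2) (sq_nonneg _)))
    have h6 : ‖∑' k, D.mat i k * (φ n k * starRingEnd ℂ (φ n j))‖ ≤ B n :=
      tsum_of_norm_bounded (hrow n).hasSum fun k => by simp
    calc _ ≤ 1 * (E * B n) := by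
          gcongr
          exact H.exp_le hs' n
      _ = _ := one_mul _
  · rw [uIoc_of_le ht] at hs
    exact (hswap s (Ioc_subset_Icc_self hs)).mul_left _

/-- Translating modes by l fixes the matrix and adds om·l to every frequency. So the kernel column
at (l, j) solves the Volterra equation started at (0, j) with ξ = om·l, and one family of mixtures
serves all l. -/
theorem hasSum_dyson (H : IsEigenbasis D p φ) {t : ℝ} (ht : 0 ≤ t) (l : ℤ) (j : Fin N) :
    HasSum (fun k => (t : ℂ) ^ k * (GaussMix.dyson D (0, j) k).ker t (D.om * l) (0, j))
      (heatKer p φ t (l, j) (l, j)) := by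
  have h0 : ∀ i, FourierData.shift l i = (l, j) ↔ i = (0, j) := by
    rintro ⟨m, k⟩
    simp [FourierData.shift]
  have hsh : Function.Bijective (FourierData.shift (N := N) l) :=
    ⟨fun i i' h => by
      simp only [FourierData.shift, Prod.mk.injEq, add_left_inj] at h
      exact Prod.ext h.1 h.2, fun i => ⟨(i.1 - l, i.2), by simp [FourierData.shift]⟩⟩
  have h := GaussMix.hasSum_dyson (D := D) (ξ := D.om * l) (i₀ := (0, j)) (T := t)
    (y := fun i s => heatKer p φ s (FourierData.shift l i) (l, j))
    (Y := Real.exp (t * D.colBound 0)) (fun i => H.continuousOn_heatKer t _ _)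
    (fun i s hs => H.norm_heatKer_le hs _ _) (fun i s hs => ?_) (0, j) (t := t) ⟨ht, le_rfl⟩
  · simpa [FourierData.shift] using h
  · rw [H.heatKer_eq hs.1, D.freq_shift, add_comm (D.freq i)]
    simp only [h0]
    congr 1
    refine intervalIntegral.integral_congr fun r _ => ?_
    congr 1
    rw [← (Equiv.ofBijective _ hsh).tsum_eq]
    refine tsum_congr fun k => ?_
    simp only [Equiv.ofBijective_apply, D.mat_shift]

/-- The heat trace converges, and after normalisation it has a Taylor expansion at `t = 0`. -/
theorem heatTrace_expansion (H : IsEigenbasis D p φ) :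
    (∀ t : ℝ, 0 < t → Summable fun n => Real.exp (-t * p n)) ∧
      PolyApprox fun t => ((√(4 * π * t) * ∑' n, Real.exp (-t * p n) : ℝ) : ℂ) := by
  have key : ∀ t : ℝ, 0 < t → HasSum (fun n => Real.exp (-t * p n))
      (∑ j : Fin N, GaussMix.dysonSum D (0, j) t).re := by
    intro t ht
    set A : ℤ × Fin N → ℝ := fun i => ∑' n, Real.exp (-(t * p n)) * ‖φ n i‖ ^ 2
    have hA : ∀ i, heatKer p φ t i i = (A i : ℂ) := by
      intro i
      simp only [heatKer, A, Complex.ofReal_tsum]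
      refine tsum_congr fun n => ?_
      rw [Complex.mul_conj, Complex.normSq_eq_norm_sq]
      push_cast; rfl
    have hAj : ∀ j, HasSum (fun l : ℤ => A (l, j)) (GaussMix.dysonSum D (0, j) t).re := by
      intro j
      have := GaussMix.hasSum_dysonSum ht fun l => H.hasSum_dyson ht.le l j
      simp only [hA] at this
      simpa using Complex.hasSum_re this
    have hA0 : ∀ i, 0 ≤ A i := fun i => tsum_nonneg fun n => by positivity
    have hA1 : Summable fun x : Fin N × ℤ => A (x.2, x.1) :=
      (summable_prod_of_nonneg fun _ => hA0 _).2 ⟨fun j => (hAj j).summable, Summable.of_finite⟩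
    have hA2 : HasSum A (∑ j : Fin N, GaussMix.dysonSum D (0, j) t).re := by
      have h1 := hA1.hasSum.prod_fiberwise hAj
      have h2 := h1.unique (hasSum_fintype _)
      rw [Complex.re_sum, ← h2]
      exact (Equiv.prodComm (Fin N) ℤ).hasSum_iff.1 hA1.hasSum
    have hterm : ∀ i, Summable fun n => Real.exp (-(t * p n)) * ‖φ n i‖ ^ 2 := fun i =>
      Summable.of_nonneg_of_le (fun n => by positivity)
        (fun n => mul_le_mul_of_nonneg_right (H.exp_le ⟨ht.le, le_rfl⟩ n) (sq_nonneg _))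
        ((H.hasSum_norm_sq i).summable.mul_left _)
    -- The trace is computed in two orders. Modes first uses the normalisation of the eigenvectors
    -- and gives the heat trace; eigenvectors first gives the diagonal of the kernel, that is, the
    -- Dyson sums.
    have hd : Summable fun x : (ℤ × Fin N) × ι => Real.exp (-(t * p x.2)) * ‖φ x.2 x.1‖ ^ 2 :=
      (summable_prod_of_nonneg fun _ => by positivity).2 ⟨hterm, hA2.summable⟩
    have h3 := (hd.hasSum.prod_fiberwise fun i => (hterm i).hasSum).unique hA2
    have h4 := ((Equiv.prodComm ι (ℤ × Fin N)).hasSum_iff.2 hd.hasSum).prod_fiberwise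
      fun n => (H.norm_sq n).mul_left (Real.exp (-(t * p n)))
    rw [h3] at h4
    simpa using h4
  refine ⟨fun t ht => (key t ht).summable, ?_⟩
  have h5 : ∀ t ∈ Ioc (0 : ℝ) 1, (√(4 * π * t) : ℂ) * ∑ j : Fin N, GaussMix.dysonSum D (0, j) t =
      ((√(4 * π * t) * ∑' n, Real.exp (-t * p n) : ℝ) : ℂ) := by
    intro t ht
    rw [(key t ht.1).tsum_eq]
    -- Dyson sums are complex by construction, but each one sums diagonal kernel values, which are
    -- real.
    have him : (∑ j : Fin N, GaussMix.dysonSum D (0, j) t).im = 0 := by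
      rw [Complex.im_sum]
      refine Finset.sum_eq_zero fun j _ => ?_
      have h1 := Complex.hasSum_im (GaussMix.hasSum_dysonSum ht.1 fun l => H.hasSum_dyson ht.1.le l j)
      have h2 : ∀ i, (heatKer p φ t i i).im = 0 := by
        intro i
        have : heatKer p φ t i i = ((∑' n, Real.exp (-(t * p n)) * ‖φ n i‖ ^ 2 : ℝ) : ℂ) := by
          simp only [heatKer, Complex.ofReal_tsum]
          refine tsum_congr fun n => ?_
          rw [Complex.mul_conj, Complex.normSq_eq_norm_sq]
          push_cast; rfl
        rw [this, Complex.ofReal_im]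
      simp only [h2] at h1
      exact h1.unique hasSum_zero
    rw [Complex.ofReal_mul]
    congr 1
    exact Complex.ext rfl (by rw [him, Complex.ofReal_im])
  refine PolyApprox.congr ?_ h5
  simp only [Finset.mul_sum]
  exact PolyApprox.sum _ fun j _ => GaussMix.polyApprox_dysonSum D (0, j)

end IsEigenbasis

end

/-! ### Free resolvent and potential as compact operators -/

section

open scoped ENNReal NNReal

theorem isCompactOperator_smulRight {E F : Type*} [NormedAddCommGroup E] [NormedSpace ℂ E]
    [NormedAddCommGroup F] [NormedSpace ℂ F] (f : E →L[ℂ] ℂ) (v : F) :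
    IsCompactOperator (f.smulRight v) :=
  (isCompactOperator_of_locallyCompactSpace_dom f).clm_comp
    ((ContinuousLinearMap.id ℂ ℂ).smulRight v)

theorem isCompactOperator_tsum {E F J : Type*} [NormedAddCommGroup E] [NormedSpace ℂ E]
    [NormedAddCommGroup F] [NormedSpace ℂ F] [CompleteSpace F] {T : J → E →L[ℂ] F}
    (hs : Summable T) (hT : ∀ j, IsCompactOperator (T j)) : IsCompactOperator (∑' j, T j : E →L[ℂ] F) := by
  refine isCompactOperator_of_tendsto hs.hasSum (Eventually.of_forall fun s => ?_)
  exact (compactOperator (RingHom.id ℂ) E F).sum_mem fun j _ => hT j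

/-- Square summable functions on the Fourier modes. -/
abbrev ModeSpace (N : ℕ) : Type := lp (fun _ : ℤ × Fin N => ℂ) 2

namespace ModeSpace

variable {N : ℕ}

/-- The Fourier modes. -/
def mode (i : ℤ × Fin N) : ModeSpace N := lp.single 2 i 1

theorem inner_mode (i : ℤ × Fin N) (x : ModeSpace N) : inner ℂ (mode i) x = x i := by
  rw [mode, lp.inner_single_left]
  simp

theorem mode_apply (i j : ℤ × Fin N) : mode j i = if i = j then 1 else 0 := by
  split_ifs with h
  · subst h
    exact lp.single_apply_self _ _ _
  · exact lp.single_apply_ne _ _ _ h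

theorem norm_mode (i : ℤ × Fin N) : ‖mode i‖ = 1 := by
  rw [mode, lp.norm_single (by norm_num)]
  simp

/-- The operator with prescribed columns. -/
def columnOp (v : ℤ × Fin N → ModeSpace N) : ModeSpace N →L[ℂ] ModeSpace N :=
  ∑' j, (innerSL ℂ (mode j)).smulRight (v j)

variable {v : ℤ × Fin N → ModeSpace N}

theorem norm_columnOp_term (v : ℤ × Fin N → ModeSpace N) (j : ℤ × Fin N) :
    ‖(innerSL ℂ (mode j)).smulRight (v j)‖ = ‖v j‖ := by
  rw [ContinuousLinearMap.norm_smulRight_apply, innerSL_apply_norm, norm_mode, one_mul]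

theorem summable_columnOp (hv : Summable fun j => ‖v j‖) :
    Summable fun j => (innerSL ℂ (mode j)).smulRight (v j) :=
  Summable.of_norm (hv.congr fun j => (norm_columnOp_term v j).symm)

theorem norm_columnOp_le (hv : Summable fun j => ‖v j‖) : ‖columnOp v‖ ≤ ∑' j, ‖v j‖ :=
  tsum_of_norm_bounded hv.hasSum fun j => (norm_columnOp_term v j).le

theorem isCompactOperator_columnOp (hv : Summable fun j => ‖v j‖) :
    IsCompactOperator (columnOp v) :=
  isCompactOperator_tsum (summable_columnOp hv) fun _ => isCompactOperator_smulRight _ _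

theorem hasSum_columnOp (hv : Summable fun j => ‖v j‖) (x : ModeSpace N) :
    HasSum (fun j => x j • v j) (columnOp v x) := by
  have h := (ContinuousLinearMap.apply ℂ (ModeSpace N) x).hasSum (summable_columnOp hv).hasSum
  refine h.congr_fun fun j => ?_
  simp [inner_mode]

theorem hasSum_columnOp_apply (hv : Summable fun j => ‖v j‖) (x : ModeSpace N) (i : ℤ × Fin N) :
    HasSum (fun j => x j * v j i) (columnOp v x i) := by
  have h := (innerSL ℂ (mode i)).hasSum (hasSum_columnOp hv x)
  simp only [innerSL_apply_apply, inner_mode] at h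
  exact h

end ModeSpace

theorem memℓp_two_of_summable {J : Type*} {f : J → ℂ} (hf : Summable fun i => ‖f i‖) :
    Memℓp f 2 := by
  refine Memℓp.of_exponent_ge (q := 1) ?_ one_le_two
  refine memℓp_gen ?_
  simpa using hf

namespace FourierData

variable {N : ℕ} (D : FourierData N)

open ModeSpace

/-- The columns of the potential. -/
def col (j : ℤ × Fin N) : ModeSpace N :=
  ⟨fun i => D.mat i j, memℓp_two_of_summable (D.summable_norm_col j)⟩

theorem col_apply (i j : ℤ × Fin N) : D.col j i = D.mat i j := rfl

/-- The square of the ℓ² norm is at most the sup norm times the ℓ¹ norm. -/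
theorem norm_col_le (j : ℤ × Fin N) : ‖D.col j‖ ≤ D.colBound 0 := by
  refine lp.norm_le_of_tsum_le (by norm_num) (NNReal.coe_nonneg _) ?_
  simp only [ENNReal.toReal_ofNat, Real.rpow_ofNat, col_apply]
  have hle : ∀ i, ‖D.mat i j‖ ^ 2 ≤ D.colBound 0 * ‖D.mat i j‖ := fun i => by
    rw [sq]
    exact mul_le_mul_of_nonneg_right (D.norm_mat_le i j) (norm_nonneg _)
  have hs := (D.summable_norm_col j).mul_left (D.colBound 0 : ℝ)
  refine ((Summable.of_nonneg_of_le (fun _ => sq_nonneg _) hle hs).tsum_le_tsum hle hs).trans ?_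
  rw [tsum_mul_left, sq]
  exact mul_le_mul_of_nonneg_left (D.tsum_norm_col_le j) (NNReal.coe_nonneg _)

/-- A lower bound constant for the squares of the frequencies. -/
theorem exists_one_add_sq_le : ∃ κ : ℝ, 0 < κ ∧
    ∀ i, (1 + i.1.natAbs : ℝ) ^ 2 ≤ κ * (D.freq i ^ 2 + 1) := by
  have hom := D.om_pos
  have hB : ∀ j, D.β j ^ 2 ≤ ∑ j, D.β j ^ 2 := fun j =>
    Finset.single_le_sum (f := fun j => D.β j ^ 2) (fun _ _ => sq_nonneg _) (Finset.mem_univ j)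
  set B := ∑ j, D.β j ^ 2
  have hB0 : 0 ≤ B := Finset.sum_nonneg fun _ _ => sq_nonneg _
  -- The factor 1 + B absorbs the shifts in freq² ≥ om² m²/2 - β²; the other factor passes from om²
  -- m²/2 + 1 to (1 + |m|)² ≤ 2 + 2m².
  refine ⟨(1 + B) * (2 + 4 / D.om ^ 2), by positivity, fun i => ?_⟩
  have h2 : (i.1 : ℝ) ^ 2 = (i.1.natAbs : ℝ) ^ 2 := by
    rw [← sq_abs, Nat.cast_natAbs, Int.cast_abs]
  have h3 : D.om ^ 2 * (i.1.natAbs : ℝ) ^ 2 / 2 + 1 ≤ (1 + B) * (D.freq i ^ 2 + 1) := by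
    rw [← h2, freq]
    nlinarith [hB i.2, sq_nonneg (D.om * i.1 + 2 * D.β i.2),
      mul_nonneg hB0 (sq_nonneg (D.om * i.1 + D.β i.2))]
  set n : ℝ := (i.1.natAbs : ℝ)
  calc (1 + n) ^ 2 ≤ 2 + 2 * n ^ 2 := by nlinarith [sq_nonneg (n - 1)]
    _ ≤ (D.om ^ 2 * n ^ 2 / 2 + 1) * (2 + 4 / D.om ^ 2) := by
        have h4 : (D.om ^ 2 * n ^ 2 / 2 + 1) * (2 + 4 / D.om ^ 2) =
            D.om ^ 2 * n ^ 2 + 2 * n ^ 2 + 2 + 4 / D.om ^ 2 := by field_simp; ring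
        rw [h4]
        have h5 : 0 ≤ 4 / D.om ^ 2 := by positivity
        nlinarith [sq_nonneg (D.om * n)]
    _ ≤ (1 + B) * (D.freq i ^ 2 + 1) * (2 + 4 / D.om ^ 2) := by gcongr
    _ = _ := by ring

theorem summable_modes : Summable fun i : ℤ × Fin N => 1 / (1 + i.1.natAbs : ℝ) ^ 2 := by
  have h : Summable fun i : Fin N × ℤ => 1 / (1 + i.2.natAbs : ℝ) ^ 2 :=
    (summable_prod_of_nonneg fun _ => by positivity).2
      ⟨fun _ => summable_one_add_natAbs, Summable.of_finite⟩
  exact (Equiv.prodComm ℤ (Fin N)).summable_iff.2 h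

/-- The symbol of the free resolvent. -/
def resCoeff (c : ℝ) (i : ℤ × Fin N) : ℝ := 1 / (D.freq i ^ 2 + c)

variable {D} {c : ℝ}

theorem resCoeff_pos (hc : 0 < c) (i : ℤ × Fin N) : 0 < D.resCoeff c i := by
  unfold resCoeff
  positivity

theorem summable_resCoeff_one : Summable (D.resCoeff 1) := by
  obtain ⟨κ, hκ, h⟩ := D.exists_one_add_sq_le
  refine Summable.of_nonneg_of_le (fun i => (resCoeff_pos one_pos i).le) (fun i => ?_)
    (summable_modes.mul_left κ)
  rw [resCoeff, mul_one_div, div_le_div_iff₀ (by positivity) (by positivity), one_mul]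
  exact h i

theorem resCoeff_le (hc : 1 ≤ c) (i : ℤ × Fin N) : D.resCoeff c i ≤ D.resCoeff 1 i := by
  unfold resCoeff
  gcongr

theorem summable_resCoeff (hc : 1 ≤ c) : Summable (D.resCoeff c) :=
  Summable.of_nonneg_of_le (fun i => (resCoeff_pos (by linarith) i).le) (resCoeff_le hc)
    summable_resCoeff_one

variable (D)

/-- Dominated convergence as c → ∞, with the case c = 1 as bound. It makes the potential times the
free resolvent a strict contraction. -/
theorem exists_tsum_resCoeff_lt : ∃ c : ℝ, 1 ≤ c ∧ ∑' i, D.resCoeff c i * D.colBound 0 < 1 := by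
  have h := tendsto_tsum_of_dominated_convergence (𝓕 := atTop)
    (f := fun (c : ℝ) i => D.resCoeff c i * D.colBound 0) (g := fun _ => (0 : ℝ))
    ((summable_resCoeff_one (D := D)).mul_right (D.colBound 0 : ℝ)) (fun i => ?_) ?_
  · rw [tsum_zero] at h
    obtain ⟨c, h1, h2⟩ := ((h.eventually (gt_mem_nhds one_pos)).and (eventually_ge_atTop 1)).exists
    exact ⟨c, h2, h1⟩
  · have h1 : Tendsto (fun c : ℝ => D.resCoeff c i) atTop (𝓝 0) := by
      simp only [resCoeff, one_div]
      exact (tendsto_atTop_add_const_left _ _ tendsto_id).inv_tendsto_atTop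
    simpa using h1.mul_const (D.colBound 0 : ℝ)
  · filter_upwards [eventually_ge_atTop 1] with c hc i
    rw [Real.norm_eq_abs, abs_of_nonneg (mul_nonneg (resCoeff_pos (by linarith) i).le
      (NNReal.coe_nonneg _))]
    exact mul_le_mul_of_nonneg_right (resCoeff_le hc i) (NNReal.coe_nonneg _)

/-- The free resolvent. -/
def freeRes (c : ℝ) : ModeSpace N →L[ℂ] ModeSpace N :=
  columnOp fun j => (D.resCoeff c j : ℂ) • mode j

/-- The potential composed with the free resolvent. -/
def potRes (c : ℝ) : ModeSpace N →L[ℂ] ModeSpace N :=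
  columnOp fun j => (D.resCoeff c j : ℂ) • D.col j

variable {D}

theorem summable_freeRes (hc : 1 ≤ c) : Summable fun j => ‖(D.resCoeff c j : ℂ) • mode (N := N) j‖ := by
  refine (summable_resCoeff (D := D) hc).congr fun j => ?_
  rw [norm_smul, norm_mode, mul_one, Complex.norm_real, Real.norm_eq_abs,
    abs_of_pos (resCoeff_pos (by linarith) j)]

theorem norm_potRes_term_le (hc : 1 ≤ c) (j : ℤ × Fin N) :
    ‖(D.resCoeff c j : ℂ) • D.col j‖ ≤ D.resCoeff c j * D.colBound 0 := by
  have h := resCoeff_pos (D := D) (by linarith : 0 < c) j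
  rw [norm_smul, Complex.norm_real, Real.norm_eq_abs, abs_of_pos h]
  exact mul_le_mul_of_nonneg_left (D.norm_col_le j) h.le

theorem summable_potRes (hc : 1 ≤ c) : Summable fun j => ‖(D.resCoeff c j : ℂ) • D.col j‖ :=
  Summable.of_nonneg_of_le (fun _ => norm_nonneg _) (norm_potRes_term_le hc)
    ((summable_resCoeff hc).mul_right _)

theorem norm_potRes_le (hc : 1 ≤ c) : ‖D.potRes c‖ ≤ ∑' i, D.resCoeff c i * D.colBound 0 :=
  (norm_columnOp_le (summable_potRes hc)).trans
    ((summable_potRes hc).tsum_le_tsum (norm_potRes_term_le hc) ((summable_resCoeff hc).mul_right _))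

theorem freeRes_apply (hc : 1 ≤ c) (x : ModeSpace N) (i : ℤ × Fin N) :
    D.freeRes c x i = D.resCoeff c i * x i := by
  have h := hasSum_columnOp_apply (summable_freeRes (D := D) hc) x i
  have h1 : HasSum (fun j => if j = i then (D.resCoeff c i : ℂ) * x i else 0)
      ((D.resCoeff c i : ℂ) * x i) := hasSum_ite_eq i _
  refine h.unique (h1.congr_fun fun j => ?_)
  change x j * ((D.resCoeff c j : ℂ) * mode j i) = _
  rw [mode_apply]
  by_cases hj : j = i
  · subst hj
    simp only [if_true]
    ring
  · simp [hj, Ne.symm hj]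

theorem hasSum_potRes (hc : 1 ≤ c) (x : ModeSpace N) (i : ℤ × Fin N) :
    HasSum (fun j => D.mat i j * D.freeRes c x j) (D.potRes c x i) := by
  refine (hasSum_columnOp_apply (summable_potRes (D := D) hc) x i).congr_fun fun j => ?_
  rw [freeRes_apply hc]
  change _ = x j * ((D.resCoeff c j : ℂ) * D.mat i j)
  ring

theorem inner_freeRes (hc : 1 ≤ c) (x y : ModeSpace N) :
    inner ℂ (D.freeRes c x) y = inner ℂ x (D.freeRes c y) := by
  rw [lp.inner_eq_tsum, lp.inner_eq_tsum]
  refine tsum_congr fun i => ?_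
  rw [freeRes_apply hc, freeRes_apply hc]
  simp
  ring

/-- Symmetry of the potential on the range of the free resolvent. That range consists of summable
sequences, so the double sum converges absolutely and may be reordered. -/
theorem inner_freeRes_potRes (hc : 1 ≤ c) (x y : ModeSpace N) :
    inner ℂ (D.freeRes c x) (D.potRes c y) = inner ℂ (D.potRes c x) (D.freeRes c y) := by
  set u := D.freeRes c x with hu
  set w := D.freeRes c y with hw
  have hsu : Summable fun i => ‖u i‖ := by
    refine Summable.of_nonneg_of_le (fun _ => norm_nonneg _) (fun i => ?_)
      ((summable_resCoeff (D := D) hc).mul_right ‖x‖)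
    have h := resCoeff_pos (D := D) (by linarith : 0 < c) i
    rw [hu, freeRes_apply hc, norm_mul, Complex.norm_real, Real.norm_eq_abs, abs_of_pos h]
    exact mul_le_mul_of_nonneg_left (lp.norm_apply_le_norm two_ne_zero x i) h.le
  have hF : Summable fun z : (ℤ × Fin N) × (ℤ × Fin N) =>
      starRingEnd ℂ (u z.1) * (D.mat z.1 z.2 * w z.2) := by
    refine Summable.of_norm_bounded (g := fun z => ‖u z.1‖ * (‖D.mat z.1 z.2‖ * ‖w‖)) ?_ fun z => ?_
    · refine (summable_prod_of_nonneg fun _ => by positivity).2 ⟨fun i => ?_, ?_⟩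
      · exact ((D.summable_norm_row i).mul_right ‖w‖).mul_left ‖u i‖
      · refine Summable.of_nonneg_of_le (fun i => tsum_nonneg fun j => by positivity) (fun i => ?_)
          (hsu.mul_right (D.colBound 0 * ‖w‖ : ℝ))
        dsimp only
        rw [tsum_mul_left, tsum_mul_right]
        have := D.tsum_norm_row_le i
        gcongr
    · rw [norm_mul, norm_mul, RCLike.norm_conj]
      gcongr
      exact lp.norm_apply_le_norm two_ne_zero w z.2
  have h1 : ∀ i, ∑' j, starRingEnd ℂ (u i) * (D.mat i j * w j) =
      inner ℂ (u i) (D.potRes c y i) := by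
    intro i
    rw [tsum_mul_left, (hasSum_potRes hc y i).tsum_eq, RCLike.inner_apply, mul_comm]
  have h2 : ∀ j, ∑' i, starRingEnd ℂ (u i) * (D.mat i j * w j) =
      inner ℂ (D.potRes c x j) (w j) := by
    intro j
    rw [RCLike.inner_apply, ← (hasSum_potRes hc x j).tsum_eq, Complex.conj_tsum, ← tsum_mul_left]
    refine tsum_congr fun i => ?_
    rw [map_mul, D.conj_mat]
    ring
  rw [lp.inner_eq_tsum, lp.inner_eq_tsum, ← tsum_congr h1, ← tsum_congr h2]
  exact hF.tsum_comm.symm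

end FourierData

end

/-! ### Rapid decay of eigenvectors and the spectral theorem -/

section

open scoped ENNReal NNReal

/-- Rapidly decreasing functions on the Fourier modes. -/
def RapidDecay {N : ℕ} (f : ℤ × Fin N → ℂ) : Prop :=
  ∀ p : ℕ, ∃ C : ℝ, ∀ i, ‖f i‖ * (1 + i.1.natAbs : ℝ) ^ p ≤ C

namespace RapidDecay

variable {N : ℕ} {f g : ℤ × Fin N → ℂ}

theorem bounded (hf : RapidDecay f) : ∃ C, ∀ i, ‖f i‖ ≤ C := by
  obtain ⟨C, hC⟩ := hf 0
  exact ⟨C, fun i => by simpa using hC i⟩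

theorem summable (hf : RapidDecay f) (p : ℕ) :
    Summable fun i => ‖f i‖ * (1 + i.1.natAbs : ℝ) ^ p := by
  obtain ⟨C, hC⟩ := hf (p + 2)
  refine Summable.of_nonneg_of_le (fun _ => by positivity) (fun i => ?_)
    (FourierData.summable_modes.mul_left C)
  rw [mul_one_div, le_div_iff₀ (by positivity), mul_assoc, ← pow_add]
  exact hC i

theorem summable_norm (hf : RapidDecay f) : Summable fun i => ‖f i‖ := by
  simpa using hf.summable 0

theorem add (hf : RapidDecay f) (hg : RapidDecay g) : RapidDecay (f + g) := by
  intro p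
  obtain ⟨C, hC⟩ := hf p
  obtain ⟨C', hC'⟩ := hg p
  refine ⟨C + C', fun i => (mul_le_mul_of_nonneg_right (norm_add_le _ _) (by positivity)).trans ?_⟩
  rw [add_mul]
  exact add_le_add (hC i) (hC' i)

theorem smul (hf : RapidDecay f) (c : ℂ) : RapidDecay (c • f) := by
  intro p
  obtain ⟨C, hC⟩ := hf p
  refine ⟨‖c‖ * C, fun i => ?_⟩
  rw [Pi.smul_apply, norm_smul, mul_assoc]
  exact mul_le_mul_of_nonneg_left (hC i) (norm_nonneg _)

theorem zero : RapidDecay (0 : ℤ × Fin N → ℂ) := fun _ => ⟨0, fun _ => by simp⟩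

end RapidDecay

namespace FourierData

variable {N : ℕ} (D : FourierData N) {f : ℤ × Fin N → ℂ}

open ModeSpace

theorem weighted_row (p : ℕ) (i : ℤ × Fin N) :
    (Summable fun j => ‖D.mat i j‖ * (1 + (i.1 - j.1).natAbs : ℝ) ^ p) ∧
      ∑' j, ‖D.mat i j‖ * (1 + (i.1 - j.1).natAbs : ℝ) ^ p ≤ D.colBound p := by
  have h := D.tsum_mat_le p i
  have h1 : ∀ j, ‖D.mat j i‖ₑ * ((1 + (j.1 - i.1).natAbs : ℕ) : ℝ≥0∞) ^ p =
      ENNReal.ofReal (‖D.mat i j‖ * (1 + (i.1 - j.1).natAbs : ℝ) ^ p) := by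
    intro j
    rw [ENNReal.ofReal_mul (norm_nonneg _), D.norm_mat_comm, ofReal_norm,
      ENNReal.ofReal_pow (by positivity), ← Int.natAbs_neg, neg_sub]
    congr 2
    rw [show (1 + (i.1 - j.1).natAbs : ℝ) = ((1 + (i.1 - j.1).natAbs : ℕ) : ℝ) by push_cast; rfl,
      ENNReal.ofReal_natCast]
  simp only [h1] at h
  have hs : Summable fun j => ‖D.mat i j‖ * (1 + (i.1 - j.1).natAbs : ℝ) ^ p := by
    have h2 := ENNReal.summable_toReal (h.trans_lt ENNReal.coe_lt_top).ne
    refine h2.congr fun j => ENNReal.toReal_ofReal (by positivity)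
  refine ⟨hs, ?_⟩
  rw [← ENNReal.ofReal_tsum_of_nonneg (fun _ => by positivity) hs,
    ENNReal.ofReal_le_iff_le_toReal ENNReal.coe_ne_top] at h
  simpa using h

theorem summable_mat_mul {C : ℝ} (hf : ∀ i, ‖f i‖ ≤ C) (i : ℤ × Fin N) :
    Summable fun j => D.mat i j * f j := by
  refine Summable.of_norm_bounded ((D.summable_norm_row i).mul_right C) fun j => ?_
  rw [norm_mul]
  exact mul_le_mul_of_nonneg_left (hf j) (norm_nonneg _)

/-- The potential preserves polynomially weighted sup norms, because 1 + |m| ≤ (1 + |m-n|)(1 + |n|)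
lets the matrix decay pay for the difference. -/
theorem norm_tsum_mat_mul_weight_le {C : ℝ} {p : ℕ}
    (hf : ∀ i, ‖f i‖ * (1 + i.1.natAbs : ℝ) ^ p ≤ C) (i : ℤ × Fin N) :
    ‖∑' j, D.mat i j * f j‖ * (1 + i.1.natAbs : ℝ) ^ p ≤ D.colBound p * C := by
  obtain ⟨hs, hle⟩ := D.weighted_row p i
  have hC : 0 ≤ C := (by positivity : (0 : ℝ) ≤ _).trans (hf i)
  have h1 : ‖∑' j, D.mat i j * f j * ((1 + i.1.natAbs : ℝ) ^ p : ℝ)‖ ≤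
      ∑' j, ‖D.mat i j‖ * (1 + (i.1 - j.1).natAbs : ℝ) ^ p * C := by
    refine tsum_of_norm_bounded (hs.mul_right C).hasSum fun j => ?_
    rw [norm_mul, norm_mul, Complex.norm_real, Real.norm_eq_abs, abs_of_nonneg (by positivity)]
    have h2 : (1 + i.1.natAbs : ℝ) ≤ (1 + (i.1 - j.1).natAbs : ℝ) * (1 + j.1.natAbs : ℝ) := by
      have h3 : i.1.natAbs ≤ (i.1 - j.1).natAbs + j.1.natAbs := by omega
      have h4 : (i.1.natAbs : ℝ) ≤ (i.1 - j.1).natAbs + j.1.natAbs := by exact_mod_cast h3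
      nlinarith [(Nat.cast_nonneg _ : (0 : ℝ) ≤ (i.1 - j.1).natAbs),
        (Nat.cast_nonneg _ : (0 : ℝ) ≤ j.1.natAbs)]
    calc ‖D.mat i j‖ * ‖f j‖ * (1 + i.1.natAbs : ℝ) ^ p
        ≤ ‖D.mat i j‖ * ‖f j‖ * ((1 + (i.1 - j.1).natAbs : ℝ) * (1 + j.1.natAbs : ℝ)) ^ p := by
          gcongr
      _ = ‖D.mat i j‖ * (1 + (i.1 - j.1).natAbs : ℝ) ^ p *
          (‖f j‖ * (1 + j.1.natAbs : ℝ) ^ p) := by rw [mul_pow]; ring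
      _ ≤ _ := mul_le_mul_of_nonneg_left (hf j) (by positivity)
  rw [tsum_mul_right, norm_mul, Complex.norm_real, Real.norm_eq_abs,
    abs_of_nonneg (by positivity), tsum_mul_right] at h1
  exact h1.trans (mul_le_mul_of_nonneg_right hle hC)

/-- Bounded eigenvectors decay rapidly. -/
theorem rapidDecay_of_eigen {C μ : ℝ} (hf : ∀ i, ‖f i‖ ≤ C)
    (he : ∀ i, ((D.freq i ^ 2 : ℝ) : ℂ) * f i + ∑' j, D.mat i j * f j = μ * f i) :
    RapidDecay f := by
  obtain ⟨κ, hκ, hfr⟩ := D.exists_one_add_sq_le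
  intro p
  induction p with
  | zero => exact ⟨C, fun i => by simpa using hf i⟩
  | succ p ih =>
    obtain ⟨B, hB⟩ := ih
    refine ⟨κ * (|μ + 1| * B + D.colBound p * B), fun i => ?_⟩
    have h1 := D.norm_tsum_mat_mul_weight_le hB i
    -- Bootstrap: the right side decays like the inductive hypothesis, and dividing by freq² + 1
    -- gains two powers, of which one is used.
    have h2 : ((D.freq i ^ 2 + 1 : ℝ) : ℂ) * f i = ((μ + 1 : ℝ) : ℂ) * f i -
        ∑' j, D.mat i j * f j := by
      have := he i
      push_cast at this ⊢
      linear_combination this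
    have h3 : (D.freq i ^ 2 + 1) * ‖f i‖ ≤ |μ + 1| * ‖f i‖ + ‖∑' j, D.mat i j * f j‖ := by
      have h4 := congrArg norm h2
      rw [norm_mul, Complex.norm_real, Real.norm_eq_abs, abs_of_pos (by positivity)] at h4
      rw [h4]
      refine (norm_sub_le _ _).trans ?_
      rw [norm_mul, Complex.norm_real, Real.norm_eq_abs]
    have h5 : (1 : ℝ) ≤ 1 + i.1.natAbs := by simp
    calc ‖f i‖ * (1 + i.1.natAbs : ℝ) ^ (p + 1)
        ≤ ‖f i‖ * (1 + i.1.natAbs : ℝ) ^ (p + 2) :=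
          mul_le_mul_of_nonneg_left (pow_le_pow_right₀ h5 (by omega)) (norm_nonneg _)
      _ = (1 + i.1.natAbs : ℝ) ^ 2 * (‖f i‖ * (1 + i.1.natAbs : ℝ) ^ p) := by ring
      _ ≤ κ * (D.freq i ^ 2 + 1) * (‖f i‖ * (1 + i.1.natAbs : ℝ) ^ p) :=
          mul_le_mul_of_nonneg_right (hfr i) (by positivity)
      _ = κ * ((D.freq i ^ 2 + 1) * ‖f i‖ * (1 + i.1.natAbs : ℝ) ^ p) := by ring
      _ ≤ κ * ((|μ + 1| * ‖f i‖ + ‖∑' j, D.mat i j * f j‖) * (1 + i.1.natAbs : ℝ) ^ p) := by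
          gcongr
      _ = κ * (|μ + 1| * (‖f i‖ * (1 + i.1.natAbs : ℝ) ^ p) +
          ‖∑' j, D.mat i j * f j‖ * (1 + i.1.natAbs : ℝ) ^ p) := by ring
      _ ≤ _ := by
          gcongr
          exact hB i

/-- The eigenspaces of the operator in Fourier space. -/
def eigenSpace (μ : ℝ) : Submodule ℂ (ℤ × Fin N → ℂ) where
  carrier := {f | RapidDecay f ∧
    ∀ i, ((D.freq i ^ 2 : ℝ) : ℂ) * f i + ∑' j, D.mat i j * f j = μ * f i}
  add_mem' := by
    rintro f g ⟨hf, hf'⟩ ⟨hg, hg'⟩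
    refine ⟨hf.add hg, fun i => ?_⟩
    obtain ⟨C, hC⟩ := hf.bounded
    obtain ⟨C', hC'⟩ := hg.bounded
    simp only [Pi.add_apply, mul_add]
    rw [(D.summable_mat_mul hC i).tsum_add (D.summable_mat_mul hC' i), ← hf' i, ← hg' i]
    ring
  zero_mem' := ⟨RapidDecay.zero, fun i => by simp⟩
  smul_mem' := by
    rintro c f ⟨hf, hf'⟩
    refine ⟨hf.smul c, fun i => ?_⟩
    simp only [Pi.smul_apply, smul_eq_mul, mul_left_comm _ c]
    rw [tsum_mul_left, ← mul_add, hf' i]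

/-- Rapidly decreasing eigenvectors as square summable functions. -/
def eigenToMode (μ : ℝ) : D.eigenSpace μ →ₗ[ℂ] ModeSpace N where
  toFun f := ⟨f.1, memℓp_two_of_summable f.2.1.summable_norm⟩
  map_add' _ _ := rfl
  map_smul' _ _ := rfl

theorem eigenToMode_injective (μ : ℝ) : Function.Injective (D.eigenToMode μ) := fun _ _ h =>
  Subtype.ext (congrArg (fun x : ModeSpace N => (x : ℤ × Fin N → ℂ)) h)

/-- A compact symmetric operator with the same eigenvectors. -/
theorem exists_resolvent : ∃ (c : ℝ) (G : ModeSpace N →L[ℂ] ModeSpace N),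
    IsCompactOperator G ∧ (G : ModeSpace N →ₗ[ℂ] ModeSpace N).IsSymmetric ∧
    (∀ x, G x = 0 → x = 0) ∧
    (∀ (x : ModeSpace N) (γ : ℝ), γ ≠ 0 → G x = (γ : ℂ) • x → ∀ i,
      ((D.freq i ^ 2 : ℝ) : ℂ) * x i + ∑' j, D.mat i j * x j = ((γ⁻¹ - c : ℝ) : ℂ) * x i) ∧
    ∀ (μ : ℝ) (f : D.eigenSpace μ), D.eigenToMode μ f = ((μ + c : ℝ) : ℂ) • G (D.eigenToMode μ f) := by
  obtain ⟨c, hc, hlt⟩ := D.exists_tsum_resCoeff_lt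
  have hc0 : 0 < c := by linarith
  -- With R_c the free resolvent, L + c = (1 + Q R_c) R_c⁻¹, so the resolvent is R_c (1 + Q R_c)⁻¹,
  -- the inverse being given by the Neumann series.
  have hnorm : ‖-D.potRes c‖ < 1 := by
    rw [norm_neg]
    exact (norm_potRes_le hc).trans_lt hlt
  have hunit := isUnit_one_sub_of_norm_lt_one hnorm
  rw [sub_neg_eq_add] at hunit
  obtain ⟨U, hU⟩ := hunit
  set R : ModeSpace N →L[ℂ] ModeSpace N := ((U⁻¹ : (ModeSpace N →L[ℂ] ModeSpace N)ˣ) :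
    ModeSpace N →L[ℂ] ModeSpace N)
  have hR1 : ∀ x, R x + D.potRes c (R x) = x := by
    intro x
    have h := congrArg (fun T : ModeSpace N →L[ℂ] ModeSpace N => T x) U.mul_inv
    rw [hU] at h
    simpa using h
  have hR2 : ∀ x, R (x + D.potRes c x) = x := by
    intro x
    have h := congrArg (fun T : ModeSpace N →L[ℂ] ModeSpace N => T x) U.inv_mul
    rw [hU] at h
    simpa using h
  have hfr : ∀ i, ((D.resCoeff c i : ℝ) : ℂ) * ((D.freq i ^ 2 + c : ℝ) : ℂ) = 1 := by
    intro i
    rw [← Complex.ofReal_mul, resCoeff, one_div_mul_cancel (by positivity), Complex.ofReal_one]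
  refine ⟨c, (D.freeRes c).comp R, ?_, ?_, ?_, ?_, ?_⟩
  · exact (isCompactOperator_columnOp (summable_freeRes hc)).comp_clm R
  · intro x y
    change inner ℂ (D.freeRes c (R x)) y = inner ℂ x (D.freeRes c (R y))
    conv_lhs => rw [← hR1 y]
    conv_rhs => rw [← hR1 x]
    rw [inner_add_right, inner_add_left, inner_freeRes hc, inner_freeRes_potRes hc]
  · intro x hx
    have h0 : R x = 0 := by
      ext i
      have h1 := congrArg (fun y : ModeSpace N => y i) hx
      change D.freeRes c (R x) i = 0 at h1
      rw [freeRes_apply hc] at h1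
      exact (mul_eq_zero.1 h1).resolve_left
        (Complex.ofReal_ne_zero.2 (resCoeff_pos (D := D) hc0 i).ne')
    rw [← hR1 x, h0]
    simp
  · intro x γ hγ hx i
    have hγ' : (γ : ℂ) ≠ 0 := by exact_mod_cast hγ
    have h1 : ∀ j, D.freeRes c (R x) j = γ * x j := fun j =>
      congrArg (fun y : ModeSpace N => y j) hx
    have h2 : R x i = γ * ((D.freq i ^ 2 + c : ℝ) : ℂ) * x i := by
      have h3 := h1 i
      rw [freeRes_apply hc] at h3
      have h4 := hfr i
      linear_combination (D.freq i ^ 2 + c : ℝ) * h3 - R x i * h4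
    have h5 := (hasSum_potRes (D := D) hc (R x) i).tsum_eq
    simp only [h1, mul_left_comm _ (γ : ℂ)] at h5
    rw [tsum_mul_left] at h5
    have h6 : R x i + D.potRes c (R x) i = x i := congrArg (fun y : ModeSpace N => y i) (hR1 x)
    rw [← h5, h2] at h6
    push_cast at h6 ⊢
    field_simp
    linear_combination h6
  · intro μ f
    obtain ⟨C, hC⟩ := f.2.1 4
    have hle : ∀ i, ‖((D.freq i ^ 2 + c : ℝ) : ℂ) * f.1 i‖ ≤
        (D.growth ^ 2 + c) * (‖f.1 i‖ * (1 + i.1.natAbs : ℝ) ^ 2) := by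
      intro i
      rw [norm_mul, Complex.norm_real, Real.norm_eq_abs, abs_of_pos (by positivity)]
      have h1 : D.freq i ^ 2 ≤ (D.growth * (1 + i.1.natAbs : ℝ)) ^ 2 := by
        rw [← sq_abs]
        refine pow_le_pow_left₀ (abs_nonneg _) ?_ 2
        exact_mod_cast D.abs_freq_le i
      have h2 : (1 : ℝ) ≤ (1 + i.1.natAbs : ℝ) ^ 2 := one_le_pow₀ (by simp)
      have h3 : D.freq i ^ 2 + c ≤ (D.growth ^ 2 + c) * (1 + i.1.natAbs : ℝ) ^ 2 := by
        nlinarith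
      calc _ ≤ (D.growth ^ 2 + c) * (1 + i.1.natAbs : ℝ) ^ 2 * ‖f.1 i‖ := by gcongr
        _ = _ := by ring
    -- With h = R_c⁻¹ f one has f = R_c h and h + Q R_c h = (L + c) f = (μ + c) f.
    let h : ModeSpace N := ⟨fun i => ((D.freq i ^ 2 + c : ℝ) : ℂ) * f.1 i,
      memℓp_two_of_summable (Summable.of_nonneg_of_le (fun _ => norm_nonneg _) hle
        ((f.2.1.summable 2).mul_left _))⟩
    have hh : D.freeRes c h = D.eigenToMode μ f := by
      ext i
      rw [freeRes_apply hc]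
      change (D.resCoeff c i : ℂ) * (((D.freq i ^ 2 + c : ℝ) : ℂ) * f.1 i) = f.1 i
      rw [← mul_assoc, hfr, one_mul]
    have h1 : h + D.potRes c h = ((μ + c : ℝ) : ℂ) • D.eigenToMode μ f := by
      ext i
      have h2 := (hasSum_potRes (D := D) hc h i).tsum_eq
      rw [hh] at h2
      change ((D.freq i ^ 2 + c : ℝ) : ℂ) * f.1 i + D.potRes c h i = ((μ + c : ℝ) : ℂ) * f.1 i
      rw [← h2]
      have h3 := f.2.2 i
      change _ + ∑' j, D.mat i j * f.1 j = _
      push_cast at h3 ⊢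
      linear_combination h3
    change _ = ((μ + c : ℝ) : ℂ) • D.freeRes c (R (D.eigenToMode μ f))
    rw [← map_smul, ← map_smul, ← h1, hR2, hh]

/-- The operator in Fourier space has an orthonormal basis of eigenvectors. -/
theorem exists_isEigenbasis :
    ∃ φ : (Σ μ : ℝ, Fin (Module.finrank ℂ (D.eigenSpace μ))) → ℤ × Fin N → ℂ,
      IsEigenbasis D (fun n => n.1) φ := by
  obtain ⟨c, G, hGc, hGs, hG0, hG1, hG2⟩ := D.exists_resolvent
  set V : ℝ → Submodule ℂ (ModeSpace N) := fun μ => LinearMap.range (D.eigenToMode μ)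
  -- The correspondence μ ↦ 1/(μ + c). For μ + c = 0 the relation from `exists_resolvent` forces the
  -- vector to vanish, so the convention for 0⁻¹ is harmless.
  have hV : ∀ μ, V μ ≤ Module.End.eigenspace (G : ModeSpace N →ₗ[ℂ] ModeSpace N)
      (((μ + c)⁻¹ : ℝ) : ℂ) := by
    rintro μ _ ⟨f, rfl⟩
    rw [Module.End.mem_eigenspace_iff]
    have h := hG2 μ f
    by_cases h0 : μ + c = 0
    · rw [h0, Complex.ofReal_zero, zero_smul] at h
      rw [h, map_zero, smul_zero]
    · conv_rhs => rw [h]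
      rw [smul_smul, ← Complex.ofReal_mul, inv_mul_cancel₀ h0, Complex.ofReal_one, one_smul]
      rfl
  have hfin : ∀ μ, FiniteDimensional ℂ (V μ) := by
    intro μ
    by_cases h0 : μ + c = 0
    · have : V μ = ⊥ := by
        rw [eq_bot_iff]
        rintro _ ⟨f, rfl⟩
        have h := hG2 μ f
        rw [h0, Complex.ofReal_zero, zero_smul] at h
        exact h
      rw [this]
      infer_instance
    · have := ContinuousLinearMap.finite_dimensional_eigenspace hGc (((μ + c)⁻¹ : ℝ) : ℂ)
        (by exact_mod_cast inv_ne_zero h0)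
      exact Submodule.finiteDimensional_of_le (hV μ)
  have hrank : ∀ μ, Module.finrank ℂ (V μ) = Module.finrank ℂ (D.eigenSpace μ) := fun μ =>
    LinearMap.finrank_range_of_inj (D.eigenToMode_injective μ)
  let b : ∀ μ, OrthonormalBasis (Fin (Module.finrank ℂ (D.eigenSpace μ))) ℂ (V μ) := fun μ =>
    (stdOrthonormalBasis ℂ (V μ)).reindex (finCongr (hrank μ))
  have horth : OrthogonalFamily ℂ (fun μ => V μ) fun μ => (V μ).subtypeₗᵢ := by
    intro μ μ' hne x y
    have hne' : (((μ + c)⁻¹ : ℝ) : ℂ) ≠ (((μ' + c)⁻¹ : ℝ) : ℂ) := by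
      intro h
      have h1 := inv_injective (Complex.ofReal_injective h)
      exact hne (by linarith)
    exact hGs.orthogonalFamily_eigenspaces hne' ⟨x, hV μ x.2⟩ ⟨y, hV μ' y.2⟩
  have hon := horth.orthonormal_sigma_orthonormal fun μ => (b μ).orthonormal
  -- By the spectral theorem the eigenspaces of the resolvent have dense span. Its eigenvalues γ are
  -- real and, by injectivity, nonzero; their eigenvectors satisfy the eigenvalue equation with μ =
  -- 1/γ - c and decay rapidly, hence lie in V μ.
  have hbot : (Submodule.span ℂ (range fun n : Σ μ : ℝ, Fin (Module.finrank ℂ (D.eigenSpace μ)) =>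
      (V n.1).subtypeₗᵢ (b n.1 n.2)))ᗮ = ⊥ := by
    rw [eq_bot_iff, ← ContinuousLinearMap.orthogonalComplement_iSup_eigenspaces_eq_bot hGc hGs]
    refine Submodule.orthogonal_le (iSup_le fun γ x hx => ?_)
    by_cases hx0 : x = 0
    · rw [hx0]; exact Submodule.zero_mem _
    rw [Module.End.mem_eigenspace_iff] at hx
    have hev : Module.End.HasEigenvalue (G : ModeSpace N →ₗ[ℂ] ModeSpace N) γ :=
      Module.End.hasEigenvalue_of_hasEigenvector (x := x)
        ⟨Module.End.mem_eigenspace_iff.2 hx, hx0⟩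
    have hreal := hGs.conj_eigenvalue_eq_self hev
    obtain ⟨r, rfl⟩ := Complex.conj_eq_iff_real.1 hreal
    have hr : r ≠ 0 := by
      rintro rfl
      rw [Complex.ofReal_zero, zero_smul] at hx
      exact hx0 (hG0 x hx)
    have he := hG1 x r hr hx
    have hxV : x ∈ V (r⁻¹ - c) := ⟨⟨x, D.rapidDecay_of_eigen
      (fun i => lp.norm_apply_le_norm two_ne_zero x i) he, he⟩, rfl⟩
    have hsum := congrArg (V (r⁻¹ - c)).subtype ((b (r⁻¹ - c)).sum_repr ⟨x, hxV⟩)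
    rw [map_sum] at hsum
    change _ = x at hsum
    rw [← hsum]
    refine Submodule.sum_mem _ fun k _ => ?_
    rw [map_smul]
    exact Submodule.smul_mem _ _ (Submodule.subset_span ⟨⟨_, k⟩, rfl⟩)
  let B := HilbertBasis.mkOfOrthogonalEqBot hon hbot
  have hB : ∀ n, B n = (b n.1 n.2 : ModeSpace N) := fun n =>
    congrFun (HilbertBasis.coe_mkOfOrthogonalEqBot hon hbot) n
  refine ⟨fun n => B n, fun n => ?_, fun i j => ?_, fun n i => ?_⟩
  · have h := lp.hasSum_norm (by norm_num) (B n)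
    have h1 : ‖B n‖ = 1 := B.orthonormal.1 n
    rw [h1] at h
    simpa using h
  · have h := B.hasSum_inner_mul_inner (mode i) (mode j)
    simp only [inner_mode, mode_apply] at h
    refine h.congr_fun fun n => ?_
    rw [← inner_conj_symm, inner_mode]
  · obtain ⟨f, hf⟩ := (b n.1 n.2).2
    have h := f.2.2 i
    rw [hB, ← hf]
    exact h

end FourierData

end

/-! ### Fourier series on the circle of radius a -/

section

variable {a : ℝ}

/-- The exponentials on the circle of radius `a`. -/
def wave (a : ℝ) (m : ℤ) (x : ℝ) : ℂ := Complex.exp ((m / a * x : ℝ) * Complex.I)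

theorem norm_wave (m : ℤ) (x : ℝ) : ‖wave a m x‖ = 1 := Complex.norm_exp_ofReal_mul_I _

theorem hasDerivAt_wave (m : ℤ) (x : ℝ) :
    HasDerivAt (wave a m) ((m / a : ℝ) * Complex.I * wave a m x) x := by
  have h : HasDerivAt (fun x : ℝ => ((m / a * x : ℝ) : ℂ) * Complex.I)
      ((m / a : ℝ) * Complex.I) x := by
    have h1 := ((hasDerivAt_id x).const_mul (m / a : ℝ)).ofReal_comp.mul_const Complex.I
    simpa using h1
  have h2 := h.cexp
  rw [mul_comm] at h2
  exact h2

theorem contDiff_wave (m : ℤ) : ContDiff ℝ ∞ (wave a m) := by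
  unfold wave
  exact ((Complex.ofRealCLM.contDiff.comp (contDiff_const.mul contDiff_id)).mul
    contDiff_const).cexp

theorem continuous_wave (m : ℤ) : Continuous (wave a m) := (contDiff_wave m).continuous

theorem wave_add (m n : ℤ) (x : ℝ) : wave a (m + n) x = wave a m x * wave a n x := by
  rw [wave, wave, wave, ← Complex.exp_add]
  congr 1
  push_cast
  ring

theorem wave_zero (x : ℝ) : wave a 0 x = 1 := by simp [wave]

theorem wave_periodic (ha : 0 < a) (m : ℤ) (x : ℝ) : wave a m (x + 2 * π * a) = wave a m x := by
  have h : ((m / a * (x + 2 * π * a) : ℝ) : ℂ) * Complex.I =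
      ((m / a * x : ℝ) : ℂ) * Complex.I + m * (2 * π * Complex.I) := by
    have : (a : ℂ) ≠ 0 := by exact_mod_cast ha.ne'
    push_cast
    field_simp
  rw [wave, h, Complex.exp_add, Complex.exp_int_mul_two_pi_mul_I, mul_one, wave]

/-- Smooth functions on the circle of radius `a`. -/
structure SmoothPeriodic (a : ℝ) (f : ℝ → ℂ) : Prop where
  contDiff : ContDiff ℝ ∞ f
  periodic : ∀ x, f (x + 2 * π * a) = f x

namespace SmoothPeriodic

variable {f g : ℝ → ℂ}

theorem differentiable (hf : SmoothPeriodic a f) : Differentiable ℝ f :=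
  (contDiff_infty_iff_deriv.1 hf.contDiff).1

theorem deriv (hf : SmoothPeriodic a f) : SmoothPeriodic a (deriv f) := by
  refine ⟨(contDiff_infty_iff_deriv.1 hf.contDiff).2, fun x => ?_⟩
  rw [← deriv_comp_add_const f (2 * π * a) x, funext hf.periodic]

theorem mul (hf : SmoothPeriodic a f) (hg : SmoothPeriodic a g) :
    SmoothPeriodic a fun x => f x * g x :=
  ⟨hf.contDiff.mul hg.contDiff, fun x => by rw [hf.periodic, hg.periodic]⟩

theorem wave (ha : 0 < a) (m : ℤ) : SmoothPeriodic a (CircleLaplace.wave a m) :=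
  ⟨contDiff_wave m, wave_periodic ha m⟩

end SmoothPeriodic

/-- Fourier coefficients. -/
def fcoeff (a : ℝ) (f : ℝ → ℂ) (m : ℤ) : ℂ :=
  (2 * π * a : ℂ)⁻¹ * ∫ x in (0 : ℝ)..2 * π * a, wave a (-m) x * f x

section

variable {f g : ℝ → ℂ}

theorem intervalIntegrable_wave_mul (hf : Continuous f) (m : ℤ) (x y : ℝ) :
    IntervalIntegrable (fun x => wave a m x * f x) volume x y :=
  Continuous.intervalIntegrable ((continuous_wave m).mul hf) x y

theorem fcoeff_add (hf : Continuous f) (hg : Continuous g) (m : ℤ) :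
    fcoeff a (fun x => f x + g x) m = fcoeff a f m + fcoeff a g m := by
  simp only [fcoeff, mul_add]
  rw [intervalIntegral.integral_add (intervalIntegrable_wave_mul hf _ _ _)
    (intervalIntegrable_wave_mul hg _ _ _), mul_add]

theorem fcoeff_const_mul (c : ℂ) (m : ℤ) :
    fcoeff a (fun x => c * f x) m = c * fcoeff a f m := by
  simp only [fcoeff, mul_left_comm _ c]
  rw [intervalIntegral.integral_const_mul, mul_left_comm]

theorem fcoeff_sum {ι : Type*} (s : Finset ι) {f : ι → ℝ → ℂ} (hf : ∀ k ∈ s, Continuous (f k))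
    (m : ℤ) : fcoeff a (fun x => ∑ k ∈ s, f k x) m = ∑ k ∈ s, fcoeff a (f k) m := by
  simp only [fcoeff, Finset.mul_sum]
  rw [intervalIntegral.integral_finsetSum fun k hk =>
    intervalIntegrable_wave_mul (hf k hk) _ _ _, Finset.mul_sum]

theorem fcoeff_mul_wave (m n : ℤ) :
    fcoeff a (fun x => f x * wave a n x) m = fcoeff a f (m - n) := by
  rw [fcoeff, fcoeff]
  congr 1
  refine intervalIntegral.integral_congr fun x _ => ?_
  rw [neg_sub, sub_eq_neg_add, wave_add]
  ring

theorem fcoeff_deriv (ha : 0 < a) (hf : SmoothPeriodic a f) (m : ℤ) :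
    fcoeff a (deriv f) m = (m / a : ℝ) * Complex.I * fcoeff a f m := by
  set κ : ℂ := (((-m : ℤ) / a : ℝ) : ℂ) * Complex.I with hκ
  have hd : ∀ x ∈ uIcc 0 (2 * π * a), HasDerivAt (fun x => wave a (-m) x * f x)
      (κ * (wave a (-m) x * f x) + wave a (-m) x * deriv f x) x := by
    intro x _
    rw [← mul_assoc]
    exact (hasDerivAt_wave (-m) x).mul (hf.differentiable x).hasDerivAt
  have hc1 := (intervalIntegrable_wave_mul (a := a) hf.contDiff.continuous (-m) 0
    (2 * π * a)).const_mul κ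
  have hc2 := intervalIntegrable_wave_mul (a := a) hf.deriv.contDiff.continuous (-m) 0 (2 * π * a)
  have h := intervalIntegral.integral_eq_sub_of_hasDerivAt hd (hc1.add hc2)
  have h0 : wave a (-m) (2 * π * a) * f (2 * π * a) = wave a (-m) 0 * f 0 := by
    rw [← zero_add (2 * π * a), wave_periodic ha, hf.periodic]
  rw [h0, sub_self, intervalIntegral.integral_add hc1 hc2, intervalIntegral.integral_const_mul] at h
  rw [fcoeff, fcoeff]
  rw [hκ] at h
  push_cast at h ⊢
  linear_combination (2 * π * a : ℂ)⁻¹ * h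

theorem norm_fcoeff_le (ha : 0 < a) {B : ℝ} (hB : ∀ x ∈ Icc 0 (2 * π * a), ‖f x‖ ≤ B) (m : ℤ) :
    ‖fcoeff a f m‖ ≤ B := by
  have hT : 0 < 2 * π * a := by have := Real.pi_pos; positivity
  have h : ‖∫ x in (0 : ℝ)..2 * π * a, wave a (-m) x * f x‖ ≤ B * |2 * π * a - 0| := by
    refine intervalIntegral.norm_integral_le_of_norm_le_const fun x hx => ?_
    rw [uIoc_of_le hT.le] at hx
    rw [norm_mul, norm_wave, one_mul]
    exact hB x (Ioc_subset_Icc_self hx)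
  rw [sub_zero, abs_of_pos hT] at h
  rw [fcoeff, norm_mul, norm_inv, show (2 * π * a : ℂ) = ((2 * π * a : ℝ) : ℂ) by push_cast; rfl,
    Complex.norm_real, Real.norm_eq_abs, abs_of_pos hT, inv_mul_le_iff₀ hT]
  exact h.trans (le_of_eq (mul_comm _ _))

/-- Each derivative gains one power of |m|/a, and coefficients of a bounded function are bounded. -/
theorem fcoeff_decay (ha : 0 < a) (p : ℕ) : ∀ {f : ℝ → ℂ}, SmoothPeriodic a f →
    ∃ C : ℝ, ∀ m : ℤ, ‖fcoeff a f m‖ * (1 + m.natAbs : ℝ) ^ p ≤ C := by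
  induction p with
  | zero =>
    intro f hf
    obtain ⟨B, hB⟩ := isCompact_Icc.exists_bound_of_continuousOn
      (hf.contDiff.continuous.continuousOn (s := Icc 0 (2 * π * a)))
    exact ⟨B, fun m => by simpa using norm_fcoeff_le ha hB m⟩
  | succ p ih =>
    intro f hf
    obtain ⟨C, hC⟩ := ih hf
    obtain ⟨C', hC'⟩ := ih hf.deriv
    refine ⟨C + a * C', fun m => ?_⟩
    have h1 := hC' m
    have h2 : |(m : ℝ)| = m.natAbs := by rw [Nat.cast_natAbs, Int.cast_abs]
    rw [fcoeff_deriv ha hf, norm_mul, norm_mul, Complex.norm_I, mul_one, Complex.norm_real,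
      Real.norm_eq_abs, abs_div, abs_of_pos ha, h2] at h1
    have h3 : ‖fcoeff a f m‖ * (1 + m.natAbs : ℝ) ^ (p + 1) =
        ‖fcoeff a f m‖ * (1 + m.natAbs : ℝ) ^ p +
          a * (m.natAbs / a * ‖fcoeff a f m‖ * (1 + m.natAbs : ℝ) ^ p) := by
      field_simp
      ring
    rw [h3]
    exact add_le_add (hC m) (mul_le_mul_of_nonneg_left h1 ha.le)

theorem summable_of_decay {c : ℤ → ℂ} {p : ℕ}
    (hc : ∃ C : ℝ, ∀ m, ‖c m‖ * (1 + m.natAbs : ℝ) ^ (p + 2) ≤ C) :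
    Summable fun m => ‖c m‖ * (1 + m.natAbs : ℝ) ^ p := by
  obtain ⟨C, hC⟩ := hc
  refine Summable.of_nonneg_of_le (fun _ => by positivity) (fun m => ?_)
    (summable_one_add_natAbs.mul_left C)
  rw [mul_one_div, le_div_iff₀ (by positivity), mul_assoc, ← pow_add]
  exact hC m

theorem summable_fcoeff (ha : 0 < a) (hf : SmoothPeriodic a f) :
    Summable fun m => ‖fcoeff a f m‖ := by
  simpa using summable_of_decay (p := 0) (fcoeff_decay ha 2 hf)

/-- Fourier inversion. -/
theorem hasSum_fcoeff (ha : 0 < a) (hf : SmoothPeriodic a f) (x : ℝ) :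
    HasSum (fun m => fcoeff a f m * wave a m x) (f x) := by
  have hT : 0 < 2 * π * a := by have := Real.pi_pos; positivity
  have : Fact (0 < 2 * π * a) := ⟨hT⟩
  have hper : Function.Periodic f (2 * π * a) := hf.periodic
  let F : C(AddCircle (2 * π * a), ℂ) :=
    ⟨hper.lift, hf.contDiff.continuous.quotient_lift _⟩
  have hw : ∀ (m : ℤ) (y : ℝ), fourier m (y : AddCircle (2 * π * a)) = wave a m y := by
    intro m y
    rw [fourier_coe_apply, wave]
    congr 1
    have h1 : (a : ℂ) ≠ 0 := by exact_mod_cast ha.ne'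
    have h2 : (π : ℂ) ≠ 0 := by exact_mod_cast Real.pi_ne_zero
    push_cast
    field_simp
  have hco : ∀ m, fourierCoeff F m = fcoeff a f m := by
    intro m
    rw [fourierCoeff_eq_intervalIntegral _ m 0, zero_add, fcoeff, Complex.real_smul]
    congr 1
    · push_cast
      rw [one_div]
    · refine intervalIntegral.integral_congr fun y _ => ?_
      rw [hw, smul_eq_mul]
      rfl
  have h := has_pointwise_sum_fourier_series_of_summable (f := F)
    (Summable.of_norm (by simpa only [hco] using summable_fcoeff ha hf)) (x : AddCircle (2 * π * a))
  simp only [hco, hw, smul_eq_mul] at h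
  exact h

theorem hasSum_fcoeff_of_hasSum {F : ℤ → ℝ → ℂ} {B : ℤ → ℝ} (hF : ∀ n, Continuous (F n))
    (hB : ∀ n x, ‖F n x‖ ≤ B n) (hs : Summable B) (hsum : ∀ x, HasSum (fun n => F n x) (f x))
    (m : ℤ) : HasSum (fun n => fcoeff a (F n) m) (fcoeff a f m) := by
  refine HasSum.mul_left _ ?_
  refine intervalIntegral.hasSum_integral_of_dominated_convergence (fun n _ => B n)
    (fun n => ((continuous_wave _).mul (hF n)).aestronglyMeasurable)
    (fun n => ae_of_all _ fun x _ => ?_) (ae_of_all _ fun x _ => hs) intervalIntegrable_const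
    (ae_of_all _ fun x _ => (hsum x).mul_left _)
  rw [norm_mul, norm_wave, one_mul]
  exact hB n x

/-- The Fourier coefficients of a product. -/
theorem hasSum_fcoeff_mul (ha : 0 < a) (hf : SmoothPeriodic a f) (hg : SmoothPeriodic a g) (m : ℤ) :
    HasSum (fun n => fcoeff a f (m - n) * fcoeff a g n) (fcoeff a (fun x => f x * g x) m) := by
  obtain ⟨B, hB⟩ := isCompact_Icc.exists_bound_of_continuousOn
    (hf.contDiff.continuous.continuousOn (s := Icc 0 (2 * π * a)))
  have hT : 0 < 2 * π * a := by have := Real.pi_pos; positivity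
  have hper : Function.Periodic f (2 * π * a) := hf.periodic
  have hB' : ∀ x, ‖f x‖ ≤ B := by
    intro x
    obtain ⟨y, hy, hxy⟩ := hper.exists_mem_Ico₀ hT x
    rw [hxy]
    exact hB y (Ico_subset_Icc_self hy)
  have h := hasSum_fcoeff_of_hasSum (a := a) (f := fun x => f x * g x)
    (F := fun n x => fcoeff a g n * (f x * wave a n x)) (B := fun n => ‖fcoeff a g n‖ * B)
    (fun n => continuous_const.mul (hf.contDiff.continuous.mul (continuous_wave n)))
    (fun n x => ?_) ((summable_fcoeff ha hg).mul_right B) (fun x => ?_) m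
  · refine h.congr_fun fun n => ?_
    rw [fcoeff_const_mul, fcoeff_mul_wave, mul_comm]
  · rw [norm_mul, norm_mul, norm_wave, mul_one]
    exact mul_le_mul_of_nonneg_left (hB' x) (norm_nonneg _)
  · refine ((hasSum_fcoeff ha hg x).mul_left (f x)).congr_fun fun n => ?_
    ring

/-- For n ≠ m, computing the coefficient of the derivative of the wave in two ways gives (n - m)
times the coefficient equal to 0. -/
theorem fcoeff_wave (ha : 0 < a) (m n : ℤ) : fcoeff a (wave a n) m = if n = m then 1 else 0 := by
  have hπ := Real.pi_pos
  split_ifs with h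
  · subst h
    rw [fcoeff]
    have h1 : ∀ x, wave a (-n) x * wave a n x = 1 := fun x => by
      rw [← wave_add, neg_add_cancel, wave_zero]
    simp only [h1, intervalIntegral.integral_const, sub_zero, Complex.real_smul, mul_one]
    push_cast
    have h2 : (a : ℂ) ≠ 0 := by exact_mod_cast ha.ne'
    have h3 : (π : ℂ) ≠ 0 := by exact_mod_cast hπ.ne'
    field_simp
  · have h1 := fcoeff_deriv ha (SmoothPeriodic.wave ha n) m
    have h2 : deriv (wave a n) = fun x => ((n / a : ℝ) * Complex.I) * wave a n x :=
      funext fun x => (hasDerivAt_wave n x).deriv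
    rw [h2, fcoeff_const_mul] at h1
    have h3 : ((n / a : ℝ) * Complex.I - (m / a : ℝ) * Complex.I) * fcoeff a (wave a n) m = 0 := by
      linear_combination h1
    refine (mul_eq_zero.1 h3).resolve_left ?_
    rw [← sub_mul, ← Complex.ofReal_sub, ← sub_div]
    refine mul_ne_zero (Complex.ofReal_ne_zero.2 (div_ne_zero ?_ ha.ne')) Complex.I_ne_zero
    rw [sub_ne_zero]
    exact_mod_cast h

/-- The function with prescribed Fourier coefficients. -/
def synth (a : ℝ) (c : ℤ → ℂ) (x : ℝ) : ℂ := ∑' m, c m * wave a m x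

variable {c : ℤ → ℂ}

theorem hasSum_synth (hc : Summable fun m => ‖c m‖) (x : ℝ) :
    HasSum (fun m => c m * wave a m x) (synth a c x) :=
  (Summable.of_norm (hc.congr fun m => by rw [norm_mul, norm_wave, mul_one])).hasSum

theorem hasDerivAt_synth (hc : ∀ p : ℕ, ∃ C : ℝ, ∀ m, ‖c m‖ * (1 + m.natAbs : ℝ) ^ p ≤ C) (x : ℝ) :
    HasDerivAt (synth a c) (synth a (fun m => c m * ((m / a : ℝ) * Complex.I)) x) x := by
  have hs : Summable fun m => ‖c m‖ := by simpa using summable_of_decay (p := 0) (hc 2)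
  have h1 := summable_of_decay (p := 1) (hc 3)
  have h := hasDerivAt_tsum (𝕜 := ℝ) (g := fun m x => c m * wave a m x)
    (g' := fun m x => c m * ((m / a : ℝ) * Complex.I * wave a m x))
    (u := fun m => ‖c m‖ * (1 + m.natAbs : ℝ) ^ 1 * |a|⁻¹) (h1.mul_right _)
    (fun m y => (hasDerivAt_wave m y).const_mul (c m)) (fun m y => ?_)
    (hasSum_synth (a := a) hs 0).summable x
  · convert! h using 1
    exact tsum_congr fun m => by ring
  · have h2 : |(m : ℝ)| = m.natAbs := by rw [Nat.cast_natAbs, Int.cast_abs]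
    rw [norm_mul, norm_mul, norm_mul, norm_wave, Complex.norm_I, mul_one, mul_one,
      Complex.norm_real, Real.norm_eq_abs, abs_div, h2, pow_one, mul_assoc, div_eq_mul_inv]
    gcongr
    linarith

theorem decay_mul (hc : ∀ p : ℕ, ∃ C : ℝ, ∀ m, ‖c m‖ * (1 + m.natAbs : ℝ) ^ p ≤ C) (p : ℕ) :
    ∃ C : ℝ, ∀ m : ℤ, ‖c m * ((m / a : ℝ) * Complex.I)‖ * (1 + m.natAbs : ℝ) ^ p ≤ C := by
  obtain ⟨C, hC⟩ := hc (p + 1)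
  refine ⟨C * |a|⁻¹, fun m => ?_⟩
  have h2 : |(m : ℝ)| = m.natAbs := by rw [Nat.cast_natAbs, Int.cast_abs]
  rw [norm_mul, norm_mul, Complex.norm_I, mul_one, Complex.norm_real, Real.norm_eq_abs, abs_div, h2]
  calc ‖c m‖ * (m.natAbs / |a|) * (1 + m.natAbs : ℝ) ^ p
      ≤ ‖c m‖ * ((1 + m.natAbs) / |a|) * (1 + m.natAbs : ℝ) ^ p := by
        gcongr
        linarith
    _ = ‖c m‖ * (1 + m.natAbs : ℝ) ^ (p + 1) * |a|⁻¹ := by ring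
    _ ≤ _ := mul_le_mul_of_nonneg_right (hC m) (by positivity)

theorem contDiff_synth (k : ℕ) : ∀ {c : ℤ → ℂ},
    (∀ p : ℕ, ∃ C : ℝ, ∀ m, ‖c m‖ * (1 + m.natAbs : ℝ) ^ p ≤ C) → ContDiff ℝ k (synth a c) := by
  induction k with
  | zero =>
    intro c hc
    exact contDiff_zero.2 (continuous_iff_continuousAt.2 fun x => (hasDerivAt_synth hc x).continuousAt)
  | succ k ih =>
    intro c hc
    have h1 : deriv (synth a c) = synth a fun m => c m * ((m / a : ℝ) * Complex.I) :=
      funext fun x => (hasDerivAt_synth hc x).deriv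
    push_cast
    rw [contDiff_succ_iff_deriv, h1]
    exact ⟨fun x => (hasDerivAt_synth hc x).differentiableAt, by simp, ih (decay_mul hc)⟩

theorem smoothPeriodic_synth (ha : 0 < a)
    (hc : ∀ p : ℕ, ∃ C : ℝ, ∀ m, ‖c m‖ * (1 + m.natAbs : ℝ) ^ p ≤ C) :
    SmoothPeriodic a (synth a c) :=
  ⟨contDiff_infty.2 fun k => contDiff_synth k hc, fun x => by simp only [synth, wave_periodic ha]⟩

theorem fcoeff_synth (ha : 0 < a)
    (hc : ∀ p : ℕ, ∃ C : ℝ, ∀ m, ‖c m‖ * (1 + m.natAbs : ℝ) ^ p ≤ C) (m : ℤ) :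
    fcoeff a (synth a c) m = c m := by
  have hs : Summable fun m => ‖c m‖ := by simpa using summable_of_decay (p := 0) (hc 2)
  have h := hasSum_fcoeff_of_hasSum (a := a) (F := fun n x => c n * wave a n x)
    (fun n => continuous_const.mul (continuous_wave n))
    (fun n x => by rw [norm_mul, norm_wave, mul_one]) hs (hasSum_synth (a := a) hs) m
  simp only [fcoeff_const_mul, fcoeff_wave ha, mul_ite, mul_one, mul_zero] at h
  exact h.unique (hasSum_ite_eq m (c m) |>.congr_fun fun n => by split_ifs with h <;> simp [h])

end

end

/-! ### A frame in which sections become periodic -/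

section

variable {N : ℕ} {a : ℝ} {W : Matrix.unitaryGroup (Fin N) ℂ}

/-- A diagonalisation of the gluing matrix. -/
structure Frame (a : ℝ) (W : Matrix.unitaryGroup (Fin N) ℂ) where
  B : Matrix (Fin N) (Fin N) ℂ
  β : Fin N → ℝ
  mul_conj : B * Bᴴ = 1
  conj_mul : Bᴴ * B = 1
  diag : B * (W : Matrix (Fin N) (Fin N) ℂ) =
    Matrix.diagonal (fun j => Complex.exp ((β j * (2 * π * a) : ℝ) * Complex.I)) * B

/-- The unit circle is infinite and the characteristic polynomial has finitely many roots. -/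
theorem exists_phase (W : Matrix (Fin N) (Fin N) ℂ) :
    ∃ z : ℂ, ‖z‖ = 1 ∧ IsUnit (z • (1 : Matrix (Fin N) (Fin N) ℂ) - W) := by
  by_contra! h
  have hinf : (range ((↑) : Circle → ℂ)).Infinite := by
    have hC : Infinite Circle := by
      have h1 : (Ioc (-π) π).Infinite := Set.Ioc_infinite (by linarith [Real.pi_pos])
      have := h1.to_subtype
      exact Infinite.of_injective _ Circle.argEquiv.symm.injective
    exact @Set.infinite_range_of_injective Circle ℂ hC _ Circle.coe_injective
  refine W.charpoly_monic.ne_zero (Polynomial.eq_zero_of_infinite_isRoot _ (hinf.mono ?_))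
  rintro _ ⟨z, rfl⟩
  have h1 := h z (Circle.norm_coe z)
  rw [Matrix.isUnit_iff_isUnit_det, isUnit_iff_ne_zero, not_not] at h1
  change Polynomial.eval _ _ = 0
  rw [Matrix.eval_charpoly, ← h1, Matrix.scalar_apply, Matrix.smul_one_eq_diagonal]

/-- Cayley transform: for a unit z that is not an eigenvalue of W, the matrix i(z - W)⁻¹(z + W) is
Hermitian, so it has a unitary eigenbasis. That basis also diagonalises W, with eigenvalues z(h -
i)/(h + i) of modulus 1, whose arguments give β. -/
theorem exists_frame (ha : 0 < a) (W : Matrix.unitaryGroup (Fin N) ℂ) : Nonempty (Frame a W) := by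
  obtain ⟨z, hz, hu⟩ := exists_phase (W : Matrix (Fin N) (Fin N) ℂ)
  set w := (W : Matrix (Fin N) (Fin N) ℂ)
  have hw : w * wᴴ = 1 := Matrix.mem_unitaryGroup_iff.1 W.2
  have hzz : star z * z = 1 := by
    rw [mul_comm, RCLike.star_def, Complex.mul_conj, Complex.normSq_eq_norm_sq, hz]; simp
  set X : Matrix (Fin N) (Fin N) ℂ := z • 1 + w
  set Y : Matrix (Fin N) (Fin N) ℂ := z • 1 - w
  have hY1 : Y * Y⁻¹ = 1 := Matrix.mul_nonsing_inv _ ((Matrix.isUnit_iff_isUnit_det _).1 hu)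
  have hY2 : Y⁻¹ * Y = 1 := Matrix.nonsing_inv_mul _ ((Matrix.isUnit_iff_isUnit_det _).1 hu)
  have hXY : -(Y * Xᴴ) = X * Yᴴ := by
    simp only [X, Y, Matrix.conjTranspose_add, Matrix.conjTranspose_sub, Matrix.conjTranspose_smul,
      Matrix.conjTranspose_one, mul_add, sub_mul, mul_sub, add_mul, smul_mul_assoc, mul_smul_comm,
      one_mul, mul_one, hw, smul_add, smul_sub, smul_smul, hzz, one_smul]
    abel
  have hH : (Complex.I • (Y⁻¹ * X)).IsHermitian := by
    have h1 : -(Xᴴ * (Y⁻¹)ᴴ) = Y⁻¹ * X := by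
      have h2 : Yᴴ * (Y⁻¹)ᴴ = 1 := by
        rw [← Matrix.conjTranspose_mul, hY2, Matrix.conjTranspose_one]
      calc -(Xᴴ * (Y⁻¹)ᴴ) = Y⁻¹ * -(Y * Xᴴ) * (Y⁻¹)ᴴ := by
            rw [mul_neg, ← mul_assoc, hY2, one_mul, neg_mul]
        _ = Y⁻¹ * X * (Yᴴ * (Y⁻¹)ᴴ) := by rw [hXY]; simp only [mul_assoc]
        _ = Y⁻¹ * X := by rw [h2, mul_one]
    rw [Matrix.IsHermitian, Matrix.conjTranspose_smul, Matrix.conjTranspose_mul, ← h1]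
    simp
  set U := (hH.eigenvectorUnitary : Matrix (Fin N) (Fin N) ℂ)
  have hU1 : U * Uᴴ = 1 := Matrix.mem_unitaryGroup_iff.1 hH.eigenvectorUnitary.2
  have hU2 : Uᴴ * U = 1 := Matrix.mem_unitaryGroup_iff'.1 hH.eigenvectorUnitary.2
  have hspec : Complex.I • (X * U) = Y * U * Matrix.diagonal (fun j => (hH.eigenvalues j : ℂ)) := by
    have h1 : (Complex.I • (Y⁻¹ * X)) * U =
        U * Matrix.diagonal (fun j => (hH.eigenvalues j : ℂ)) := by
      ext i j
      rw [Matrix.mul_diagonal]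
      have h2 := congrFun (hH.mulVec_eigenvectorBasis j) i
      simp only [Pi.smul_apply, Complex.real_smul] at h2
      rw [mul_comm]
      exact h2
    rw [mul_assoc, ← h1, smul_mul_assoc, mul_smul_comm, ← mul_assoc, ← mul_assoc, hY1, one_mul]
  set om : Fin N → ℂ := fun j =>
    z * ((hH.eigenvalues j : ℂ) - Complex.I) / ((hH.eigenvalues j : ℂ) + Complex.I)
  have hne : ∀ j, (hH.eigenvalues j : ℂ) + Complex.I ≠ 0 := fun j h => by
    have := congrArg Complex.im h
    simp at this
  have hWU : w * U = U * Matrix.diagonal om := by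
    ext i j
    have h1 := congrFun (congrFun hspec i) j
    rw [Matrix.mul_diagonal] at h1
    simp only [X, Y, add_mul, sub_mul, smul_mul_assoc, one_mul, Matrix.smul_apply, Matrix.add_apply,
      Matrix.sub_apply, smul_eq_mul] at h1
    rw [Matrix.mul_diagonal, ← mul_div_assoc, eq_div_iff (hne j)]
    linear_combination h1
  have hom : ∀ j, ‖om j‖ = 1 := by
    intro j
    have h1 : ‖(hH.eigenvalues j : ℂ) - Complex.I‖ = ‖(hH.eigenvalues j : ℂ) + Complex.I‖ := by
      rw [← RCLike.norm_conj]
      simp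
    rw [norm_div, norm_mul, hz, one_mul, h1, div_self (norm_ne_zero_iff.2 (hne j))]
  refine ⟨⟨Uᴴ, fun j => Complex.arg (om j) / (2 * π * a), ?_, ?_, ?_⟩⟩
  · rw [Matrix.conjTranspose_conjTranspose, hU2]
  · rw [Matrix.conjTranspose_conjTranspose, hU1]
  · have h1 : ∀ j, Complex.exp ((Complex.arg (om j) / (2 * π * a) * (2 * π * a) : ℝ) * Complex.I) =
        om j := by
      intro j
      have hT : 2 * π * a ≠ 0 := by have := Real.pi_pos; positivity
      rw [div_mul_cancel₀ _ hT]
      have := Complex.norm_mul_exp_arg_mul_I (om j)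
      rwa [hom, Complex.ofReal_one, one_mul] at this
    simp only [h1]
    calc Uᴴ * w = Uᴴ * (w * U) * Uᴴ := by rw [mul_assoc, mul_assoc, hU1, mul_one]
      _ = Matrix.diagonal om * Uᴴ := by rw [hWU, ← mul_assoc, hU2, one_mul]

namespace Frame

/-- The phase factors of a frame. -/
def phase (F : Frame a W) (j : Fin N) (x : ℝ) : ℂ := Complex.exp ((F.β j * x : ℝ) * Complex.I)

variable (F : Frame a W)

theorem phase_ne_zero (j : Fin N) (x : ℝ) : F.phase j x ≠ 0 := Complex.exp_ne_zero _

theorem conj_phase (j : Fin N) (x : ℝ) : starRingEnd ℂ (F.phase j x) = (F.phase j x)⁻¹ := by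
  rw [phase, ← Complex.exp_conj, ← Complex.exp_neg]
  simp

theorem contDiff_phase (j : Fin N) : ContDiff ℝ ∞ (F.phase j) := by
  unfold phase
  exact ((Complex.ofRealCLM.contDiff.comp (contDiff_const.mul contDiff_id)).mul
    contDiff_const).cexp

theorem hasDerivAt_phase (j : Fin N) (x : ℝ) :
    HasDerivAt (F.phase j) (F.β j * Complex.I * F.phase j x) x := by
  have h : HasDerivAt (fun x : ℝ => ((F.β j * x : ℝ) : ℂ) * Complex.I) (F.β j * Complex.I) x := by
    have h1 := ((hasDerivAt_id x).const_mul (F.β j)).ofReal_comp.mul_const Complex.I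
    simpa using h1
  have h2 := h.cexp
  rw [mul_comm] at h2
  exact h2

theorem phase_add (j : Fin N) (x : ℝ) :
    F.phase j (x + 2 * π * a) = F.phase j (2 * π * a) * F.phase j x := by
  rw [phase, phase, phase, ← Complex.exp_add]
  congr 1
  push_cast
  ring

theorem mulVec_glue (v : Fin N → ℂ) (j : Fin N) :
    (F.B *ᵥ ((W : Matrix (Fin N) (Fin N) ℂ) *ᵥ v)) j = F.phase j (2 * π * a) * (F.B *ᵥ v) j := by
  rw [Matrix.mulVec_mulVec, F.diag, ← Matrix.mulVec_mulVec, Matrix.mulVec_diagonal]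
  rfl

/-- The components of a section in a frame which makes them periodic. -/
def gauge (u : ℝ → Fin N → ℂ) (j : Fin N) (x : ℝ) : ℂ := (F.phase j x)⁻¹ * (F.B *ᵥ u x) j

/-- The section with given components. -/
def ungauge (g : Fin N → ℝ → ℂ) (x : ℝ) : Fin N → ℂ := F.Bᴴ *ᵥ fun j => F.phase j x * g j x

theorem contDiff_mulVec (A : Matrix (Fin N) (Fin N) ℂ) {u : ℝ → Fin N → ℂ} (hu : ContDiff ℝ ∞ u)
    (j : Fin N) : ContDiff ℝ ∞ fun x => (A *ᵥ u x) j := by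
  rw [contDiff_pi] at hu
  simp only [Matrix.mulVec, dotProduct]
  exact ContDiff.sum fun k _ => contDiff_const.mul (hu k)

theorem smoothPeriodic_gauge {u : ℝ → Fin N → ℂ} (hu : u ∈ smoothSections a W) (j : Fin N) :
    SmoothPeriodic a (F.gauge u j) := by
  refine ⟨((F.contDiff_phase j).inv fun x => F.phase_ne_zero j x).mul
    (contDiff_mulVec _ hu.1 j), fun x => ?_⟩
  rw [gauge, gauge, hu.2, mulVec_glue, phase_add, mul_inv]
  have := F.phase_ne_zero j (2 * π * a)
  field_simp

theorem ungauge_gauge (u : ℝ → Fin N → ℂ) : F.ungauge (F.gauge u) = u := by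
  funext x
  have h : (fun j => F.phase j x * F.gauge u j x) = F.B *ᵥ u x := funext fun j => by
    rw [gauge, mul_inv_cancel_left₀ (F.phase_ne_zero j x)]
  rw [ungauge, h, Matrix.mulVec_mulVec, F.conj_mul, Matrix.one_mulVec]

theorem gauge_ungauge (g : Fin N → ℝ → ℂ) : F.gauge (F.ungauge g) = g := by
  funext j x
  rw [gauge, ungauge, Matrix.mulVec_mulVec, F.mul_conj, Matrix.one_mulVec,
    inv_mul_cancel_left₀ (F.phase_ne_zero j x)]

theorem ungauge_mem {g : Fin N → ℝ → ℂ} (hg : ∀ j, SmoothPeriodic a (g j)) :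
    F.ungauge g ∈ smoothSections a W := by
  refine ⟨?_, fun x => ?_⟩
  · rw [contDiff_pi]
    exact fun k => contDiff_mulVec _
      (contDiff_pi.2 fun j => (F.contDiff_phase j).mul (hg j).contDiff) k
  · have h1 : F.B *ᵥ F.ungauge g (x + 2 * π * a) =
        F.B *ᵥ ((W : Matrix (Fin N) (Fin N) ℂ) *ᵥ F.ungauge g x) := by
      funext j
      rw [mulVec_glue, ungauge, ungauge, Matrix.mulVec_mulVec, Matrix.mulVec_mulVec, F.mul_conj,
        Matrix.one_mulVec, Matrix.one_mulVec, phase_add, (hg j).periodic, mul_assoc]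
    have h2 := congrArg (fun v => F.Bᴴ *ᵥ v) h1
    simp only [Matrix.mulVec_mulVec _ F.Bᴴ, F.conj_mul, Matrix.one_mulVec] at h2
    exact h2

/-- The phase turns ∂ into ∂ + iβ j on the j-th component, so the frequencies become m/a + β j. -/
theorem gauge_deriv {u : ℝ → Fin N → ℂ} (hu : u ∈ smoothSections a W) (j : Fin N) :
    F.gauge (deriv u) j = fun x => deriv (F.gauge u j) x + F.β j * Complex.I * F.gauge u j x := by
  funext x
  have h1 : HasDerivAt u (deriv u x) x :=
    ((contDiff_infty_iff_deriv.1 hu.1).1 x).hasDerivAt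
  rw [hasDerivAt_pi] at h1
  have h2 : HasDerivAt (fun x => (F.B *ᵥ u x) j) ((F.B *ᵥ deriv u x) j) x := by
    simp only [Matrix.mulVec, dotProduct]
    exact HasDerivAt.fun_sum fun k _ => (h1 k).const_mul _
  have h3 : HasDerivAt (fun x => F.phase j x * F.gauge u j x)
      (F.β j * Complex.I * F.phase j x * F.gauge u j x + F.phase j x * deriv (F.gauge u j) x) x :=
    (F.hasDerivAt_phase j x).mul ((F.smoothPeriodic_gauge hu j).differentiable x).hasDerivAt
  have h4 : (fun x => F.phase j x * F.gauge u j x) = fun x => (F.B *ᵥ u x) j := funext fun y => by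
    rw [gauge, mul_inv_cancel_left₀ (F.phase_ne_zero j y)]
  rw [h4] at h3
  rw [gauge, h2.unique h3]
  have := F.phase_ne_zero j x
  field_simp
  ring

/-- The components of an endomorphism. -/
def gaugePot (Q : Potential a W) (j k : Fin N) (x : ℝ) : ℂ :=
  (F.phase j x)⁻¹ * (F.B * Q.toFun x * F.Bᴴ) j k * F.phase k x

theorem gauge_mulVec (Q : Potential a W) (u : ℝ → Fin N → ℂ) (j : Fin N) :
    F.gauge (fun x => Q.toFun x *ᵥ u x) j = fun x => ∑ k, F.gaugePot Q j k x * F.gauge u k x := by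
  funext x
  have h : F.B *ᵥ (Q.toFun x *ᵥ u x) = (F.B * Q.toFun x * F.Bᴴ) *ᵥ (F.B *ᵥ u x) := by
    rw [Matrix.mulVec_mulVec, Matrix.mulVec_mulVec, mul_assoc _ F.Bᴴ, F.conj_mul, mul_one]
  rw [gauge, h, Matrix.mulVec, dotProduct, Finset.mul_sum]
  refine Finset.sum_congr rfl fun k _ => ?_
  rw [gaugePot, gauge]
  have := F.phase_ne_zero k x
  field_simp

theorem conj_gaugePot (Q : Potential a W) (j k : Fin N) (x : ℝ) :
    starRingEnd ℂ (F.gaugePot Q j k x) = F.gaugePot Q k j x := by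
  have h : (F.B * Q.toFun x * F.Bᴴ).IsHermitian := by
    rw [Matrix.IsHermitian, Matrix.conjTranspose_mul, Matrix.conjTranspose_mul,
      Matrix.conjTranspose_conjTranspose, (Q.hermitian x).eq, mul_assoc]
  rw [gaugePot, gaugePot, map_mul, map_mul, map_inv₀, conj_phase, conj_phase, inv_inv, ← h.apply k j,
    RCLike.star_def]
  ring

/-- Equivariance reads Q(x + 2πa) = W Q(x) W*; in the diagonalising frame the two unitary factors
become phases that cancel those of the gauge. -/
theorem smoothPeriodic_gaugePot (Q : Potential a W) (j k : Fin N) :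
    SmoothPeriodic a (F.gaugePot Q j k) := by
  refine ⟨(((F.contDiff_phase j).inv fun x => F.phase_ne_zero j x).mul ?_).mul
    (F.contDiff_phase k), fun x => ?_⟩
  · simp only [Matrix.mul_apply]
    exact ContDiff.sum fun l _ => (ContDiff.sum fun m _ =>
      contDiff_const.mul (Q.smooth m l)).mul contDiff_const
  · have hW : (W : Matrix (Fin N) (Fin N) ℂ) * (W : Matrix (Fin N) (Fin N) ℂ)ᴴ = 1 :=
      Matrix.mem_unitaryGroup_iff.1 W.2
    have hQ : Q.toFun (x + 2 * π * a) = (W : Matrix (Fin N) (Fin N) ℂ) * Q.toFun x *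
        (W : Matrix (Fin N) (Fin N) ℂ)ᴴ := by
      rw [← Q.equivariant, Matrix.mul_assoc, hW, Matrix.mul_one]
    have hB : F.B * Q.toFun (x + 2 * π * a) * F.Bᴴ =
        Matrix.diagonal (fun j => F.phase j (2 * π * a)) * (F.B * Q.toFun x * F.Bᴴ) *
          (Matrix.diagonal (fun j => F.phase j (2 * π * a)))ᴴ := by
      have hd : F.B * (W : Matrix (Fin N) (Fin N) ℂ) =
        Matrix.diagonal (fun j => F.phase j (2 * π * a)) * F.B := F.diag
      have hd' := congrArg Matrix.conjTranspose hd
      rw [Matrix.conjTranspose_mul, Matrix.conjTranspose_mul] at hd'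
      calc _ = (F.B * (W : Matrix (Fin N) (Fin N) ℂ)) * Q.toFun x *
            ((W : Matrix (Fin N) (Fin N) ℂ)ᴴ * F.Bᴴ) := by rw [hQ]; simp only [mul_assoc]
        _ = _ := by rw [hd, hd']; simp only [mul_assoc]
    rw [gaugePot, hB, Matrix.diagonal_conjTranspose, Matrix.mul_diagonal, Matrix.diagonal_mul,
      phase_add, phase_add, gaugePot, Pi.star_apply, RCLike.star_def, conj_phase]
    have h1 := F.phase_ne_zero j (2 * π * a)
    have h2 := F.phase_ne_zero k (2 * π * a)
    have h3 := F.phase_ne_zero j x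
    field_simp

end Frame

end

/-! ### Identification of the eigenspaces and conclusion -/

section

variable {N : ℕ} {a : ℝ} {W : Matrix.unitaryGroup (Fin N) ℂ}

theorem conj_fcoeff (f : ℝ → ℂ) (m : ℤ) :
    starRingEnd ℂ (fcoeff a f m) = fcoeff a (fun x => starRingEnd ℂ (f x)) (-m) := by
  rw [fcoeff, fcoeff, map_mul, ← intervalIntegral.intervalIntegral_conj]
  congr 1
  · simp [Complex.conj_ofNat]
  · refine intervalIntegral.integral_congr fun x _ => ?_
    rw [map_mul, wave, wave, ← Complex.exp_conj]
    simp [neg_div]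

namespace Frame

variable (F : Frame a W)

/-- The Fourier data of a Laplace type operator. -/
def fourierData (ha : 0 < a) (Q : Potential a W) : FourierData N where
  om := 1 / a
  om_pos := by positivity
  β := F.β
  q j k m := fcoeff a (F.gaugePot Q j k) m
  herm j k m := by
    rw [conj_fcoeff]
    simp only [F.conj_gaugePot]
  decay p := by
    choose C hC using fun j k => fcoeff_decay ha p (F.smoothPeriodic_gaugePot Q j k)
    have hC0 : ∀ j k, 0 ≤ C j k := fun j k => (by positivity : (0 : ℝ) ≤ _).trans (hC j k 0)
    refine ⟨∑ j, ∑ k, C j k, fun j k m => (hC j k m).trans ?_⟩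
    refine le_trans ?_ (Finset.single_le_sum (f := fun j => ∑ k, C j k)
      (fun j _ => Finset.sum_nonneg fun k _ => hC0 j k) (Finset.mem_univ j))
    exact Finset.single_le_sum (f := fun k => C j k) (fun k _ => hC0 j k) (Finset.mem_univ k)

/-- The Fourier coefficients of a section. -/
def coef (u : ℝ → Fin N → ℂ) (i : ℤ × Fin N) : ℂ := fcoeff a (F.gauge u i.2) i.1

variable {u v : ℝ → Fin N → ℂ}

theorem coef_add (hu : u ∈ smoothSections a W) (hv : v ∈ smoothSections a W) :
    F.coef (u + v) = F.coef u + F.coef v := by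
  funext i
  rw [Pi.add_apply, coef, coef, coef, ← fcoeff_add
    (F.smoothPeriodic_gauge hu _).contDiff.continuous
    (F.smoothPeriodic_gauge hv _).contDiff.continuous]
  congr 1
  funext x
  rw [gauge, Pi.add_apply, Matrix.mulVec_add, Pi.add_apply, mul_add]
  rfl

theorem coef_smul (c : ℂ) : F.coef (c • u) = c • F.coef u := by
  funext i
  rw [Pi.smul_apply, smul_eq_mul, coef, coef, ← fcoeff_const_mul]
  congr 1
  funext x
  rw [gauge, Pi.smul_apply, Matrix.mulVec_smul, Pi.smul_apply, smul_eq_mul, mul_left_comm]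
  rfl

/-- The Fourier coefficients as a linear map. -/
def coefL : smoothSections a W →ₗ[ℂ] (ℤ × Fin N → ℂ) where
  toFun u := F.coef u
  map_add' u v := F.coef_add u.2 v.2
  map_smul' c _ := F.coef_smul c

theorem rapidDecay_coef (ha : 0 < a) (hu : u ∈ smoothSections a W) : RapidDecay (F.coef u) := by
  intro p
  choose C hC using fun j => fcoeff_decay ha p (F.smoothPeriodic_gauge hu j)
  have hC0 : ∀ j, 0 ≤ C j := fun j => (by positivity : (0 : ℝ) ≤ _).trans (hC j 0)
  exact ⟨∑ j, C j, fun i => (hC i.2 i.1).trans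
    (Finset.single_le_sum (f := C) (fun j _ => hC0 j) (Finset.mem_univ i.2))⟩

theorem coef_injective (ha : 0 < a) : Function.Injective F.coefL := by
  intro u v h
  have h1 : F.gauge u.1 = F.gauge v.1 := by
    funext j x
    have h2 := hasSum_fcoeff ha (F.smoothPeriodic_gauge u.2 j) x
    have h3 := hasSum_fcoeff ha (F.smoothPeriodic_gauge v.2 j) x
    have h4 : ∀ m, fcoeff a (F.gauge u.1 j) m = fcoeff a (F.gauge v.1 j) m := fun m =>
      congrFun h (m, j)
    simp only [h4] at h2
    exact h2.unique h3
  exact Subtype.ext (by rw [← F.ungauge_gauge u.1, h1, F.ungauge_gauge])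

theorem exists_coef_eq (ha : 0 < a) {f : ℤ × Fin N → ℂ} (hf : RapidDecay f) :
    ∃ u : smoothSections a W, F.coefL u = f := by
  have hd : ∀ (j : Fin N) (p : ℕ), ∃ C : ℝ, ∀ m : ℤ, ‖f (m, j)‖ * (1 + m.natAbs : ℝ) ^ p ≤ C := by
    intro j p
    obtain ⟨C, hC⟩ := hf p
    exact ⟨C, fun m => hC (m, j)⟩
  refine ⟨⟨F.ungauge fun j => synth a fun m => f (m, j),
    F.ungauge_mem fun j => smoothPeriodic_synth ha (hd j)⟩, ?_⟩
  funext ⟨m, j⟩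
  change fcoeff a (F.gauge (F.ungauge _) j) m = _
  rw [gauge_ungauge, fcoeff_synth ha (hd j)]

theorem coef_deriv (ha : 0 < a) (Q : Potential a W) (hu : u ∈ smoothSections a W) (i : ℤ × Fin N) :
    F.coef (deriv u) i = ((F.fourierData ha Q).freq i : ℂ) * Complex.I * F.coef u i := by
  have hg := F.smoothPeriodic_gauge hu i.2
  have hc : Continuous fun x => (F.β i.2 : ℂ) * Complex.I * F.gauge u i.2 x :=
    continuous_const.mul hg.contDiff.continuous
  rw [coef, F.gauge_deriv hu, fcoeff_add hg.deriv.contDiff.continuous hc, fcoeff_const_mul, fcoeff_deriv ha hg, coef,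
    FourierData.freq, fourierData]
  push_cast
  ring

theorem coef_mulVec (ha : 0 < a) (Q : Potential a W) (hu : u ∈ smoothSections a W)
    (i : ℤ × Fin N) : F.coef (fun x => Q.toFun x *ᵥ u x) i =
      ∑' j, (F.fourierData ha Q).mat i j * F.coef u j := by
  have hg := F.smoothPeriodic_gauge hu
  obtain ⟨C, hC⟩ := (F.rapidDecay_coef ha hu).bounded
  rw [coef, F.gauge_mulVec, fcoeff_sum _ fun k _ =>
    ((F.smoothPeriodic_gaugePot Q i.2 k).mul (hg k)).contDiff.continuous,
    ((F.fourierData ha Q).summable_mat_mul hC i).tsum_prod]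
  have h := hasSum_sum (s := Finset.univ) fun k _ =>
    hasSum_fcoeff_mul ha (F.smoothPeriodic_gaugePot Q i.2 k) (hg k) i.1
  rw [← h.tsum_eq]
  refine tsum_congr fun n => ?_
  rw [tsum_fintype]
  rfl

theorem coef_laplaceOp (ha : 0 < a) (Q : Potential a W) (u : smoothSections a W) (i : ℤ × Fin N) :
    F.coefL (laplaceOp Q u) i = (((F.fourierData ha Q).freq i ^ 2 : ℝ) : ℂ) * F.coefL u i +
      ∑' j, (F.fourierData ha Q).mat i j * F.coefL u j := by
  have h1 := deriv_mem u.2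
  have h2 := deriv_mem h1
  have h3 : ((laplaceOp Q u : smoothSections a W) : ℝ → Fin N → ℂ) =
      (-1 : ℂ) • deriv (deriv u.1) + fun x => Q.toFun x *ᵥ u.1 x := by
    funext x
    simp [laplaceOp]
  change F.coef _ i = _ * F.coef u.1 i + ∑' j, _ * F.coef u.1 j
  rw [h3, F.coef_add ((smoothSections a W).smul_mem _ h2) (mulVec_mem Q u.2), Pi.add_apply,
    F.coef_smul, Pi.smul_apply, F.coef_deriv ha Q h1, F.coef_deriv ha Q u.2,
    F.coef_mulVec ha Q u.2]
  congr 1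
  push_cast
  rw [smul_eq_mul]
  linear_combination -((F.fourierData ha Q).freq i : ℂ) ^ 2 * F.coef u.1 i * Complex.I_sq

/-- Coefficients determine the section, and those of a smooth section decay rapidly, so only the
eigenvalue equation has to be compared. -/
theorem mem_eigenspace_iff (ha : 0 < a) (Q : Potential a W) (μ : ℝ) (u : smoothSections a W) :
    u ∈ Module.End.eigenspace (laplaceOp Q) (μ : ℂ) ↔
      F.coefL u ∈ (F.fourierData ha Q).eigenSpace μ := by
  rw [Module.End.mem_eigenspace_iff, ← (F.coef_injective ha).eq_iff, map_smul, funext_iff]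
  simp only [F.coef_laplaceOp ha Q]
  exact ⟨fun h => ⟨F.rapidDecay_coef ha u.2, h⟩, fun h => h.2⟩

/-- Rapidly decreasing coefficients always come from a smooth section, so multiplicities may be
counted in Fourier space. -/
theorem finrank_eigenspace (ha : 0 < a) (Q : Potential a W) (μ : ℝ) :
    Module.finrank ℂ ((F.fourierData ha Q).eigenSpace μ) =
      Module.finrank ℂ (Module.End.eigenspace (laplaceOp Q) (μ : ℂ)) := by
  refine (LinearEquiv.finrank_eq (LinearEquiv.ofBijective
    (F.coefL.restrict fun u hu => (F.mem_eigenspace_iff ha Q μ u).1 hu) ⟨?_, ?_⟩)).symm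
  · intro u v h
    exact Subtype.ext (F.coef_injective ha (congrArg Subtype.val h))
  · rintro ⟨f, hf⟩
    obtain ⟨u, hu⟩ := F.exists_coef_eq ha hf.1
    refine ⟨⟨u, (F.mem_eigenspace_iff ha Q μ u).2 (hu ▸ hf)⟩, Subtype.ext hu⟩

end Frame

/-- The heat trace converges, and `Ω` has a Taylor expansion at `t = 0`. -/
theorem polyApprox_Omega (ha : 0 < a) (Q : Potential a W) :
    (∀ t : ℝ, 0 < t → Summable fun n : EigenIndex Q => Real.exp (-t * eigenvalue Q n)) ∧
      PolyApprox fun t => (Omega Q t : ℂ) := by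
  obtain ⟨F⟩ := exists_frame ha W
  obtain ⟨φ, hφ⟩ := (F.fourierData ha Q).exists_isEigenbasis
  let e : EigenIndex Q ≃ Σ μ : ℝ, Fin (Module.finrank ℂ ((F.fourierData ha Q).eigenSpace μ)) :=
    Equiv.sigmaCongrRight fun μ => finCongr (F.finrank_eigenspace ha Q μ).symm
  have he : ∀ n, (e n).1 = eigenvalue Q n := fun _ => rfl
  obtain ⟨h1, h2⟩ := hφ.heatTrace_expansion
  refine ⟨fun t ht => e.summable_iff.2 (h1 t ht), h2.congr fun t _ => ?_⟩
  rw [← e.tsum_eq]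
  rfl

/-- An index over μ exists only when the eigenspace has positive dimension. -/
theorem lt_eigenvalue (Q : Potential a W) {lam : ℂ}
    (hlam : ∀ μ : ℝ, (laplaceOp Q).HasEigenvalue (μ : ℂ) → lam.re < μ) (n : EigenIndex Q) :
    lam.re < eigenvalue Q n := by
  refine hlam _ fun h => ?_
  have h1 : Module.finrank ℂ (Module.End.eigenspace (laplaceOp Q) ((n.1 : ℝ) : ℂ)) = 0 := by
    change Module.finrank ℂ (Module.End.eigenspace (laplaceOp Q) ((eigenvalue Q n : ℝ) : ℂ)) = 0
    have h' : Module.End.eigenspace (laplaceOp Q) ((eigenvalue Q n : ℝ) : ℂ) = ⊥ := h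
    rw [h', finrank_bot]
  exact (Fin.cast h1 n.2).elim0

end

end CircleLaplace

end

theorem mainTheorem4 {N : ℕ} {a : ℝ} (ha : 0 < a) (W : Matrix.unitaryGroup (Fin N) ℂ)
    (Q : CircleLaplace.Potential a W) (lam : ℂ)
    (hlam : ∀ μ : ℝ, (CircleLaplace.laplaceOp Q).HasEigenvalue (μ : ℂ) → lam.re < μ) :
    (∀ t : ℝ, 0 < t → Summable
      (fun n : CircleLaplace.EigenIndex Q => Real.exp (-t * CircleLaplace.eigenvalue Q n))) ∧
    (∃! B : ℂ → ℂ, CircleLaplace.IsModifiedMellin Q lam B) ∧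
    (∃! Z : ℂ → ℂ, CircleLaplace.IsZeta Q lam Z) ∧
    ∀ B Z : ℂ → ℂ, CircleLaplace.IsModifiedMellin Q lam B → CircleLaplace.IsZeta Q lam Z →
      (∀ s : ℂ, 1 / 2 < s.re →
        HasSum (fun n : CircleLaplace.EigenIndex Q =>
          ((CircleLaplace.eigenvalue Q n : ℂ) - lam) ^ (-s)) (Z s)) ∧
      (∀ s : ℂ, (∀ k : ℕ, s ≠ 1 / 2 - (k : ℂ)) →
        Z s = ((4 * π : ℝ) : ℂ) ^ (-(1 / 2) : ℂ) *
          (Complex.Gamma (s - 1 / 2) / Complex.Gamma s) * B (1 / 2 - s)) ∧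
      AnalyticAt ℂ Z 0 ∧
      Z 0 = 0 ∧
      CircleLaplace.logDet Z = B (1 / 2) ∧
      DifferentiableOn ℝ (CircleLaplace.expOmega Q lam) (Set.Ioi 0) ∧
      MeasureTheory.IntegrableOn
        (fun t : ℝ => (t : ℂ) ^ (-(1 / 2) : ℂ) * deriv (CircleLaplace.expOmega Q lam) t)
        (Set.Ioi 0) ∧
      B (1 / 2) = -((π : ℝ) : ℂ) ^ (-(1 / 2) : ℂ) *
        ∫ t in Set.Ioi (0 : ℝ),
          (t : ℂ) ^ (-(1 / 2) : ℂ) * deriv (CircleLaplace.expOmega Q lam) t := by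
  obtain ⟨hs, hP⟩ := CircleLaplace.polyApprox_Omega ha Q
  exact ⟨hs, CircleLaplace.conclusion_of_polyApprox (CircleLaplace.lt_eigenvalue Q hlam) hs hP⟩
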